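/- Let $b>0$. For $k\in\mathbb{R}$ let $h(k) = -\frac{d^2}{dx^2} + (k-b|x|)^2$, as a self-adjoint operator in $L^2(\mathbb{R})$, and let $h^+(k)$ be its restriction to the even functions. Let $\omega_1(k)<\omega_2(k)<\cdots$ be the eigenvalues of $h(k)$ and $\omega_1^+(k)<\omega_2^+(k)<\cdots$ those of $h^+(k)$, listed in increasing order. Put $\mathfrak{e}_0(b)=0$ and $\mathfrak{e}_j(b)=(2j-1)b$ for $j\ge 1$. Let $j\ge 1$. For all $k \in \mathbb{R}$ we have $\omega_j^+(k)=\omega_{2j-1}(k)$; this number is an eigenvalue of $h(k)$ with a real $L^2(\mathbb{R})$-normalized eigenfunction, and every such eigenfunction is even. The function $\omega_{2j-1}$ is differentiable on $\mathbb{R}$, and there is a point $$\kappa_j\in\bigl(0,\ \mathfrak{e}_{2j-1}(b)^{1/2}\bigr)=\bigl(0,\ ((4j-3)b)^{1/2}\bigr)$$ with the following properties. 1. $\kappa_j$ is the unique critical point and the unique local extremum of $\omega_{2j-1}$ on $\mathbb{R}$, and it is a strict global minimum: $\omega_{2j-1}(\kappa_j)<\omega_{2j-1}(k)$ for all $k\neq\kappa_j$.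 2. $\kappa_j$ is the unique real solution of $\omega_{2j-1}(k)-k^2=0$, and the minimum value $\mathcal{E}_j=\omega_{2j-1}(\kappa_j)=\kappa_j^2$ satisfies $\mathfrak{e}_{j-1}(b)<\mathcal{E}_j<\mathfrak{e}_j(b)$. 3. $\omega_{2j-1}$ is twice differentiable at $\kappa_j$ and $$\omega_{2j-1}''(\kappa_j)=\frac{4\kappa_j}{b}\,\psi_{2j-1}(0,\kappa_j)^2>0,$$ where $\psi_{2j-1}(\cdot,\kappa_j)$ is any real $L^2(\mathbb{R})$-normalized eigenfunction of $h(\kappa_j)$ with eigenvalue $\omega_{2j-1}(\kappa_j)$ (taken continuous). 4. $\omega_{2j-1}'(k)<0$ for $k<\kappa_j$ and $\omega_{2j-1}'(k)>0$ for $k>\kappa_j$. -/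

import Mathlib

open MeasureTheory Set

noncomputable section

namespace MagneticEdge

/-- The complex Hilbert space `L²(ℝ)`. -/
abbrev L2R : Type := Lp ℂ 2 (volume : Measure ℝ)

/-- The effective potential `V(x, k) = (k - b|x|)²`. -/
def effPotential (b k x : ℝ) : ℝ := (k - b * |x|) ^ 2

/-- `IsFiberPair b k u f` says that `u` has a `C¹` representative `g` whose derivative `p` is
locally absolutely continuous and that `-g'' + (k - b|x|)² g = f` almost everywhere (the equation
is written in its integrated form, the integrand being locally integrable). -/
def IsFiberPair (b k : ℝ) (u f : L2R) : Prop :=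
  ∃ g p : ℝ → ℂ, (u : ℝ → ℂ) =ᵐ[volume] g ∧ (∀ x, HasDerivAt g (p x) x) ∧
    ∀ x, p x - p 0 = ∫ t in (0 : ℝ)..x, ((effPotential b k t : ℂ) * g t - f t)

theorem intervalIntegrable_L2R (f : L2R) (x y : ℝ) :
    IntervalIntegrable (f : ℝ → ℂ) volume x y :=
  (LocallyIntegrable.integrableOn_isCompact ((Lp.memLp f).locallyIntegrable (by norm_num))
    isCompact_uIcc).intervalIntegrable

theorem continuous_effPotential (b k : ℝ) :
    Continuous fun t : ℝ => (effPotential b k t : ℂ) := by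
  unfold effPotential
  fun_prop

theorem intervalIntegrable_fiber (b k : ℝ) {g p : ℝ → ℂ} (hg : ∀ x, HasDerivAt g (p x) x)
    (f : L2R) (x y : ℝ) :
    IntervalIntegrable (fun t => (effPotential b k t : ℂ) * g t - f t) volume x y := by
  have hc : Continuous g := continuous_iff_continuousAt.2 fun x => (hg x).continuousAt
  exact (((continuous_effPotential b k).mul hc).intervalIntegrable x y).sub
    (intervalIntegrable_L2R f x y)

/-- The graph of the fiber operator `h(k)`. -/
def fiberGraph (b k : ℝ) : Submodule ℂ (L2R × L2R) where
  carrier := {z | IsFiberPair b k z.1 z.2}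
  zero_mem' := by
    refine ⟨fun _ => 0, fun _ => 0, Lp.coeFn_zero _ _ _, fun x => hasDerivAt_const x 0, ?_⟩
    intro x
    simp
  add_mem' := by
    rintro ⟨u, f⟩ ⟨v, f'⟩ ⟨g, p, hu, hg, hp⟩ ⟨g', p', hu', hg', hp'⟩
    refine ⟨fun x => g x + g' x, fun x => p x + p' x, ?_, fun x => (hg x).add (hg' x), ?_⟩
    · filter_upwards [Lp.coeFn_add u v, hu, hu'] with x h1 h2 h3
      simpa [h2, h3] using h1
    · intro x
      have e : p x + p' x - (p 0 + p' 0) = (p x - p 0) + (p' x - p' 0) := by ring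
      rw [e, hp x, hp' x, ← intervalIntegral.integral_add (intervalIntegrable_fiber b k hg f 0 x)
        (intervalIntegrable_fiber b k hg' f' 0 x)]
      apply intervalIntegral.integral_congr_ae
      filter_upwards [Lp.coeFn_add f f'] with t ht _
      simp only [Prod.mk_add_mk, ht, Pi.add_apply]
      ring
  smul_mem' := by
    rintro c ⟨u, f⟩ ⟨g, p, hu, hg, hp⟩
    refine ⟨fun x => c * g x, fun x => c * p x, ?_, fun x => (hg x).const_mul c, ?_⟩
    · filter_upwards [Lp.coeFn_smul c u, hu] with x h1 h2
      simpa [h2] using h1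
    · intro x
      rw [← mul_sub, hp x, ← intervalIntegral.integral_const_mul]
      apply intervalIntegral.integral_congr_ae
      filter_upwards [Lp.coeFn_smul c f] with t ht _
      simp only [Prod.smul_mk, ht, Pi.smul_apply, smul_eq_mul]
      ring

/-- The graph is single-valued, so that it is the graph of a linear operator. -/
theorem fiberGraph_functional (b k : ℝ) :
    ∀ z ∈ fiberGraph b k, z.1 = 0 → z.2 = 0 := by
  rintro ⟨u, f⟩ ⟨g, p, hu, hg, hp⟩ hu0
  simp only at hu0 hu hp ⊢
  subst hu0
  have hc : Continuous g := continuous_iff_continuousAt.2 fun x => (hg x).continuousAt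
  have hg0 : g = fun _ => 0 := by
    refine (Continuous.ae_eq_iff_eq volume hc continuous_const).1 ?_
    filter_upwards [hu, Lp.coeFn_zero ℂ 2 (volume : Measure ℝ)] with x h1 h2
    rw [← h1, h2]
    rfl
  have hp0 : ∀ x, p x = 0 := fun x => by
    have := hg x
    rw [hg0] at this
    exact this.unique (hasDerivAt_const x 0)
  have hint : ∀ x : ℝ, ∫ t in (0 : ℝ)..x, (f : ℝ → ℂ) t = 0 := by
    intro x
    have := hp x
    simpa [hp0, hg0, intervalIntegral.integral_neg] using this
  have hloc : LocallyIntegrable (f : ℝ → ℂ) volume :=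
    (Lp.memLp f).locallyIntegrable (by norm_num)
  rw [Lp.eq_zero_iff_ae_eq_zero]
  filter_upwards [LocallyIntegrable.ae_hasDerivAt_integral hloc] with x hx
  have h1 := hx 0
  simp only [hint] at h1
  exact h1.unique (hasDerivAt_const x 0)

/-- The fiber operator `h(k) = -d²/dx² + (k - b|x|)²` in `L²(ℝ)`, on its maximal domain
`{u ∈ L² : u, u' locally absolutely continuous, -u'' + (k - b|x|)² u ∈ L²}`. Since the potential is
continuous and nonnegative, this is the unique self-adjoint extension of the differential
expression on `C₀^∞(ℝ)`. -/
def fiberOperator (b k : ℝ) : L2R →ₗ.[ℂ] L2R := (fiberGraph b k).toLinearPMap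

theorem mem_graph_fiberOperator (b k : ℝ) (u f : L2R) :
    (u, f) ∈ (fiberOperator b k).graph ↔ IsFiberPair b k u f := by
  rw [fiberOperator, Submodule.toLinearPMap_graph_eq _ (fun x h h' =>
    fiberGraph_functional b k x h h')]
  rfl

/-- The subspace `H₊` of even functions in `L²(ℝ)`. -/
def evenSubspace : Submodule ℂ L2R where
  carrier := {u | ∀ᵐ x ∂(volume : Measure ℝ), (u : ℝ → ℂ) (-x) = u x}
  zero_mem' := by
    have h := Lp.coeFn_zero ℂ 2 (volume : Measure ℝ)
    have h' := (Measure.measurePreserving_neg (volume : Measure ℝ)).quasiMeasurePreserving.ae h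
    filter_upwards [h, h'] with x h1 h2
    rw [h1, h2]
    rfl
  add_mem' := by
    intro u v hu hv
    simp only [mem_ofPred_eq] at hu hv ⊢
    have h := Lp.coeFn_add u v
    have h' := (Measure.measurePreserving_neg (volume : Measure ℝ)).quasiMeasurePreserving.ae h
    filter_upwards [h, h', hu, hv] with x h1 h2 h3 h4
    rw [h1, h2, Pi.add_apply, Pi.add_apply, h3, h4]
  smul_mem' := by
    intro c u hu
    simp only [mem_ofPred_eq] at hu ⊢
    have h := Lp.coeFn_smul c u
    have h' := (Measure.measurePreserving_neg (volume : Measure ℝ)).quasiMeasurePreserving.ae h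
    filter_upwards [h, h', hu] with x h1 h2 h3
    rw [h1, h2, Pi.smul_apply, Pi.smul_apply, h3]

/-- The restriction `h⁺(k)` of `h(k)` to the even functions. -/
def evenFiberOperator (b k : ℝ) : L2R →ₗ.[ℂ] L2R :=
  (fiberOperator b k).domRestrict evenSubspace

/-- The set of real eigenvalues of an operator in `L²(ℝ)`. -/
def eigenvalues (T : L2R →ₗ.[ℂ] L2R) : Set ℝ :=
  {E | ∃ u : T.domain, (u : L2R) ≠ 0 ∧ T u = (E : ℂ) • (u : L2R)}

/-- The eigenvalues of `T` listed in increasing order, starting at index `0`: the smallest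
eigenvalue, then repeatedly the smallest eigenvalue above the previous one. -/
def eigenvalueList (T : L2R →ₗ.[ℂ] L2R) : ℕ → ℝ
  | 0 => sInf (eigenvalues T)
  | n + 1 => sInf {E ∈ eigenvalues T | eigenvalueList T n < E}

/-- The band function `ω_n(k)`, `n ≥ 1`: the `n`-th eigenvalue of `h(k)`. -/
def bandFunction (b : ℝ) (n : ℕ) (k : ℝ) : ℝ := eigenvalueList (fiberOperator b k) (n - 1)

/-- The even band function `ω_j⁺(k)`, `j ≥ 1`: the `j`-th eigenvalue of `h⁺(k)`. -/
def evenBandFunction (b : ℝ) (j : ℕ) (k : ℝ) : ℝ :=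
  eigenvalueList (evenFiberOperator b k) (j - 1)

/-- `ψ` is (the continuous representative of) a real `L²`-normalized eigenfunction of `h(k)` with
eigenvalue `E`. -/
def IsNormalizedEigenfunction (b k E : ℝ) (ψ : ℝ → ℝ) : Prop :=
  Continuous ψ ∧ ∃ u : (fiberOperator b k).domain,
    ((u : L2R) : ℝ → ℂ) =ᵐ[volume] (fun x => (ψ x : ℂ)) ∧ ‖(u : L2R)‖ = 1 ∧
      fiberOperator b k u = (E : ℂ) • (u : L2R)

/-- The harmonic oscillator levels `e_0(b) = 0`, `e_j(b) = (2j - 1) b` for `j ≥ 1`. -/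
def landauLevel (b : ℝ) (j : ℕ) : ℝ := if j = 0 then 0 else (2 * (j : ℝ) - 1) * b

end MagneticEdge

end

noncomputable section

namespace MagneticEdge

open Filter Topology

/-! On each half-line, with `t = |x| + s` and `s = -k/b`, the eigenvalue equation becomes the
oscillator equation `u'' = (b² t² - E) u`. Its solutions that are square-integrable at `+∞` are the
multiples of one function `u_E`. An eigenfunction of `h(k)` is therefore an even or an odd extension
of `u_E(|x| + s)`, and the matching condition at `x = 0` is `u_E'(s) = 0` or `u_E(s) = 0`.
Everything reduces to the dependence of `u_E` on `E ≥ 0` and `s`; it is realized by a contour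
integral, which gives joint continuity and locally uniform decay.

The Wronskian of `u_E` and `u_{E'}` at `s` is `(E' - E) ∫_s^∞ u_E u_{E'}` (`wronskian_decayingSol`).
Hence the angle `θ(E, s)` of the vector `(u_E(s), u_E'(s))` is strictly increasing in `E`
(`decayingSol_eq_cos`, `strictMono_phaseAngle`). It starts in `(-π/2, 0)` at `E = 0` and is
unbounded, so there is one eigenvalue for each equation `θ = nπ/2`, `n ≥ 0`. Even `n` gives the even
states.

The same identity yields `ω' = (k² - ω) D` with `D > 0` and continuous (`hasDerivAt_evenBand`). For
`k ≤ 0` one has `ω > k²`, because otherwise `[s, ∞)` would be classically forbidden and `u u' < 0`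
there, against `u'(s) = 0`. So every zero of `ω - k²` lies at some `k > 0`, where its derivative is
`-2k < 0`: there is at most one. If there were none up to `√M`, with `M ≥ ω(0)`, then `ω` would
decrease on `[0, √M]`, forcing `ω(√M) < M = (√M)²`. The sign of `ω'` and the second derivative `2κ
D(κ)` follow (`band_shape`).

The bounds by Landau levels compare `ω` with `E = (2n+1) b`, where `u_E` is a Hermite function. It
has at most `n` zeros, which bounds `θ` above (`phaseAngle_landau_lt`); its parity gives `θ(t) +
θ(-t) = 2 θ(0)`, which bounds `θ` below at the left turning point (`phaseAngle_landau_gt`). -/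

/-! ### Second-order linear equations: uniqueness, Wronskians, Sturm comparison -/

/-- `u` solves `u'' = q u` at the points of `S`, with derivative `v`. -/
def SolvesOn (q u v : ℝ → ℝ) (S : Set ℝ) : Prop :=
  ∀ x ∈ S, HasDerivAt u (v x) x ∧ HasDerivAt v (q x * u x) x

theorem SolvesOn.mono {q u v : ℝ → ℝ} {S S' : Set ℝ} (h : SolvesOn q u v S) (hS : S' ⊆ S) :
    SolvesOn q u v S' := fun x hx => h x (hS hx)

theorem SolvesOn.comp_neg {q u v : ℝ → ℝ} {S : Set ℝ} (h : SolvesOn q u v S) :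
    SolvesOn (fun x => q (-x)) (fun x => u (-x)) (fun x => -v (-x)) (Neg.neg ⁻¹' S) := by
  intro x hx
  obtain ⟨h1, h2⟩ := h (-x) hx
  refine ⟨?_, ?_⟩
  · simpa [Function.comp_def] using h1.comp x (hasDerivAt_neg x)
  · exact (h2.comp x (hasDerivAt_neg x)).neg.congr_deriv (by simp)

theorem SolvesOn.comp_add {q u v : ℝ → ℝ} {S : Set ℝ} (h : SolvesOn q u v S) (s : ℝ) :
    SolvesOn (fun x => q (x + s)) (fun x => u (x + s)) (fun x => v (x + s))
      ((fun x => x + s) ⁻¹' S) := by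
  intro x hx
  obtain ⟨h1, h2⟩ := h (x + s) hx
  exact ⟨h1.comp_add_const x s, h2.comp_add_const x s⟩

theorem SolvesOn.sub_mul {q u v u' v' : ℝ → ℝ} {S : Set ℝ} (h : SolvesOn q u v S)
    (h' : SolvesOn q u' v' S) (c : ℝ) :
    SolvesOn q (fun x => u x - c * u' x) (fun x => v x - c * v' x) S := by
  intro x hx
  refine ⟨(h x hx).1.sub ((h' x hx).1.const_mul c), ?_⟩
  refine HasDerivAt.congr_deriv ((h x hx).2.sub ((h' x hx).2.const_mul c)) ?_
  ring

theorem SolvesOn.const_mul {q u v : ℝ → ℝ} {S : Set ℝ} (h : SolvesOn q u v S) (c : ℝ) :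
    SolvesOn q (fun x => c * u x) (fun x => c * v x) S := by
  intro x hx
  refine ⟨(h x hx).1.const_mul c, ?_⟩
  refine HasDerivAt.congr_deriv ((h x hx).2.const_mul c) ?_
  ring

/-- Solutions with vanishing Cauchy data at `a` vanish to the right of `a`. -/
theorem SolvesOn.eq_zero_Ici {q u v : ℝ → ℝ} {a : ℝ} (h : SolvesOn q u v (Ici a))
    (hq : Continuous q) (hu : u a = 0) (hv : v a = 0) :
    ∀ x, a ≤ x → u x = 0 ∧ v x = 0 := by
  intro y hy
  obtain ⟨K, hK⟩ := (isCompact_Icc (a := a) (b := y)).exists_bound_of_continuousOn hq.continuousOn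
  -- Grönwall weight: with `|q| ≤ K` on the interval, `(u² + v²)' = 2uv(1 + q) ≤ (1 + K)(u² + v²)`.
  set f : ℝ → ℝ := fun x => (u x ^ 2 + v x ^ 2) * Real.exp (-(1 + K) * x) with hf
  have hd : ∀ x ∈ Icc a y, HasDerivAt f ((2 * u x * v x * (1 + q x) -
      (1 + K) * (u x ^ 2 + v x ^ 2)) * Real.exp (-(1 + K) * x)) x := by
    intro x hx
    obtain ⟨h1, h2⟩ := h x hx.1
    have h3 : HasDerivAt (fun x : ℝ => Real.exp (-(1 + K) * x))
        (Real.exp (-(1 + K) * x) * (-(1 + K) * 1)) x :=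
      ((hasDerivAt_id x).const_mul (-(1 + K))).exp
    refine HasDerivAt.congr_deriv (((h1.pow 2).add (h2.pow 2)).mul h3) ?_
    simp only [Pi.add_apply, Pi.pow_apply]
    push_cast
    ring
  have hanti : AntitoneOn f (Icc a y) := by
    apply antitoneOn_of_deriv_nonpos (convex_Icc a y)
    · exact fun x hx => (hd x hx).continuousAt.continuousWithinAt
    · intro x hx
      exact (hd x (interior_subset hx)).differentiableAt.differentiableWithinAt
    · intro x hx
      have hx := interior_subset hx
      rw [(hd x hx).deriv]
      apply mul_nonpos_of_nonpos_of_nonneg _ (Real.exp_pos _).le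
      have hb : |q x| ≤ K := hK x hx
      have h1 : |2 * u x * v x * (1 + q x)| ≤ (u x ^ 2 + v x ^ 2) * (1 + K) := by
        rw [abs_mul]
        apply mul_le_mul _ _ (abs_nonneg _) (by positivity)
        · rw [abs_le]
          constructor <;> nlinarith [sq_nonneg (u x + v x), sq_nonneg (u x - v x)]
        · exact (abs_add_le _ _).trans (by simpa using hb)
      have := le_abs_self (2 * u x * v x * (1 + q x))
      linarith
  have h0 : f y ≤ f a := hanti ⟨le_rfl, hy⟩ ⟨hy, le_rfl⟩ hy
  have h1 : f a = 0 := by simp [hf, hu, hv]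
  rw [h1] at h0
  have h2 : u y ^ 2 + v y ^ 2 ≤ 0 := by
    by_contra! hc
    exact absurd h0 (not_le.2 (mul_pos hc (Real.exp_pos _)))
  constructor <;> nlinarith [sq_nonneg (u y), sq_nonneg (v y)]

/-- Solutions on the line with vanishing Cauchy data at a point vanish. -/
theorem SolvesOn.eq_zero {q u v : ℝ → ℝ} {a : ℝ} (h : SolvesOn q u v univ)
    (hq : Continuous q) (hu : u a = 0) (hv : v a = 0) (x : ℝ) : u x = 0 ∧ v x = 0 := by
  rcases le_total a x with hx | hx
  · exact (h.mono (subset_univ _)).eq_zero_Ici hq hu hv x hx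
  · have := (h.comp_neg.mono (subset_univ (Ici (-a)))).eq_zero_Ici (hq.comp continuous_neg)
      (by simpa using hu) (by simpa using hv) (-x) (by linarith)
    simpa using this

theorem SolvesOn.continuousOn {q u v : ℝ → ℝ} {S : Set ℝ} (h : SolvesOn q u v S) :
    ContinuousOn u S ∧ ContinuousOn v S :=
  ⟨fun x hx => (h x hx).1.continuousAt.continuousWithinAt,
    fun x hx => (h x hx).2.continuousAt.continuousWithinAt⟩

theorem SolvesOn.hasDerivAt_wronskian {q q' u v u' v' : ℝ → ℝ} {S : Set ℝ}
    (h : SolvesOn q u v S) (h' : SolvesOn q' u' v' S) {x : ℝ} (hx : x ∈ S) :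
    HasDerivAt (fun x => u x * v' x - v x * u' x) ((q' x - q x) * (u x * u' x)) x := by
  refine HasDerivAt.congr_deriv (((h x hx).1.mul (h' x hx).2).sub ((h x hx).2.mul (h' x hx).1)) ?_
  ring

theorem not_integrableOn_Ioi_of_le {f : ℝ → ℝ} {a c : ℝ} (hc : 0 < c) (hf : ∀ x, a ≤ x → c ≤ f x) :
    ¬ IntegrableOn f (Ioi a) := by
  intro h
  have h1 : IntegrableOn (fun _ : ℝ => c) (Ioi a) := by
    refine Integrable.mono' h aestronglyMeasurable_const ?_
    refine (ae_restrict_iff' measurableSet_Ioi).2 (Filter.Eventually.of_forall fun x hx => ?_)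
    rw [Real.norm_of_nonneg hc.le]
    exact hf x (le_of_lt hx)
  rw [integrableOn_const_iff] at h1
  simp [hc.ne'] at h1

theorem monotoneOn_Ici_of_hasDerivAt {f f' : ℝ → ℝ} {a : ℝ}
    (hf : ∀ x, a ≤ x → HasDerivAt f (f' x) x) (hf' : ∀ x, a ≤ x → 0 ≤ f' x) :
    MonotoneOn f (Ici a) := by
  apply monotoneOn_of_deriv_nonneg (convex_Ici a)
  · exact fun x hx => (hf x hx).continuousAt.continuousWithinAt
  · intro x hx
    exact (hf x (interior_subset hx)).differentiableAt.differentiableWithinAt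
  · intro x hx
    rw [(hf x (interior_subset hx)).deriv]
    exact hf' x (interior_subset hx)

/-- A square-integrable solution is non-increasing in modulus where the potential is
nonnegative. -/
theorem SolvesOn.mul_nonpos {q u v : ℝ → ℝ} {a : ℝ} (h : SolvesOn q u v (Ici a))
    (hq : ∀ x, a ≤ x → 0 ≤ q x) (hu : IntegrableOn (fun x => u x ^ 2) (Ioi a)) :
    ∀ x, a ≤ x → u x * v x ≤ 0 := by
  intro x hx
  by_contra! hpos
  -- `(u u')' = u'² + q u² ≥ 0`, so a positive value of `u u'` persists to the right; then `u²` is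
  -- nondecreasing and cannot be integrable.
  have h1 : MonotoneOn (fun x => u x * v x) (Ici a) := by
    apply monotoneOn_Ici_of_hasDerivAt (f' := fun x => v x * v x + u x * (q x * u x))
    · exact fun y hy => (h y hy).1.mul (h y hy).2
    · intro y hy
      have := mul_nonneg (hq y hy) (sq_nonneg (u y))
      nlinarith [sq_nonneg (v y)]
  have h2 : MonotoneOn (fun x => u x ^ 2) (Ici x) := by
    apply monotoneOn_Ici_of_hasDerivAt (f' := fun x => 2 * (u x * v x))
    · intro y hy
      refine HasDerivAt.congr_deriv ((h y (hx.trans hy)).1.pow 2) ?_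
      push_cast
      ring
    · intro y hy
      have := h1 (mem_Ici.2 hx) (mem_Ici.2 (hx.trans hy)) hy
      simp only at this
      linarith
  have hne : u x ≠ 0 := by
    rintro h0
    simp [h0] at hpos
  exact not_integrableOn_Ioi_of_le (a := x) (c := u x ^ 2) (by positivity)
    (fun y hy => h2 (mem_Ici.2 le_rfl) hy hy) (hu.mono_set (Ioi_subset_Ioi hx))

/-- The product `u u'` is nondecreasing and nonpositive, so if it vanishes at one point it vanishes
from there on. Its derivative `u'² + q u²` is then zero, `u` is constant, and square-integrability
forces the trivial solution. -/
theorem SolvesOn.mul_neg {q u v : ℝ → ℝ} {a : ℝ} (h : SolvesOn q u v (Ici a))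
    (hq : ∀ x, a ≤ x → 0 ≤ q x) (hu : IntegrableOn (fun x => u x ^ 2) (Ioi a))
    (hne : ∀ x, a ≤ x → ¬ (u x = 0 ∧ v x = 0)) :
    ∀ x, a ≤ x → u x * v x < 0 := by
  intro x hx
  refine lt_of_le_of_ne (h.mul_nonpos hq hu x hx) fun h0 => ?_
  have hd : ∀ y, x ≤ y → HasDerivAt (fun x => u x * v x) (v y * v y + u y * (q y * u y)) y :=
    fun y hy => (h y (hx.trans hy)).1.mul (h y (hx.trans hy)).2
  have h1 : MonotoneOn (fun x => u x * v x) (Ici x) := by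
    apply monotoneOn_Ici_of_hasDerivAt hd
    intro y hy
    have := mul_nonneg (hq y (hx.trans hy)) (sq_nonneg (u y))
    nlinarith [sq_nonneg (v y)]
  have h2 : ∀ y, x ≤ y → u y * v y = 0 := by
    intro y hy
    refine le_antisymm (h.mul_nonpos hq hu y (hx.trans hy)) ?_
    have := h1 (mem_Ici.2 le_rfl) hy hy
    simp only at this
    linarith
  have h3 : ∀ y, x < y → v y = 0 := by
    intro y hy
    have e : (fun x => u x * v x) =ᶠ[nhds y] fun _ => 0 := by
      filter_upwards [Ioi_mem_nhds hy] with z hz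
      exact h2 z (le_of_lt hz)
    have := (hd y hy.le).unique ((hasDerivAt_const y (0 : ℝ)).congr_of_eventuallyEq e)
    have hqy := mul_nonneg (hq y (hx.trans hy.le)) (sq_nonneg (u y))
    nlinarith [sq_nonneg (v y)]
  have h4 : ∀ y, x + 1 ≤ y → u y ^ 2 = u (x + 1) ^ 2 := by
    intro y hy
    rcases hy.eq_or_lt with rfl | hy
    · rfl
    have hc := constant_of_has_deriv_right_zero (f := u) (a := x + 1) (b := y)
      ((h.continuousOn.1).mono fun z hz => mem_Ici.2 (by linarith [hz.1])) (fun z hz => by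
        have h5 := (h z (mem_Ici.2 (by linarith [hz.1]))).1
        rw [h3 z (by linarith [hz.1])] at h5
        exact h5.hasDerivWithinAt)
    rw [hc y ⟨hy.le, le_rfl⟩]
  have hne' : u (x + 1) ≠ 0 := fun h5 =>
    hne (x + 1) (by linarith) ⟨h5, h3 _ (by linarith)⟩
  exact not_integrableOn_Ioi_of_le (a := x + 1) (c := u (x + 1) ^ 2) (by positivity)
    (fun y hy => (h4 y hy).ge) (hu.mono_set (Ioi_subset_Ioi (by linarith)))

/-- Two square-integrable solutions of the same equation, one of them with square-integrable
derivative, have vanishing Wronskian. -/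
theorem SolvesOn.wronskian_eq_zero {q u v u' v' : ℝ → ℝ} {a : ℝ}
    (h : SolvesOn q u v (Ici a)) (h' : SolvesOn q u' v' (Ici a))
    (hu : IntegrableOn (fun x => u x ^ 2) (Ioi a))
    (hu' : IntegrableOn (fun x => u' x ^ 2) (Ioi a))
    (hv' : IntegrableOn (fun x => v' x ^ 2) (Ioi a)) :
    ∀ x, a ≤ x → u x * v' x - v x * u' x = 0 := by
  have hconst : ∀ x, a ≤ x → u x * v' x - v x * u' x = u a * v' a - v a * u' a := by
    intro x hx
    refine constant_of_has_deriv_right_zero (f := fun x => u x * v' x - v x * u' x)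
      (a := a) (b := x) ?_ ?_ x ⟨hx, le_rfl⟩
    · intro z hz
      exact (h.hasDerivAt_wronskian h' hz.1).continuousAt.continuousWithinAt
    · intro z hz
      have := h.hasDerivAt_wronskian h' (x := z) hz.1
      simpa using this.hasDerivWithinAt
  intro x hx
  rw [hconst x hx]
  by_contra hW
  set W := u a * v' a - v a * u' a with hWdef
  have cu := h.continuousOn.1
  have cu' := h'.continuousOn.1
  have cv' := h'.continuousOn.2
  have meas : ∀ {f : ℝ → ℝ}, ContinuousOn f (Ici a) →
      AEStronglyMeasurable f (volume.restrict (Ioi a)) := fun hf =>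
    (hf.mono Ioi_subset_Ici_self).aestronglyMeasurable measurableSet_Ioi
  have hprod : ∀ {f : ℝ → ℝ}, ContinuousOn f (Ici a) → IntegrableOn (fun x => f x ^ 2) (Ioi a) →
      IntegrableOn (fun x => u x * f x) (Ioi a) := by
    intro f hf hf2
    refine Integrable.mono' (hu.add hf2) ((meas cu).mul (meas hf)) (Filter.Eventually.of_forall ?_)
    intro y
    simp only [Pi.add_apply, Real.norm_eq_abs]
    rw [abs_le]
    constructor <;> nlinarith [sq_nonneg (u y + f y), sq_nonneg (u y - f y)]
  have i1 := hprod cu' hu'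
  have i2 := hprod cv' hv'
  set M := ∫ y in Ioi a, ‖u y * v' y‖ with hM
  -- `u u'` differs from `- W x` by a bounded function
  have key : ∀ y, a ≤ y → u y * u' y = u a * u' a - W * (y - a) +
      2 * ∫ z in a..y, u z * v' z := by
    intro y hy
    have hd : ∀ z ∈ uIcc a y, HasDerivAt (fun z => u z * u' z) (2 * (u z * v' z) - W) z := by
      intro z hz
      rw [uIcc_of_le hy] at hz
      refine HasDerivAt.congr_deriv ((h z hz.1).1.mul (h' z hz.1).1) ?_
      have := hconst z hz.1
      linarith
    have hi : IntervalIntegrable (fun z => u z * v' z) volume a y := by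
      rw [intervalIntegrable_iff_integrableOn_Ioc_of_le hy]
      exact i2.mono_set Ioc_subset_Ioi_self
    have := intervalIntegral.integral_eq_sub_of_hasDerivAt hd
      ((hi.const_mul 2).sub intervalIntegrable_const)
    rw [intervalIntegral.integral_sub (hi.const_mul 2) intervalIntegrable_const,
      intervalIntegral.integral_const_mul, intervalIntegral.integral_const, smul_eq_mul] at this
    linarith
  have hbound : ∀ y, a ≤ y → |∫ z in a..y, u z * v' z| ≤ M := by
    intro y hy
    rw [intervalIntegral.integral_of_le hy]
    refine (norm_integral_le_integral_norm (μ := volume.restrict (Ioc a y))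
      (fun z => u z * v' z)).trans ?_
    exact setIntegral_mono_set i2.norm (Filter.Eventually.of_forall fun _ => norm_nonneg _)
      (Ioc_subset_Ioi_self.eventuallyLE)
  have hWpos : 0 < |W| := abs_pos.2 hW
  -- Beyond `a + B` the linear term `W (y - a)` exceeds the bounded terms by at least `1`, so `|u
  -- u'| ≥ 1` there, against the integrability of `u u'`.
  set B := (1 + 2 * M + |u a * u' a|) / |W| with hB
  have hMnn : 0 ≤ M := integral_nonneg fun _ => norm_nonneg _
  have hBnn : 0 ≤ B := by positivity
  refine not_integrableOn_Ioi_of_le (a := a + B) (c := 1) one_pos (f := fun y => |u y * u' y|) ?_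
    (IntegrableOn.mono_set (Integrable.norm i1) (Ioi_subset_Ioi (by linarith)))
  intro y hy
  have hay : a ≤ y := by linarith
  have e1 : W * (y - a) = u a * u' a + 2 * (∫ z in a..y, u z * v' z) - u y * u' y := by
    linarith [key y hay]
  have e2 : |W| * (y - a) ≤ |u a * u' a| + 2 * M + |u y * u' y| := by
    calc |W| * (y - a) = |W * (y - a)| := by rw [abs_mul, abs_of_nonneg (by linarith : 0 ≤ y - a)]
      _ ≤ |u a * u' a + 2 * (∫ z in a..y, u z * v' z)| + |u y * u' y| := by
        rw [e1]; exact abs_sub _ _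
      _ ≤ _ := by
        have h1 := abs_add_le (u a * u' a) (2 * (∫ z in a..y, u z * v' z))
        have h2 := hbound y hay
        rw [abs_mul 2, abs_two] at h1
        linarith
  have e3 : 1 + 2 * M + |u a * u' a| ≤ |W| * (y - a) := by
    have : B * |W| = 1 + 2 * M + |u a * u' a| := div_mul_cancel₀ _ hWpos.ne'
    nlinarith
  linarith

/-- Sturm comparison with `sin (c x)`. -/
theorem SolvesOn.exists_zero {q u v : ℝ → ℝ} {a c : ℝ} (hc : 0 < c)
    (h : SolvesOn q u v (Icc a (a + Real.pi / c)))
    (hq : ∀ x ∈ Icc a (a + Real.pi / c), q x ≤ -c ^ 2) :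
    ∃ x ∈ Icc a (a + Real.pi / c), u x = 0 := by
  by_contra! hne
  have hpc : 0 < Real.pi / c := div_pos Real.pi_pos hc
  set d := a + Real.pi / c with hd
  have had : a < d := by linarith
  have main : ∀ {u v : ℝ → ℝ}, SolvesOn q u v (Icc a d) → (∀ x ∈ Icc a d, 0 < u x) → False := by
    intro u v h hpos
    have hs : ∀ x, HasDerivAt (fun x => Real.sin (c * (x - a))) (c * Real.cos (c * (x - a))) x := by
      intro x
      have : HasDerivAt (fun x => c * (x - a)) (c * 1) x :=
        ((hasDerivAt_id x).sub_const a).const_mul c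
      refine HasDerivAt.congr_deriv (this.sin) ?_
      ring
    have hs' : ∀ x, HasDerivAt (fun x => c * Real.cos (c * (x - a)))
        (-c ^ 2 * Real.sin (c * (x - a))) x := by
      intro x
      have : HasDerivAt (fun x => c * (x - a)) (c * 1) x :=
        ((hasDerivAt_id x).sub_const a).const_mul c
      refine HasDerivAt.congr_deriv (this.cos.const_mul c) ?_
      ring
    have hsol : SolvesOn (fun _ => -c ^ 2) (fun x => Real.sin (c * (x - a)))
        (fun x => c * Real.cos (c * (x - a))) (Icc a d) := fun x _ => ⟨hs x, hs' x⟩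
    have hmono : MonotoneOn (fun x => u x * (c * Real.cos (c * (x - a))) -
        v x * Real.sin (c * (x - a))) (Icc a d) := by
      apply monotoneOn_of_deriv_nonneg (convex_Icc a d)
      · exact fun x hx => (h.hasDerivAt_wronskian hsol hx).continuousAt.continuousWithinAt
      · intro x hx
        exact (h.hasDerivAt_wronskian hsol
          (interior_subset hx)).differentiableAt.differentiableWithinAt
      · intro x hx
        have hx := interior_subset hx
        rw [(h.hasDerivAt_wronskian hsol hx).deriv]
        have h1 : 0 ≤ Real.sin (c * (x - a)) := by
          apply Real.sin_nonneg_of_nonneg_of_le_pi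
          · exact mul_nonneg hc.le (by linarith [hx.1])
          · have : x - a ≤ Real.pi / c := by linarith [hx.2]
            rw [le_div_iff₀ hc] at this
            linarith
        have h2 := hq x hx
        exact mul_nonneg (by linarith) (mul_nonneg (hpos x hx).le h1)
    -- The sine vanishes at both ends, so the Wronskian takes the values `c u(a) > 0` and `-c u(d) <
    -- 0`, which contradicts monotonicity.
    have h1 := hmono ⟨le_rfl, had.le⟩ ⟨had.le, le_rfl⟩ had.le
    have e : c * (d - a) = Real.pi := by rw [hd]; field_simp; ring
    simp only [e, sub_self, mul_zero, Real.cos_zero, Real.sin_zero, Real.cos_pi, Real.sin_pi] at h1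
    have h2 := mul_pos (hpos a ⟨le_rfl, had.le⟩) hc
    have h3 := mul_pos (hpos d ⟨had.le, le_rfl⟩) hc
    linarith
  have hcont := h.continuousOn.1
  rcases lt_or_gt_of_ne (hne a ⟨le_rfl, had.le⟩) with ha | ha
  · refine main (u := fun x => -1 * u x) (v := fun x => -1 * v x) (h.const_mul (-1)) fun x hx => ?_
    by_contra! hx'
    have hux : 0 ≤ u x := by linarith
    obtain ⟨z, hz, hz0⟩ := intermediate_value_Icc hx.1
      (hcont.mono (Icc_subset_Icc_right hx.2)) ⟨ha.le, hux⟩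
    exact hne z ⟨hz.1, hz.2.trans hx.2⟩ hz0
  · refine main h fun x hx => ?_
    by_contra! hx'
    obtain ⟨z, hz, hz0⟩ := intermediate_value_Icc' hx.1
      (hcont.mono (Icc_subset_Icc_right hx.2)) ⟨hx', ha.le⟩
    exact hne z ⟨hz.1, hz.2.trans hx.2⟩ hz0

/-! ### The Hankel loop integral for parabolic cylinder functions -/

/-- The circular part of the loop integral for parabolic cylinder functions. -/
def loopIntegrand (b ν x θ : ℝ) : ℝ :=
  Real.exp (2 * b * x * Real.cos θ - b * Real.cos (2 * θ)) *
    Real.cos (2 * b * x * Real.sin θ - b * Real.sin (2 * θ) - ν * θ)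

/-- The contour comes in from `-∞` below the cut, follows the unit circle, and returns above the
cut; the form integrated is `exp(2bxz - bz²) z^(-ν-1) dz`. On the circle `z = e^{iθ}` it equals, up
to a factor `i`, `exp(2bxz - bz²) e^{-iνθ} dθ`, whose real part is `loopIntegrand`. -/
def loopIntegral (b ν x : ℝ) : ℝ := ∫ θ in (-Real.pi)..Real.pi, loopIntegrand b ν x θ

/-- The modulus of the contour integrand at `z = -τ`. The two sides of the cut carry conjugate
phases, whence the factor `-2 sin(πν)` in `hankelLoop`. -/
def rayIntegrand (b ν x τ : ℝ) : ℝ := Real.exp (-2 * b * x * τ - b * τ ^ 2) * τ ^ (-ν - 1)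

def rayIntegral (b ν x : ℝ) : ℝ := ∫ τ in Ioi (1 : ℝ), rayIntegrand b ν x τ

/-- The loop (Hankel) integral representing, up to normalization and a Gaussian factor, the
parabolic cylinder function of index `ν`. -/
def hankelLoop (b ν x : ℝ) : ℝ :=
  loopIntegral b ν x - 2 * Real.sin (Real.pi * ν) * rayIntegral b ν x

theorem abs_loopIntegrand_le {b : ℝ} (hb : 0 < b) (ν x θ : ℝ) :
    |loopIntegrand b ν x θ| ≤ Real.exp (2 * b * |x| + b) := by
  rw [loopIntegrand, abs_mul, Real.abs_exp]
  refine (mul_le_of_le_one_right (Real.exp_pos _).le (Real.abs_cos_le_one _)).trans ?_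
  apply Real.exp_le_exp.2
  have h1 : x * Real.cos θ ≤ |x| := by
    refine (le_abs_self _).trans ?_
    rw [abs_mul]
    exact mul_le_of_le_one_right (abs_nonneg _) (Real.abs_cos_le_one _)
  have h2 := Real.neg_one_le_cos (2 * θ)
  nlinarith

theorem continuous_loopIntegrand (b : ℝ) :
    Continuous fun p : (ℝ × ℝ) × ℝ => loopIntegrand b p.1.1 p.1.2 p.2 := by
  unfold loopIntegrand
  fun_prop

theorem continuous_loopIntegral (b : ℝ) :
    Continuous fun p : ℝ × ℝ => loopIntegral b p.1 p.2 := by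
  unfold loopIntegral
  exact intervalIntegral.continuous_parametric_intervalIntegral_of_continuous'
    (f := fun (p : ℝ × ℝ) θ => loopIntegrand b p.1 p.2 θ) (continuous_loopIntegrand b) _ _

theorem continuous_loopIntegrand_right (b ν x : ℝ) : Continuous (loopIntegrand b ν x) := by
  unfold loopIntegrand
  fun_prop

theorem intervalIntegrable_loopIntegrand (b ν x u v : ℝ) :
    IntervalIntegrable (loopIntegrand b ν x) volume u v :=
  (continuous_loopIntegrand_right b ν x).intervalIntegrable u v

theorem abs_loopIntegral_le {b : ℝ} (hb : 0 < b) (ν x : ℝ) :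
    |loopIntegral b ν x| ≤ 2 * Real.pi * Real.exp (2 * b * |x| + b) := by
  have := intervalIntegral.norm_integral_le_of_norm_le_const (a := -Real.pi) (b := Real.pi)
    (f := loopIntegrand b ν x) (C := Real.exp (2 * b * |x| + b))
    (fun θ _ => abs_loopIntegrand_le hb ν x θ)
  rw [Real.norm_eq_abs,
    abs_of_nonneg (a := Real.pi - -Real.pi) (by linarith [Real.pi_pos])] at this
  unfold loopIntegral
  linarith

/-- Differentiation in `x` multiplies the contour integrand by `2bz`, which lowers the index `ν` by
one. -/
theorem hasDerivAt_loopIntegrand (b ν x θ : ℝ) :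
    HasDerivAt (fun x => loopIntegrand b ν x θ) (2 * b * loopIntegrand b (ν - 1) x θ) x := by
  unfold loopIntegrand
  have h1 : HasDerivAt (fun x : ℝ => 2 * b * x * Real.cos θ - b * Real.cos (2 * θ))
      (2 * b * 1 * Real.cos θ) x :=
    (((hasDerivAt_id x).const_mul (2 * b)).mul_const _).sub_const _
  have h2 : HasDerivAt (fun x : ℝ => 2 * b * x * Real.sin θ - b * Real.sin (2 * θ) - ν * θ)
      (2 * b * 1 * Real.sin θ) x :=
    ((((hasDerivAt_id x).const_mul (2 * b)).mul_const _).sub_const _).sub_const _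
  refine (h1.exp.mul h2.cos).congr_deriv ?_
  have e : 2 * b * x * Real.sin θ - b * Real.sin (2 * θ) - (ν - 1) * θ =
    (2 * b * x * Real.sin θ - b * Real.sin (2 * θ) - ν * θ) + θ := by ring
  rw [e, Real.cos_add]
  ring

theorem hasDerivAt_loopIntegral {b : ℝ} (hb : 0 < b) (ν x : ℝ) :
    HasDerivAt (loopIntegral b ν) (2 * b * loopIntegral b (ν - 1) x) x := by
  have := (intervalIntegral.hasDerivAt_integral_of_dominated_loc_of_deriv_le (μ := volume)
    (a := -Real.pi) (b := Real.pi)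
    (F := loopIntegrand b ν) (F' := fun x θ => 2 * b * loopIntegrand b (ν - 1) x θ) (x₀ := x)
    (s := Metric.ball x 1) (bound := fun _ => 2 * b * Real.exp (2 * b * (|x| + 1) + b))
    (Metric.ball_mem_nhds x one_pos)
    (Eventually.of_forall fun y => (continuous_loopIntegrand_right b ν y).aestronglyMeasurable)
    (intervalIntegrable_loopIntegrand b ν x _ _)
    ((continuous_loopIntegrand_right b (ν - 1) x).const_mul (2 * b)).aestronglyMeasurable
    (Eventually.of_forall fun θ _ y hy => by
      rw [norm_mul, Real.norm_of_nonneg (by positivity)]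
      apply mul_le_mul_of_nonneg_left _ (by positivity)
      refine (abs_loopIntegrand_le hb _ _ _).trans (Real.exp_le_exp.2 ?_)
      rw [Metric.mem_ball, Real.dist_eq] at hy
      have : |y| ≤ |x| + 1 := by
        have := abs_sub_abs_le_abs_sub y x
        linarith
      nlinarith)
    intervalIntegrable_const
    (Eventually.of_forall fun θ _ y _ => hasDerivAt_loopIntegrand b ν y θ)).2
  rw [intervalIntegral.integral_const_mul] at this
  exact this

/-- Integration of the total derivative of `exp(2bxz - bz²) z^(-ν)` over the open circle from `-π`
to `π`. The right side is the jump across the cut at `z = -1`, which the ray integrals compensate.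
-/
theorem loopIntegral_recurrence (b ν x : ℝ) :
    2 * b * x * loopIntegral b (ν - 1) x - 2 * b * loopIntegral b (ν - 2) x -
      ν * loopIntegral b ν x = -2 * Real.sin (Real.pi * ν) * Real.exp (-2 * b * x - b) := by
  -- The imaginary part of `exp(2bxz - bz²) z^(-ν)` at `z = e^{iθ}`.
  set G : ℝ → ℝ := fun θ => Real.exp (2 * b * x * Real.cos θ - b * Real.cos (2 * θ)) *
    Real.sin (2 * b * x * Real.sin θ - b * Real.sin (2 * θ) - ν * θ) with hG
  have hd : ∀ θ, HasDerivAt G (2 * b * x * loopIntegrand b (ν - 1) x θ -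
      2 * b * loopIntegrand b (ν - 2) x θ - ν * loopIntegrand b ν x θ) θ := by
    intro θ
    have c2 : HasDerivAt (fun θ : ℝ => Real.cos (2 * θ)) (-Real.sin (2 * θ) * (2 * 1)) θ :=
      ((hasDerivAt_id θ).const_mul 2).cos
    have s2 : HasDerivAt (fun θ : ℝ => Real.sin (2 * θ)) (Real.cos (2 * θ) * (2 * 1)) θ :=
      ((hasDerivAt_id θ).const_mul 2).sin
    have h1 := (((Real.hasDerivAt_cos θ).const_mul (2 * b * x)).sub (c2.const_mul b)).exp
    have h2 := ((((Real.hasDerivAt_sin θ).const_mul (2 * b * x)).sub (s2.const_mul b)).sub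
      ((hasDerivAt_id θ).const_mul ν)).sin
    refine (h1.mul h2).congr_deriv ?_
    unfold loopIntegrand
    set A := 2 * b * x * Real.sin θ - b * Real.sin (2 * θ) - ν * θ with hA
    have e1 : 2 * b * x * Real.sin θ - b * Real.sin (2 * θ) - (ν - 1) * θ = A + θ := by
      rw [hA]; ring
    have e2 : 2 * b * x * Real.sin θ - b * Real.sin (2 * θ) - (ν - 2) * θ = A + 2 * θ := by
      rw [hA]; ring
    rw [e1, e2, Real.cos_add, Real.cos_add]
    simp only [Pi.sub_apply, id]
    rw [← hA]
    ring
  have i1 := intervalIntegrable_loopIntegrand b (ν - 1) x (-Real.pi) Real.pi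
  have i2 := intervalIntegrable_loopIntegrand b (ν - 2) x (-Real.pi) Real.pi
  have i3 := intervalIntegrable_loopIntegrand b ν x (-Real.pi) Real.pi
  have key := intervalIntegral.integral_eq_sub_of_hasDerivAt (a := -Real.pi) (b := Real.pi)
    (fun θ _ => hd θ) (((i1.const_mul _).sub (i2.const_mul _)).sub (i3.const_mul _))
  rw [intervalIntegral.integral_sub ((i1.const_mul _).sub (i2.const_mul _)) (i3.const_mul _),
    intervalIntegral.integral_sub (i1.const_mul _) (i2.const_mul _),
    intervalIntegral.integral_const_mul, intervalIntegral.integral_const_mul,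
    intervalIntegral.integral_const_mul] at key
  unfold loopIntegral
  rw [key, hG]
  have e : (2 : ℝ) * -Real.pi = -(2 * Real.pi) := by ring
  simp only [Real.cos_pi, Real.sin_pi, Real.cos_neg, Real.sin_neg, e, Real.cos_two_pi,
    Real.sin_two_pi]
  have e1 : 2 * b * x * 0 - b * 0 - ν * Real.pi = -(Real.pi * ν) := by ring
  have e2 : 2 * b * x * -0 - b * -0 - ν * -Real.pi = Real.pi * ν := by ring
  have e3 : 2 * b * x * -1 - b * 1 = -2 * b * x - b := by ring
  rw [e1, e2, e3, Real.sin_neg]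
  ring

theorem integrable_exp_linear_sub_sq {b : ℝ} (hb : 0 < b) (c : ℝ) :
    Integrable fun τ : ℝ => Real.exp (c * τ - b * τ ^ 2) := by
  have h := (integrable_exp_neg_mul_sq (half_pos hb)).const_mul (Real.exp (c ^ 2 / (2 * b)))
  refine h.mono' (by fun_prop) (Eventually.of_forall fun τ => ?_)
  rw [Real.norm_of_nonneg (Real.exp_pos _).le, ← Real.exp_add]
  apply Real.exp_le_exp.2
  have : c ^ 2 / (2 * b) + -(b / 2) * τ ^ 2 - (c * τ - b * τ ^ 2) = b / 2 * (τ - c / b) ^ 2 := by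
    field_simp
    ring
  have h2 : 0 ≤ b / 2 * (τ - c / b) ^ 2 := by positivity
  linarith

theorem rayIntegrand_nonneg (b ν x : ℝ) {τ : ℝ} (hτ : 1 ≤ τ) : 0 ≤ rayIntegrand b ν x τ :=
  mul_nonneg (Real.exp_pos _).le (Real.rpow_nonneg (by linarith) _)

theorem rpow_le_exp_of_abs_le {m M τ : ℝ} (hm : |m| ≤ M) (hτ : 1 ≤ τ) :
    τ ^ m ≤ Real.exp (M * τ) := by
  rw [Real.rpow_def_of_pos (by linarith)]
  apply Real.exp_le_exp.2
  have h1 := Real.log_nonneg hτ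
  have h2 := Real.log_le_sub_one_of_pos (by linarith : 0 < τ)
  have h3 := (abs_le.1 hm).2
  have h4 : 0 ≤ M := (abs_nonneg m).trans hm
  nlinarith

theorem rayIntegrand_le {b ν x X M τ : ℝ} (hb : 0 < b) (hx : -X ≤ x) (hν : |ν| ≤ M) (hτ : 1 ≤ τ) :
    rayIntegrand b ν x τ ≤ Real.exp ((2 * b * X + M + 1) * τ - b * τ ^ 2) := by
  have h1 : τ ^ (-ν - 1) ≤ Real.exp ((M + 1) * τ) := by
    apply rpow_le_exp_of_abs_le _ hτ
    have := abs_sub (-ν) 1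
    rw [abs_neg, abs_one] at this
    linarith
  calc rayIntegrand b ν x τ ≤ Real.exp (-2 * b * x * τ - b * τ ^ 2) * Real.exp ((M + 1) * τ) :=
        mul_le_mul_of_nonneg_left h1 (Real.exp_pos _).le
    _ ≤ _ := by
      rw [← Real.exp_add]
      apply Real.exp_le_exp.2
      have : 0 ≤ b * τ * (x + X) := mul_nonneg (by positivity) (by linarith)
      nlinarith

theorem measurable_rayIntegrand (b ν x : ℝ) : Measurable (rayIntegrand b ν x) := by
  unfold rayIntegrand
  fun_prop

theorem integrableOn_rayIntegrand {b : ℝ} (hb : 0 < b) (ν x : ℝ) :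
    IntegrableOn (rayIntegrand b ν x) (Ioi 1) := by
  refine Integrable.mono' (integrable_exp_linear_sub_sq hb (2 * b * |x| + |ν| + 1)).integrableOn
    (measurable_rayIntegrand b ν x).aestronglyMeasurable ?_
  refine (ae_restrict_iff' measurableSet_Ioi).2 (Eventually.of_forall fun τ hτ => ?_)
  have hτ : (1 : ℝ) ≤ τ := le_of_lt hτ
  rw [Real.norm_of_nonneg (rayIntegrand_nonneg b ν x hτ)]
  exact rayIntegrand_le hb (neg_abs_le x) le_rfl hτ

theorem rayIntegral_nonneg (b ν x : ℝ) : 0 ≤ rayIntegral b ν x :=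
  setIntegral_nonneg measurableSet_Ioi fun _ hτ => rayIntegrand_nonneg b ν x (le_of_lt hτ)

theorem rayIntegral_le {b ν x X M : ℝ} (hb : 0 < b) (hx : -X ≤ x) (hν : |ν| ≤ M) :
    rayIntegral b ν x ≤ ∫ τ in Ioi (1 : ℝ), Real.exp ((2 * b * X + M + 1) * τ - b * τ ^ 2) :=
  setIntegral_mono_on (integrableOn_rayIntegrand hb ν x)
    (integrable_exp_linear_sub_sq hb _).integrableOn measurableSet_Ioi
    fun _ hτ => rayIntegrand_le hb hx hν (le_of_lt hτ)

theorem continuous_rayIntegral {b : ℝ} (hb : 0 < b) :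
    Continuous fun p : ℝ × ℝ => rayIntegral b p.1 p.2 := by
  refine continuous_iff_continuousAt.2 fun p => ?_
  have hU : Metric.ball p 1 ∈ 𝓝 p := Metric.ball_mem_nhds p one_pos
  refine continuousAt_of_dominated
    (bound := fun τ => Real.exp ((2 * b * (|p.2| + 1) + (|p.1| + 1) + 1) * τ - b * τ ^ 2)) ?_ ?_
    (integrable_exp_linear_sub_sq hb _).integrableOn ?_
  · exact Eventually.of_forall fun q => (measurable_rayIntegrand b q.1 q.2).aestronglyMeasurable
  · filter_upwards [hU] with q hq
    refine (ae_restrict_iff' measurableSet_Ioi).2 (Eventually.of_forall fun τ hτ => ?_)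
    have hτ : (1 : ℝ) ≤ τ := le_of_lt hτ
    rw [Real.norm_of_nonneg (rayIntegrand_nonneg b _ _ hτ)]
    rw [Metric.mem_ball, Prod.dist_eq, max_lt_iff, Real.dist_eq, Real.dist_eq] at hq
    apply rayIntegrand_le hb _ _ hτ
    · have := neg_abs_le q.2
      have := abs_sub_abs_le_abs_sub q.2 p.2
      linarith
    · have := abs_sub_abs_le_abs_sub q.1 p.1
      linarith
  · refine (ae_restrict_iff' measurableSet_Ioi).2 (Eventually.of_forall fun τ hτ => ?_)
    have hτ : (0 : ℝ) < τ := lt_trans one_pos hτ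
    unfold rayIntegrand
    refine ContinuousAt.mul (by fun_prop) ?_
    exact ContinuousAt.rpow (by fun_prop) (by fun_prop) (Or.inl hτ.ne')

theorem rpow_shift {ν τ : ℝ} (hτ : 0 < τ) : τ ^ (-(ν - 1) - 1) = τ * τ ^ (-ν - 1) := by
  rw [show -(ν - 1) - 1 = 1 + (-ν - 1) by ring, Real.rpow_add hτ, Real.rpow_one]

theorem hasDerivAt_rayIntegral {b : ℝ} (hb : 0 < b) (ν x : ℝ) :
    HasDerivAt (rayIntegral b ν) (-2 * b * rayIntegral b (ν - 1) x) x := by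
  have := (hasDerivAt_integral_of_dominated_loc_of_deriv_le (μ := volume.restrict (Ioi (1 : ℝ)))
    (F := rayIntegrand b ν) (F' := fun x τ => -2 * b * rayIntegrand b (ν - 1) x τ) (x₀ := x)
    (s := Metric.ball x 1)
    (bound := fun τ => 2 * b * Real.exp ((2 * b * (|x| + 1) + |ν - 1| + 1) * τ - b * τ ^ 2))
    (Metric.ball_mem_nhds x one_pos)
    (Eventually.of_forall fun y => (measurable_rayIntegrand b ν y).aestronglyMeasurable)
    (integrableOn_rayIntegrand hb ν x)
    ((measurable_rayIntegrand b (ν - 1) x).const_mul _).aestronglyMeasurable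
    ((ae_restrict_iff' measurableSet_Ioi).2 (Eventually.of_forall fun τ hτ y hy => by
      have hτ : (1 : ℝ) ≤ τ := le_of_lt hτ
      rw [norm_mul, Real.norm_of_nonneg (rayIntegrand_nonneg b _ _ hτ),
        show ‖-2 * b‖ = 2 * b by rw [Real.norm_eq_abs, abs_mul, abs_neg, abs_two, abs_of_pos hb]]
      apply mul_le_mul_of_nonneg_left _ (by positivity)
      rw [Metric.mem_ball, Real.dist_eq] at hy
      apply rayIntegrand_le hb _ le_rfl hτ
      have := neg_abs_le y
      have := abs_sub_abs_le_abs_sub y x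
      linarith))
    ((integrable_exp_linear_sub_sq hb _).const_mul _).integrableOn
    ((ae_restrict_iff' measurableSet_Ioi).2 (Eventually.of_forall fun τ hτ y hy => by
      have hτ : (0 : ℝ) < τ := lt_trans one_pos hτ
      have h1 : HasDerivAt (fun x : ℝ => -2 * b * x * τ - b * τ ^ 2) (-2 * b * 1 * τ) y :=
        (((hasDerivAt_id y).const_mul (-2 * b)).mul_const _).sub_const _
      refine (h1.exp.mul_const (τ ^ (-ν - 1))).congr_deriv ?_
      simp only [rayIntegrand, rpow_shift hτ]
      ring))).2
  rw [integral_const_mul] at this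
  exact this

/-- The same total derivative along the ray; Gaussian decay kills the end at infinity and only the
boundary term at `τ = 1` remains. -/
theorem rayIntegral_recurrence {b : ℝ} (hb : 0 < b) (ν x : ℝ) :
    2 * b * x * rayIntegral b (ν - 1) x + 2 * b * rayIntegral b (ν - 2) x +
      ν * rayIntegral b ν x = Real.exp (-2 * b * x - b) := by
  set G : ℝ → ℝ := fun τ => Real.exp (-2 * b * x * τ - b * τ ^ 2) * τ ^ (-ν) with hG
  have i1 := integrableOn_rayIntegrand hb (ν - 1) x
  have i2 := integrableOn_rayIntegrand hb (ν - 2) x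
  have i3 := integrableOn_rayIntegrand hb ν x
  have hd : ∀ τ ∈ Ici (1 : ℝ), HasDerivAt G (-(2 * b * x * rayIntegrand b (ν - 1) x τ) -
      2 * b * rayIntegrand b (ν - 2) x τ - ν * rayIntegrand b ν x τ) τ := by
    intro τ hτ
    have hτ : (0 : ℝ) < τ := lt_of_lt_of_le one_pos hτ
    have h1 : HasDerivAt (fun τ : ℝ => -2 * b * x * τ - b * τ ^ 2)
        (-2 * b * x * 1 - b * (↑(2 : ℕ) * τ ^ (2 - 1))) τ :=
      ((hasDerivAt_id τ).const_mul _).sub ((hasDerivAt_pow 2 τ).const_mul b)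
    have h2 := Real.hasDerivAt_rpow_const (x := τ) (p := -ν) (Or.inl hτ.ne')
    refine (h1.exp.mul h2).congr_deriv ?_
    have e2 : τ ^ (-(ν - 2) - 1) = τ * (τ * τ ^ (-ν - 1)) := by
      rw [← rpow_shift hτ, show ν - 2 = (ν - 1) - 1 by ring, rpow_shift hτ]
    have e1 : τ ^ (-ν) = τ * τ ^ (-ν - 1) := by
      rw [← rpow_shift hτ]; congr 1; ring
    simp only [rayIntegrand, rpow_shift hτ, e2, e1]
    push_cast
    ring
  have hlim : Tendsto G atTop (𝓝 0) := by
    have hG' : ∀ᶠ τ in atTop, ‖G τ‖ ≤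
        Real.exp ((2 * b * |x| + |ν + -1| + 1 - b * τ) * τ) := by
      filter_upwards [eventually_ge_atTop 1] with τ hτ
      have := rayIntegrand_le hb (neg_abs_le x) (le_refl |ν + -1|) hτ
      rw [show (2 * b * |x| + |ν + -1| + 1 - b * τ) * τ =
        (2 * b * |x| + |ν + -1| + 1) * τ - b * τ ^ 2 by ring]
      rw [Real.norm_of_nonneg (mul_nonneg (Real.exp_pos _).le (Real.rpow_nonneg (by linarith) _))]
      refine le_trans (le_of_eq ?_) this
      simp only [rayIntegrand]
      congr 2
      ring
    refine squeeze_zero_norm' hG' (Real.tendsto_exp_atBot.comp ?_)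
    refine Tendsto.atBot_mul_atTop₀ ?_ tendsto_id
    exact tendsto_atBot_add_const_left _ _
      (tendsto_neg_atTop_atBot.comp (tendsto_id.const_mul_atTop hb))
  have key := integral_Ioi_of_hasDerivAt_of_tendsto' hd
    (((i1.const_mul _).neg.sub (i2.const_mul _)).sub (i3.const_mul _)) hlim
  have s1 := integral_sub ((i1.const_mul (2 * b * x)).neg.sub (i2.const_mul (2 * b)))
    (i3.const_mul ν)
  have s2 := integral_sub (i1.const_mul (2 * b * x)).neg (i2.const_mul (2 * b))
  simp only [Pi.sub_apply, Pi.neg_apply] at s1 s2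
  rw [s1, s2, integral_neg, integral_const_mul, integral_const_mul, integral_const_mul] at key
  have e : G 1 = Real.exp (-2 * b * x - b) := by simp [hG]
  rw [e] at key
  unfold rayIntegral
  linarith

theorem continuous_hankelLoop {b : ℝ} (hb : 0 < b) :
    Continuous fun p : ℝ × ℝ => hankelLoop b p.1 p.2 := by
  unfold hankelLoop
  exact (continuous_loopIntegral b).sub ((by fun_prop : Continuous fun p : ℝ × ℝ =>
    2 * Real.sin (Real.pi * p.1)).mul (continuous_rayIntegral hb))

theorem sin_pi_mul_sub_one (ν : ℝ) : Real.sin (Real.pi * (ν - 1)) = -Real.sin (Real.pi * ν) := by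
  rw [mul_sub, mul_one, Real.sin_sub_pi]

theorem hasDerivAt_hankelLoop {b : ℝ} (hb : 0 < b) (ν x : ℝ) :
    HasDerivAt (hankelLoop b ν) (2 * b * hankelLoop b (ν - 1) x) x := by
  refine ((hasDerivAt_loopIntegral hb ν x).sub ((hasDerivAt_rayIntegral hb ν x).const_mul
    (2 * Real.sin (Real.pi * ν)))).congr_deriv ?_
  rw [hankelLoop, sin_pi_mul_sub_one]
  ring

theorem hankelLoop_recurrence {b : ℝ} (hb : 0 < b) (ν x : ℝ) :
    2 * b * x * hankelLoop b (ν - 1) x - 2 * b * hankelLoop b (ν - 2) x - ν * hankelLoop b ν x =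
      0 := by
  have h1 := loopIntegral_recurrence b ν x
  have h2 := rayIntegral_recurrence hb ν x
  have e : Real.sin (Real.pi * (ν - 2)) = Real.sin (Real.pi * ν) := by
    rw [show ν - 2 = (ν - 1) - 1 by ring, sin_pi_mul_sub_one, sin_pi_mul_sub_one, neg_neg]
  simp only [hankelLoop, sin_pi_mul_sub_one, e]
  linear_combination h1 + 2 * Real.sin (Real.pi * ν) * h2

/-- Mean value property of the entire function `exp(-bz²)` on the unit circle. -/
theorem loopIntegral_zero_zero (b : ℝ) : loopIntegral b 0 0 = 2 * Real.pi := by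
  set f : ℂ → ℂ := fun z => Complex.exp (-b * z ^ 2) with hf
  have hd : Differentiable ℂ f := by fun_prop
  have h1 : Real.circleAverage f 0 1 = f 0 :=
    DiffContOnCl.circleAverage (hd.diffContOnCl)
  rw [Real.circleAverage_eq_integral_add (-Real.pi), intervalIntegral.integral_comp_add_right
    (fun θ => f (circleMap 0 1 θ))] at h1
  have e0 : f 0 = 1 := by simp [hf]
  have ea : (0 : ℝ) + -Real.pi = -Real.pi := by ring
  have eb : 2 * Real.pi + -Real.pi = Real.pi := by ring
  rw [e0, ea, eb] at h1
  have hc : Continuous fun θ => f (circleMap 0 1 θ) :=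
    hd.continuous.comp (continuous_circleMap 0 1)
  have h2 : loopIntegral b 0 0 = (∫ θ in (-Real.pi)..Real.pi, f (circleMap 0 1 θ)).re := by
    have := Complex.reCLM.intervalIntegral_comp_comm
      (hc.intervalIntegrable (μ := volume) (-Real.pi) Real.pi)
    simp only [Complex.reCLM_apply] at this
    rw [← this, loopIntegral]
    apply intervalIntegral.integral_congr
    intro θ _
    simp only [loopIntegrand, hf, Complex.exp_re]
    have : (-b * (circleMap 0 1 θ) ^ 2 : ℂ) =
        ((-b * Real.cos (2 * θ) : ℝ) : ℂ) + ((-b * Real.sin (2 * θ) : ℝ) : ℂ) * Complex.I := by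
      rw [circleMap, zero_add, Complex.ofReal_one, one_mul, ← Complex.exp_nat_mul]
      rw [show ((2 : ℕ) : ℂ) * (θ * Complex.I) = ((2 * θ : ℝ) : ℂ) * Complex.I by push_cast; ring,
        Complex.exp_mul_I, ← Complex.ofReal_cos, ← Complex.ofReal_sin]
      push_cast
      ring
    rw [this]
    simp only [Complex.add_re, Complex.add_im, Complex.mul_re, Complex.mul_im, Complex.ofReal_re,
      Complex.ofReal_im, Complex.I_re, Complex.I_im]
    congr 2 <;> ring
  have hpi : (0 : ℝ) < 2 * Real.pi := by positivity
  have h3 : (∫ θ in (-Real.pi)..Real.pi, f (circleMap 0 1 θ)) = ((2 * Real.pi : ℝ) : ℂ) := by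
    rw [Complex.real_smul] at h1
    have hne : ((2 * Real.pi : ℝ) : ℂ) ≠ 0 := by exact_mod_cast hpi.ne'
    calc _ = ((2 * Real.pi : ℝ) : ℂ) * ((((2 * Real.pi)⁻¹ : ℝ) : ℂ) *
          ∫ θ in (-Real.pi)..Real.pi, f (circleMap 0 1 θ)) := by
          rw [← mul_assoc, ← Complex.ofReal_mul, mul_inv_cancel₀ hpi.ne', Complex.ofReal_one,
            one_mul]
      _ = _ := by rw [h1, mul_one]
  rw [h2, h3, Complex.ofReal_re]

/-- For non-integer index the ray dominates the loop far to the left. -/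
theorem exists_hankelLoop_sign {b : ℝ} (hb : 0 < b) {ν : ℝ} (hν : Real.sin (Real.pi * ν) ≠ 0) :
    ∃ x, 0 < -Real.sin (Real.pi * ν) * hankelLoop b ν x := by
  set s := Real.sin (Real.pi * ν) with hs
  set c := ∫ τ in Icc (2 : ℝ) 3, Real.exp (-(b * τ ^ 2)) * τ ^ (-ν - 1) with hc
  have hcont : ContinuousOn (fun τ : ℝ => Real.exp (-(b * τ ^ 2)) * τ ^ (-ν - 1)) (Icc 2 3) := by
    refine ContinuousOn.mul (by fun_prop) ?_
    intro τ hτ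
    exact (Real.continuousAt_rpow_const τ _
      (Or.inl (by linarith [hτ.1] : τ ≠ 0))).continuousWithinAt
  have hcpos : 0 < c := by
    rw [hc, ← integral_Icc_eq_integral_Ioc.symm, ← intervalIntegral.integral_of_le (by norm_num)]
    apply intervalIntegral.intervalIntegral_pos_of_pos_on
    · exact hcont.intervalIntegrable_of_Icc (by norm_num)
    · intro τ hτ
      have : (0 : ℝ) < τ := by linarith [hτ.1]
      positivity
    · norm_num
  -- The part `τ ∈ [2, 3]` of the ray alone grows like `e^{4by}`, whereas the circle contributes at
  -- most a multiple of `e^{2by}`.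
  have hray : ∀ y : ℝ, 0 ≤ y → Real.exp (4 * b * y) * c ≤ rayIntegral b ν (-y) := by
    intro y hy
    calc Real.exp (4 * b * y) * c
        = ∫ τ in Icc (2 : ℝ) 3, Real.exp (4 * b * y) *
            (Real.exp (-(b * τ ^ 2)) * τ ^ (-ν - 1)) := by rw [integral_const_mul]
      _ ≤ ∫ τ in Icc (2 : ℝ) 3, rayIntegrand b ν (-y) τ := by
        apply setIntegral_mono_on (hcont.integrableOn_Icc.const_mul _)
          ((integrableOn_rayIntegrand hb ν (-y)).mono_set fun τ hτ => mem_Ioi.2 (by linarith [hτ.1]))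
          measurableSet_Icc
        intro τ hτ
        rw [← mul_assoc, ← Real.exp_add]
        refine mul_le_mul_of_nonneg_right (Real.exp_le_exp.2 ?_)
          (Real.rpow_nonneg (by linarith [hτ.1]) _)
        have : 0 ≤ b * y * (τ - 2) := mul_nonneg (by positivity) (by linarith [hτ.1])
        nlinarith
      _ ≤ _ := by
        apply setIntegral_mono_set (integrableOn_rayIntegrand hb ν (-y))
        · exact (ae_restrict_iff' measurableSet_Ioi).2 (Eventually.of_forall fun τ hτ =>
            rayIntegrand_nonneg b ν _ (le_of_lt hτ))
        · exact (show Icc (2 : ℝ) 3 ⊆ Ioi 1 from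
            fun τ hτ => mem_Ioi.2 (by linarith [hτ.1])).eventuallyLE
  -- At `x = -Q/(2b)` the two growth factors are `e^{2Q}` and `e^Q`; this `Q` makes `e^Q > Q`
  -- exactly the inequality by which the ray wins.
  set Q := Real.pi * Real.exp b / (s ^ 2 * c) with hQ
  have hs2 : 0 < s ^ 2 * c := by positivity
  have hQpos : 0 < Q := by positivity
  refine ⟨-(Q / (2 * b)), ?_⟩
  have h1 := hray (Q / (2 * b)) (by positivity)
  have h2 := abs_loopIntegral_le hb ν (-(Q / (2 * b)))
  rw [abs_neg, abs_of_pos (by positivity : 0 < Q / (2 * b)),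
    show 2 * b * (Q / (2 * b)) = Q by field_simp, Real.exp_add] at h2
  rw [show 4 * b * (Q / (2 * b)) = Q + Q by field_simp; ring, Real.exp_add] at h1
  have h3 : s * loopIntegral b ν (-(Q / (2 * b))) ≤ |loopIntegral b ν (-(Q / (2 * b)))| := by
    refine (le_abs_self _).trans ?_
    rw [abs_mul]
    exact mul_le_of_le_one_left (abs_nonneg _) (Real.abs_sin_le_one _)
  have h4 : Q < Real.exp Q := by linarith [Real.add_one_le_exp Q]
  have h5 : Real.pi * Real.exp b = Q * (s ^ 2 * c) := (div_mul_cancel₀ _ hs2.ne').symm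
  have h6 : Real.pi * Real.exp b < Real.exp Q * (s ^ 2 * c) := by
    rw [h5]
    exact mul_lt_mul_of_pos_right h4 hs2
  have h7 : s ^ 2 * (Real.exp Q * Real.exp Q * c) ≤ s ^ 2 * rayIntegral b ν (-(Q / (2 * b))) :=
    mul_le_mul_of_nonneg_left h1 (sq_nonneg s)
  have h8 := mul_lt_mul_of_pos_right h6 (Real.exp_pos Q)
  have h9 : -s * hankelLoop b ν (-(Q / (2 * b))) =
      2 * (s ^ 2 * rayIntegral b ν (-(Q / (2 * b)))) -
        s * loopIntegral b ν (-(Q / (2 * b))) := by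
    rw [hankelLoop, ← hs]
    ring
  rw [h9]
  nlinarith

/-- For non-integer `ν` the sign far to the left decides. For an integer `ν = n ≥ 0`, vanishing
identically would descend by differentiation to index `0`, where the value at the origin is `2π`. -/
theorem exists_hankelLoop_ne_zero {b : ℝ} (hb : 0 < b) {ν : ℝ} (hν : -1 < ν) :
    ∃ x, hankelLoop b ν x ≠ 0 := by
  by_contra! hzero
  by_cases hs : Real.sin (Real.pi * ν) = 0
  · rw [Real.sin_eq_zero_iff] at hs
    obtain ⟨n, hn⟩ := hs
    have hn : (n : ℝ) = ν := by
      rw [mul_comm] at hn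
      exact mul_left_cancel₀ Real.pi_ne_zero hn
    have hn0 : 0 ≤ n := by
      have : (-1 : ℝ) < n := by rw [hn]; exact hν
      have : (-1 : ℤ) < n := by exact_mod_cast this
      omega
    lift n to ℕ using hn0
    have hdesc : ∀ m : ℕ, m ≤ n → ∀ x, hankelLoop b (ν - m) x = 0 := by
      intro m
      induction m with
      | zero => intro _ x; simpa using hzero x
      | succ m ih =>
        intro hm x
        have h1 := hasDerivAt_hankelLoop hb (ν - m) x
        have h2 : hankelLoop b (ν - m) = fun _ => 0 := funext (ih (by omega))
        rw [h2] at h1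
        have h3 := h1.unique (hasDerivAt_const x 0)
        have h4 := (mul_eq_zero.1 h3).resolve_left (by positivity)
        push_cast
        rw [← sub_sub]
        exact h4
    have := hdesc n le_rfl 0
    rw [← hn] at this
    simp only [Int.cast_natCast, sub_self] at this
    rw [hankelLoop, loopIntegral_zero_zero] at this
    simp at this
  · obtain ⟨x, hx⟩ := exists_hankelLoop_sign hb hs
    rw [hzero x] at hx
    simp at hx

/-! ### The decaying oscillator solution -/

/-- The solution of `u'' = (b² t² - E) u` that decays at `+∞`. -/
def decayingSol (b E t : ℝ) : ℝ :=
  Real.exp (-(b * t ^ 2 / 2)) * hankelLoop b ((E / b - 1) / 2) t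

/-- The derivative of `decayingSol`. -/
def decayingSol' (b E t : ℝ) : ℝ :=
  Real.exp (-(b * t ^ 2 / 2)) * (2 * b * hankelLoop b ((E / b - 1) / 2 - 1) t -
    b * t * hankelLoop b ((E / b - 1) / 2) t)

theorem solvesOn_decayingSol {b : ℝ} (hb : 0 < b) (E : ℝ) :
    SolvesOn (fun t => b ^ 2 * t ^ 2 - E) (decayingSol b E) (decayingSol' b E) univ := by
  intro t _
  set ν := (E / b - 1) / 2 with hν
  have he : HasDerivAt (fun t : ℝ => Real.exp (-(b * t ^ 2 / 2)))
      (Real.exp (-(b * t ^ 2 / 2)) * (-(b * (↑(2 : ℕ) * t ^ (2 - 1)) / 2))) t :=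
    (((hasDerivAt_pow 2 t).const_mul b).div_const 2).neg.exp
  have h0 := hasDerivAt_hankelLoop hb ν t
  have h1 := hasDerivAt_hankelLoop hb (ν - 1) t
  constructor
  · refine (he.mul h0).congr_deriv ?_
    rw [decayingSol', ← hν]
    push_cast
    ring
  · have ht : HasDerivAt (fun t : ℝ => b * t) (b * 1) t := (hasDerivAt_id t).const_mul b
    refine (he.mul ((h1.const_mul (2 * b)).sub (ht.mul h0))).congr_deriv ?_
    simp only [Pi.sub_apply, Pi.mul_apply]
    rw [decayingSol, ← hν]
    have h2 := hankelLoop_recurrence hb ν t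
    have e : E = 2 * b * ν + b := by rw [hν]; field_simp; ring
    rw [e, show ν - 1 - 1 = ν - 2 by ring]
    push_cast
    linear_combination (-2 * b * Real.exp (-(b * t ^ 2 / 2))) * h2

theorem hasDerivAt_decayingSol {b : ℝ} (hb : 0 < b) (E t : ℝ) :
    HasDerivAt (decayingSol b E) (decayingSol' b E t) t :=
  (solvesOn_decayingSol hb E t (mem_univ t)).1

theorem hasDerivAt_decayingSol' {b : ℝ} (hb : 0 < b) (E t : ℝ) :
    HasDerivAt (decayingSol' b E) ((b ^ 2 * t ^ 2 - E) * decayingSol b E t) t :=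
  (solvesOn_decayingSol hb E t (mem_univ t)).2

theorem continuous_decayingSol {b : ℝ} (hb : 0 < b) :
    Continuous fun p : ℝ × ℝ => decayingSol b p.1 p.2 := by
  unfold decayingSol
  exact Continuous.mul (by fun_prop) ((continuous_hankelLoop hb).comp
    (by fun_prop : Continuous fun p : ℝ × ℝ => ((p.1 / b - 1) / 2, p.2)))

theorem continuous_decayingSol' {b : ℝ} (hb : 0 < b) :
    Continuous fun p : ℝ × ℝ => decayingSol' b p.1 p.2 := by
  unfold decayingSol'
  have h1 := (continuous_hankelLoop hb).comp
    (by fun_prop : Continuous fun p : ℝ × ℝ => ((p.1 / b - 1) / 2, p.2))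
  have h2 := (continuous_hankelLoop hb).comp
    (by fun_prop : Continuous fun p : ℝ × ℝ => ((p.1 / b - 1) / 2 - 1, p.2))
  exact Continuous.mul (by fun_prop) ((continuous_const.mul h2).sub
    (Continuous.mul (by fun_prop) h1))

theorem continuous_decayingSol_right {b : ℝ} (hb : 0 < b) (E : ℝ) :
    Continuous (decayingSol b E) :=
  (continuous_decayingSol hb).comp (by fun_prop : Continuous fun t : ℝ => (E, t))

theorem continuous_decayingSol'_right {b : ℝ} (hb : 0 < b) (E : ℝ) :
    Continuous (decayingSol' b E) :=
  (continuous_decayingSol' hb).comp (by fun_prop : Continuous fun t : ℝ => (E, t))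

/-- For `E ≥ 0` the index `(E/b - 1)/2` is at least `-1/2`, so the loop integral is not identically
zero, and uniqueness for the Cauchy problem excludes a common zero. -/
theorem decayingSol_ne_zero {b E : ℝ} (hb : 0 < b) (hE : 0 ≤ E) (t : ℝ) :
    ¬ (decayingSol b E t = 0 ∧ decayingSol' b E t = 0) := by
  rintro ⟨h0, h1⟩
  have h2 : -1 < (E / b - 1) / 2 := by
    have : 0 ≤ E / b := by positivity
    linarith
  obtain ⟨x, hx⟩ := exists_hankelLoop_ne_zero hb h2
  have h3 := ((solvesOn_decayingSol hb E).eq_zero (by fun_prop) h0 h1 x).1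
  exact (mul_ne_zero (Real.exp_pos _).ne' hx) h3

theorem exists_decayingSol_zero_pos {b : ℝ} (hb : 0 < b) : ∃ t, 0 < decayingSol b 0 t := by
  have e : Real.sin (Real.pi * ((0 / b - 1) / 2)) = -1 := by
    rw [show Real.pi * ((0 / b - 1) / 2) = -(Real.pi / 2) by ring, Real.sin_neg,
      Real.sin_pi_div_two]
  obtain ⟨x, hx⟩ := exists_hankelLoop_sign hb (ν := (0 / b - 1) / 2) (by rw [e]; norm_num)
  rw [e, neg_neg, one_mul] at hx
  exact ⟨x, mul_pos (Real.exp_pos _) hx⟩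

theorem exists_abs_hankelLoop_le {b : ℝ} (hb : 0 < b) (M T : ℝ) :
    ∃ C, 0 ≤ C ∧ ∀ ν t, |ν| ≤ M → -T ≤ t → |hankelLoop b ν t| ≤ C * Real.exp (2 * b * |t|) := by
  set K := ∫ τ in Ioi (1 : ℝ), Real.exp ((2 * b * T + M + 1) * τ - b * τ ^ 2) with hK
  have hKnn : 0 ≤ K := integral_nonneg fun _ => (Real.exp_pos _).le
  refine ⟨2 * Real.pi * Real.exp b + 2 * K, by positivity, fun ν t hν ht => ?_⟩
  have h1 := abs_loopIntegral_le hb ν t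
  have h2 := rayIntegral_le hb ht hν
  have h3 := rayIntegral_nonneg b ν t
  rw [Real.exp_add] at h1
  have h4 : |2 * Real.sin (Real.pi * ν) * rayIntegral b ν t| ≤ 2 * K := by
    rw [abs_mul, abs_mul, abs_two, abs_of_nonneg h3]
    have := Real.abs_sin_le_one (Real.pi * ν)
    nlinarith [abs_nonneg (Real.sin (Real.pi * ν))]
  have h5 := abs_sub (loopIntegral b ν t) (2 * Real.sin (Real.pi * ν) * rayIntegral b ν t)
  have h6 : 1 ≤ Real.exp (2 * b * |t|) := Real.one_le_exp (by positivity)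
  rw [hankelLoop]
  nlinarith

/-- Locally uniform exponential decay at `+∞`. -/
theorem exists_decayingSol_le {b : ℝ} (hb : 0 < b) (M T : ℝ) :
    ∃ C, 0 ≤ C ∧ ∀ E t, |E| ≤ M → -T ≤ t → |decayingSol b E t| ≤ C * Real.exp (-|t|) ∧
      |decayingSol' b E t| ≤ C * Real.exp (-|t|) := by
  set M' := M / b + 2 with hM'
  obtain ⟨C, hC, h⟩ := exists_abs_hankelLoop_le hb M' T
  -- The exponential of the maximum of `(2b + 2)|t| - b t²/2`; the rate `2b + 2` collects `2b` from
  -- the loop bound, `1` to absorb the linear factor in `t`, and `1` for the decay claimed.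
  set D := Real.exp ((2 * b + 2) ^ 2 / (2 * b)) with hD
  refine ⟨3 * (b + 1) * C * D, by positivity, fun E t hE ht => ?_⟩
  have hν : |(E / b - 1) / 2| ≤ M / b + 1 := by
    rw [abs_div, abs_two]
    have h1 := abs_sub (E / b) 1
    rw [abs_div, abs_of_pos hb, abs_one] at h1
    have h2 : |E| / b ≤ M / b := by gcongr
    have h3 : 0 ≤ |E| / b := by positivity
    linarith
  have h0 := h ((E / b - 1) / 2) t (by linarith) ht
  have h1 := h ((E / b - 1) / 2 - 1) t (by
    have := abs_sub ((E / b - 1) / 2) 1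
    rw [abs_one] at this
    linarith) ht
  have hg : Real.exp (-(b * t ^ 2 / 2)) * (Real.exp (2 * b * |t|) * Real.exp |t|) ≤
      D * Real.exp (-|t|) := by
    rw [hD, ← Real.exp_add, ← Real.exp_add, ← Real.exp_add]
    apply Real.exp_le_exp.2
    have e : (2 * b + 2) ^ 2 / (2 * b) + -|t| - (-(b * t ^ 2 / 2) + (2 * b * |t| + |t|)) =
        b / 2 * (|t| - (2 * b + 2) / b) ^ 2 := by
      rw [← sq_abs t]
      field_simp
      ring
    have : 0 ≤ b / 2 * (|t| - (2 * b + 2) / b) ^ 2 := by positivity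
    linarith
  have ht1 : 1 ≤ Real.exp |t| := Real.one_le_exp (abs_nonneg _)
  have ht2 : |t| ≤ Real.exp |t| := by linarith [Real.add_one_le_exp |t|]
  set e0 := Real.exp (-(b * t ^ 2 / 2)) with he0
  set e1 := Real.exp (2 * b * |t|) with he1
  have he0' : 0 < e0 := Real.exp_pos _
  have he1' : 0 < e1 := Real.exp_pos _
  have hCe : 0 ≤ C * e1 := by positivity
  constructor
  · rw [decayingSol, abs_mul, abs_of_pos he0']
    calc e0 * |hankelLoop b ((E / b - 1) / 2) t| ≤ e0 * (C * e1) := by gcongr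
      _ ≤ e0 * (C * e1 * (3 * (b + 1) * Real.exp |t|)) := by
        apply mul_le_mul_of_nonneg_left _ he0'.le
        apply le_mul_of_one_le_right hCe
        nlinarith
      _ = 3 * (b + 1) * C * (e0 * (e1 * Real.exp |t|)) := by ring
      _ ≤ 3 * (b + 1) * C * (D * Real.exp (-|t|)) := by gcongr
      _ = _ := by ring
  · rw [decayingSol', abs_mul, abs_of_pos he0']
    have h2 : |2 * b * hankelLoop b ((E / b - 1) / 2 - 1) t -
        b * t * hankelLoop b ((E / b - 1) / 2) t| ≤
        C * e1 * (3 * (b + 1) * Real.exp |t|) := by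
      refine (abs_sub _ _).trans ?_
      rw [abs_mul, abs_mul, abs_mul, abs_mul, abs_two, abs_of_pos hb]
      calc 2 * b * |hankelLoop b ((E / b - 1) / 2 - 1) t| +
            b * |t| * |hankelLoop b ((E / b - 1) / 2) t|
          ≤ 2 * b * (C * e1) + b * |t| * (C * e1) := by gcongr
        _ = C * e1 * (2 * b + b * |t|) := by ring
        _ ≤ _ := by
          apply mul_le_mul_of_nonneg_left _ hCe
          nlinarith
    calc e0 * _ ≤ e0 * (C * e1 * (3 * (b + 1) * Real.exp |t|)) := by gcongr
      _ = 3 * (b + 1) * C * (e0 * (e1 * Real.exp |t|)) := by ring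
      _ ≤ 3 * (b + 1) * C * (D * Real.exp (-|t|)) := by gcongr
      _ = _ := by ring

/-! ### Overlap integrals and the Wronskian in the energy -/

/-- `∫_s^∞ u_E u_{E'}` for the decaying solutions. -/
def overlap (b E E' s : ℝ) : ℝ :=
  ∫ x in Ioi (0 : ℝ), decayingSol b E (x + s) * decayingSol b E' (x + s)

theorem integrableOn_of_decay {f : ℝ → ℝ} (hf : Continuous f) {a C : ℝ}
    (h : ∀ x, a ≤ x → |f x| ≤ C * Real.exp (-x)) : IntegrableOn f (Ioi a) := by
  refine Integrable.mono' ((exp_neg_integrableOn_Ioi a one_pos).const_mul C)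
    hf.aestronglyMeasurable ?_
  refine (ae_restrict_iff' measurableSet_Ioi).2 (Eventually.of_forall fun x hx => ?_)
  simpa using h x (le_of_lt hx)

/-- Decay of products of the decaying solutions, locally uniform in the energies. -/
theorem exists_mul_decayingSol_le {b : ℝ} (hb : 0 < b) (M T : ℝ) :
    ∃ C, ∀ E E' s x, |E| ≤ M → |E'| ≤ M → -T ≤ s → 0 ≤ x →
      |decayingSol b E (x + s) * decayingSol b E' (x + s)| ≤ C * Real.exp (-x) ∧
      |decayingSol b E (x + s) * decayingSol' b E' (x + s)| ≤ C * Real.exp (-x) ∧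
      |decayingSol' b E (x + s) * decayingSol' b E' (x + s)| ≤ C * Real.exp (-x) := by
  obtain ⟨C, hC, h⟩ := exists_decayingSol_le hb M T
  refine ⟨C * C * Real.exp T, fun E E' s x hE hE' hs hx => ?_⟩
  obtain ⟨h1, h2⟩ := h E (x + s) hE (by linarith)
  obtain ⟨h3, h4⟩ := h E' (x + s) hE' (by linarith)
  set w := Real.exp (-|x + s|) with hw
  have hw0 : 0 < w := Real.exp_pos _
  have hw1 : w ≤ 1 := Real.exp_le_one_iff.2 (by simp)
  have hw2 : w ≤ Real.exp T * Real.exp (-x) := by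
    rw [← Real.exp_add]
    apply Real.exp_le_exp.2
    have := le_abs_self (x + s)
    linarith
  have hprod : ∀ u v : ℝ, |u| ≤ C * w → |v| ≤ C * w →
      |u * v| ≤ C * C * Real.exp T * Real.exp (-x) := by
    intro u v hu hv
    rw [abs_mul]
    calc |u| * |v| ≤ (C * w) * (C * w) := by gcongr
      _ = C * C * (w * w) := by ring
      _ ≤ C * C * (Real.exp T * Real.exp (-x)) := by
        apply mul_le_mul_of_nonneg_left _ (by positivity)
        nlinarith
      _ = _ := by ring
  exact ⟨hprod _ _ h1 h3, hprod _ _ h1 h4, hprod _ _ h2 h4⟩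

theorem continuous_overlap {b : ℝ} (hb : 0 < b) :
    Continuous fun p : (ℝ × ℝ) × ℝ => overlap b p.1.1 p.1.2 p.2 := by
  refine continuous_iff_continuousAt.2 fun p => ?_
  obtain ⟨C, hC⟩ := exists_mul_decayingSol_le hb (|p.1.1| + |p.1.2| + 1) (|p.2| + 1)
  have hc := continuous_decayingSol hb
  refine continuousAt_of_dominated (bound := fun x => C * Real.exp (-x)) ?_ ?_ ?_ ?_
  · refine Eventually.of_forall fun q => ?_
    exact (((continuous_decayingSol_right hb q.1.1).comp (by fun_prop)).mul
      ((continuous_decayingSol_right hb q.1.2).comp (by fun_prop))).aestronglyMeasurable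
  · filter_upwards [Metric.ball_mem_nhds p one_pos] with q hq
    refine (ae_restrict_iff' measurableSet_Ioi).2 (Eventually.of_forall fun x hx => ?_)
    rw [Metric.mem_ball, Prod.dist_eq, Prod.dist_eq, max_lt_iff, max_lt_iff, Real.dist_eq,
      Real.dist_eq, Real.dist_eq] at hq
    have h1 := abs_sub_abs_le_abs_sub q.1.1 p.1.1
    have h2 := abs_sub_abs_le_abs_sub q.1.2 p.1.2
    have h3 := abs_sub_abs_le_abs_sub q.2 p.2
    have h4 := neg_abs_le q.2
    have h5 := abs_nonneg p.1.1
    have h6 := abs_nonneg p.1.2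
    exact (hC q.1.1 q.1.2 q.2 x (by linarith) (by linarith) (by linarith) (le_of_lt hx)).1
  · simpa using ((exp_neg_integrableOn_Ioi 0 one_pos).const_mul C)
  · refine Eventually.of_forall fun x => ContinuousAt.mul ?_ ?_
    · exact (hc.comp (by fun_prop : Continuous fun q : (ℝ × ℝ) × ℝ =>
        (q.1.1, x + q.2))).continuousAt
    · exact (hc.comp (by fun_prop : Continuous fun q : (ℝ × ℝ) × ℝ =>
        (q.1.2, x + q.2))).continuousAt

theorem integrableOn_mul_decayingSol {b : ℝ} (hb : 0 < b) (E E' s : ℝ) :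
    IntegrableOn (fun x => decayingSol b E (x + s) * decayingSol b E' (x + s)) (Ioi 0) := by
  obtain ⟨C, hC⟩ := exists_mul_decayingSol_le hb (|E| + |E'|) |s|
  refine integrableOn_of_decay (C := C) (((continuous_decayingSol_right hb E).comp
    (by fun_prop)).mul ((continuous_decayingSol_right hb E').comp (by fun_prop))) fun x hx => ?_
  exact (hC E E' s x (by linarith [abs_nonneg E']) (by linarith [abs_nonneg E]) (neg_abs_le s)
    hx).1

theorem integrableOn_sq_decayingSol {b : ℝ} (hb : 0 < b) (E s : ℝ) :
    IntegrableOn (fun x => decayingSol b E (x + s) ^ 2) (Ioi 0) := by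
  simpa only [sq] using integrableOn_mul_decayingSol hb E E s

theorem integrableOn_sq_decayingSol' {b : ℝ} (hb : 0 < b) (E s : ℝ) :
    IntegrableOn (fun x => decayingSol' b E (x + s) ^ 2) (Ioi 0) := by
  obtain ⟨C, hC⟩ := exists_mul_decayingSol_le hb |E| |s|
  refine integrableOn_of_decay (C := C) (((continuous_decayingSol'_right hb E).comp
    (by fun_prop)).pow 2) fun x hx => ?_
  rw [sq]
  exact (hC E E s x le_rfl le_rfl (neg_abs_le s) hx).2.2

theorem solvesOn_decayingSol_add {b : ℝ} (hb : 0 < b) (E s : ℝ) (S : Set ℝ) :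
    SolvesOn (fun x => b ^ 2 * (x + s) ^ 2 - E) (fun x => decayingSol b E (x + s))
      (fun x => decayingSol' b E (x + s)) S :=
  ((solvesOn_decayingSol hb E).comp_add s).mono fun _ _ => mem_univ _

/-- The Wronskian of two decaying solutions. -/
theorem wronskian_decayingSol {b : ℝ} (hb : 0 < b) (E E' s : ℝ) :
    decayingSol b E s * decayingSol' b E' s - decayingSol' b E s * decayingSol b E' s =
      (E' - E) * overlap b E E' s := by
  have hd : ∀ x ∈ Ici (0 : ℝ), HasDerivAt (fun x => decayingSol b E (x + s) *
      decayingSol' b E' (x + s) - decayingSol' b E (x + s) * decayingSol b E' (x + s))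
      ((E - E') * (decayingSol b E (x + s) * decayingSol b E' (x + s))) x := by
    intro x hx
    refine ((solvesOn_decayingSol_add hb E s univ).hasDerivAt_wronskian
      (solvesOn_decayingSol_add hb E' s univ) (mem_univ x)).congr_deriv ?_
    ring
  obtain ⟨C, hC⟩ := exists_mul_decayingSol_le hb (|E| + |E'|) |s|
  have hlim : Tendsto (fun x => decayingSol b E (x + s) * decayingSol' b E' (x + s) -
      decayingSol' b E (x + s) * decayingSol b E' (x + s)) atTop (𝓝 0) := by
    have h0 : Tendsto (fun x : ℝ => 2 * C * Real.exp (-x)) atTop (𝓝 0) := by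
      simpa using (Real.tendsto_exp_neg_atTop_nhds_zero).const_mul (2 * C)
    refine squeeze_zero_norm' ?_ h0
    filter_upwards [eventually_ge_atTop 0] with x hx
    have hE : |E| ≤ |E| + |E'| := by linarith [abs_nonneg E']
    have hE' : |E'| ≤ |E| + |E'| := by linarith [abs_nonneg E]
    have h1 := (hC E E' s x hE hE' (neg_abs_le s) hx).2.1
    have h2 := (hC E' E s x hE' hE (neg_abs_le s) hx).2.1
    rw [mul_comm] at h2
    refine (abs_sub _ _).trans ?_
    linarith
  have key := integral_Ioi_of_hasDerivAt_of_tendsto' hd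
    ((integrableOn_mul_decayingSol hb E E' s).const_mul _) hlim
  rw [integral_const_mul] at key
  simp only [zero_add] at key
  unfold overlap
  linarith

/-- A vanishing integral would make `u` vanish on an interval, hence its Cauchy data at a point. -/
theorem overlap_self_pos {b E : ℝ} (hb : 0 < b) (hE : 0 ≤ E) (s : ℝ) : 0 < overlap b E E s := by
  have hnn : 0 ≤ overlap b E E s :=
    setIntegral_nonneg measurableSet_Ioi fun x _ => mul_self_nonneg _
  refine lt_of_le_of_ne hnn fun h0 => ?_
  have h1 := (setIntegral_eq_zero_iff_of_nonneg_ae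
    (Eventually.of_forall fun x => mul_self_nonneg (decayingSol b E (x + s)))
    (integrableOn_mul_decayingSol hb E E s)).1 h0.symm
  have hc : Continuous fun x => decayingSol b E (x + s) :=
    (continuous_decayingSol_right hb E).comp (by fun_prop)
  have h2 := Measure.eqOn_open_of_ae_eq h1 isOpen_Ioi (hc.mul hc).continuousOn continuousOn_const
  have h3 : ∀ x ∈ Ioi (0 : ℝ), decayingSol b E (x + s) = 0 := fun x hx =>
    mul_self_eq_zero.1 (h2 hx)
  have h4 : HasDerivAt (fun x => decayingSol b E (x + s)) 0 1 := by
    refine (hasDerivAt_const (1 : ℝ) (0 : ℝ)).congr_of_eventuallyEq ?_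
    filter_upwards [Ioi_mem_nhds (one_pos : (0 : ℝ) < 1)] with x hx
    exact h3 x hx
  have h5 := (solvesOn_decayingSol_add hb E s univ 1 (mem_univ _)).1.unique h4
  exact decayingSol_ne_zero hb hE (1 + s) ⟨h3 1 (mem_Ioi.2 one_pos), h5⟩

/-- On the region `t ≥ s ≥ 0`, `b² s² ≥ E` the decaying solution is monotone in modulus. -/
theorem decayingSol_mul_neg {b E s : ℝ} (hb : 0 < b) (hE : 0 ≤ E)
    (h : ∀ t, s ≤ t → E ≤ b ^ 2 * t ^ 2) : decayingSol b E s * decayingSol' b E s < 0 := by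
  have := (solvesOn_decayingSol_add hb E s (Ici 0)).mul_neg
    (fun x hx => sub_nonneg.2 (h (x + s) (by linarith)))
    (integrableOn_sq_decayingSol hb E s) (fun x _ => decayingSol_ne_zero hb hE (x + s)) 0 le_rfl
  simpa using this

theorem decayingSol_zero_mul_neg {b : ℝ} (hb : 0 < b) (s : ℝ) :
    decayingSol b 0 s * decayingSol' b 0 s < 0 :=
  decayingSol_mul_neg hb le_rfl fun t _ => by positivity

/-- At `E = 0` the whole line is classically forbidden, so `u u' < 0` everywhere and `u` has no
zero; one positive value fixes the sign. -/
theorem decayingSol_zero_pos {b : ℝ} (hb : 0 < b) (s : ℝ) : 0 < decayingSol b 0 s := by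
  obtain ⟨t, ht⟩ := exists_decayingSol_zero_pos hb
  by_contra! hs
  obtain ⟨z, hz⟩ := mem_range_of_exists_le_of_exists_ge (continuous_decayingSol_right hb 0)
    ⟨s, hs⟩ ⟨t, ht.le⟩
  have := decayingSol_zero_mul_neg hb z
  rw [hz, zero_mul] at this
  exact lt_irrefl _ this

/-! ### The phase angle as a function of the energy -/

/-- The modulus of the phase-plane vector `(u, u')`. -/
def phaseRadius (b E s : ℝ) : ℝ := Real.sqrt (decayingSol b E s ^ 2 + decayingSol' b E s ^ 2)

theorem phaseRadius_pos {b E : ℝ} (hb : 0 < b) (hE : 0 ≤ E) (s : ℝ) : 0 < phaseRadius b E s := by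
  apply Real.sqrt_pos.2
  rcases not_and_or.1 (decayingSol_ne_zero hb hE s) with h | h <;> positivity

theorem phaseRadius_sq (b E s : ℝ) :
    phaseRadius b E s ^ 2 = decayingSol b E s ^ 2 + decayingSol' b E s ^ 2 :=
  Real.sq_sqrt (by positivity)

theorem continuous_phaseRadius {b : ℝ} (hb : 0 < b) :
    Continuous fun p : ℝ × ℝ => phaseRadius b p.1 p.2 :=
  (((continuous_decayingSol hb).pow 2).add ((continuous_decayingSol' hb).pow 2)).sqrt

/-- The derivative in the energy of the phase angle. -/
def angleDensity (b E s : ℝ) : ℝ :=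
  -- Freezing the energy at `0` for `E < 0` keeps the denominator nonzero, so the density is
  -- continuous and positive on the whole line.
  overlap b (max E 0) (max E 0) s / phaseRadius b (max E 0) s ^ 2

theorem continuous_angleDensity {b : ℝ} (hb : 0 < b) :
    Continuous fun p : ℝ × ℝ => angleDensity b p.1 p.2 := by
  unfold angleDensity
  refine Continuous.div ?_ ?_ fun p => (pow_pos (phaseRadius_pos hb (le_max_right _ _) _) 2).ne'
  · exact (continuous_overlap hb).comp
      (by fun_prop : Continuous fun p : ℝ × ℝ => ((max p.1 0, max p.1 0), p.2))
  · exact ((continuous_phaseRadius hb).comp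
      (by fun_prop : Continuous fun p : ℝ × ℝ => (max p.1 0, p.2))).pow 2

theorem angleDensity_pos {b : ℝ} (hb : 0 < b) (E s : ℝ) : 0 < angleDensity b E s :=
  div_pos (overlap_self_pos hb (le_max_right _ _) s)
    (pow_pos (phaseRadius_pos hb (le_max_right _ _) s) 2)

/-- The phase (Prüfer) angle of the decaying solution at `s`, as a continuous function of the
energy. -/
def phaseAngle (b E s : ℝ) : ℝ :=
  Real.arctan (decayingSol' b 0 s / decayingSol b 0 s) + ∫ e in (0 : ℝ)..E, angleDensity b e s

theorem continuous_phaseAngle {b : ℝ} (hb : 0 < b) :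
    Continuous fun p : ℝ × ℝ => phaseAngle b p.1 p.2 := by
  unfold phaseAngle
  refine Continuous.add ?_ ?_
  · refine Real.continuous_arctan.comp (Continuous.div ?_ ?_ fun p =>
      (decayingSol_zero_pos hb p.2).ne')
    · exact (continuous_decayingSol'_right hb 0).comp continuous_snd
    · exact (continuous_decayingSol_right hb 0).comp continuous_snd
  · exact intervalIntegral.continuous_parametric_intervalIntegral_of_continuous
      (f := fun (p : ℝ × ℝ) e => angleDensity b e p.2)
      ((continuous_angleDensity hb).comp
        (by fun_prop : Continuous fun q : (ℝ × ℝ) × ℝ => (q.2, q.1.2))) continuous_fst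

theorem continuous_phaseAngle_left {b : ℝ} (hb : 0 < b) (s : ℝ) :
    Continuous fun E => phaseAngle b E s :=
  Continuous.comp (g := fun p : ℝ × ℝ => phaseAngle b p.1 p.2) (f := fun E : ℝ => (E, s))
    (continuous_phaseAngle hb) (by fun_prop)

theorem continuous_phaseAngle_right {b : ℝ} (hb : 0 < b) (E : ℝ) :
    Continuous fun s => phaseAngle b E s :=
  Continuous.comp (g := fun p : ℝ × ℝ => phaseAngle b p.1 p.2) (f := fun s : ℝ => (E, s))
    (continuous_phaseAngle hb) (by fun_prop)

theorem hasDerivAt_phaseAngle {b : ℝ} (hb : 0 < b) (E s : ℝ) :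
    HasDerivAt (fun E => phaseAngle b E s) (angleDensity b E s) E := by
  have hc : Continuous fun e => angleDensity b e s :=
    Continuous.comp (g := fun p : ℝ × ℝ => angleDensity b p.1 p.2) (f := fun E : ℝ => (E, s))
      (continuous_angleDensity hb) (by fun_prop)
  unfold phaseAngle
  exact HasDerivAt.const_add _ (hc.integral_hasStrictDerivAt 0 E).hasDerivAt

theorem strictMono_phaseAngle {b : ℝ} (hb : 0 < b) (s : ℝ) :
    StrictMono fun E => phaseAngle b E s :=
  strictMono_of_hasDerivAt_pos (fun E => hasDerivAt_phaseAngle hb E s)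
    fun E => angleDensity_pos hb E s

theorem phaseAngle_zero_mem {b : ℝ} (hb : 0 < b) (s : ℝ) :
    phaseAngle b 0 s ∈ Ioo (-(Real.pi / 2)) 0 := by
  have h0 := decayingSol_zero_pos hb s
  have h1 := decayingSol_zero_mul_neg hb s
  have h2 : decayingSol' b 0 s < 0 := by
    by_contra! h
    nlinarith
  simp only [phaseAngle, intervalIntegral.integral_same, add_zero]
  exact ⟨Real.neg_pi_div_two_lt_arctan _, Real.arctan_lt_zero.2 (div_neg_of_neg_of_pos h2 h0)⟩

theorem neg_pi_div_two_lt_phaseAngle {b E : ℝ} (hb : 0 < b) (hE : 0 ≤ E) (s : ℝ) :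
    -(Real.pi / 2) < phaseAngle b E s :=
  (phaseAngle_zero_mem hb s).1.trans_le ((strictMono_phaseAngle hb s).monotone hE)

/-- Only continuity of `f` is needed. Through this, the Wronskian identity yields derivatives in the
energy and of the levels without any differentiability of `u_E` in `E`. -/
theorem hasDerivWithinAt_sub_mul {f : ℝ → ℝ} {a : ℝ} {S : Set ℝ} (hf : ContinuousWithinAt f S a) :
    HasDerivWithinAt (fun x => (x - a) * f x) (f a) S a := by
  rw [hasDerivWithinAt_iff_tendsto_slope]
  have h1 : Tendsto f (𝓝[S \ {a}] a) (𝓝 (f a)) := hf.mono_left (nhdsWithin_mono _ sdiff_subset)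
  refine h1.congr' ?_
  filter_upwards [self_mem_nhdsWithin] with x hx
  have : x - a ≠ 0 := sub_ne_zero.2 hx.2
  rw [slope_def_field]
  field_simp
  simp

/-- The phase angle is an angle of the phase-plane vector. -/
theorem decayingSol_eq_cos {b E : ℝ} (hb : 0 < b) (hE : 0 ≤ E) (s : ℝ) :
    decayingSol b E s = phaseRadius b E s * Real.cos (phaseAngle b E s) ∧
      decayingSol' b E s = phaseRadius b E s * Real.sin (phaseAngle b E s) := by
  set c : ℝ → ℝ := fun e => decayingSol b e s / phaseRadius b e s with hc
  set d : ℝ → ℝ := fun e => decayingSol' b e s / phaseRadius b e s with hd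
  have hr : ∀ e, 0 ≤ e → 0 < phaseRadius b e s := fun e he => phaseRadius_pos hb he s
  have hunit : ∀ e, 0 ≤ e → c e ^ 2 + d e ^ 2 = 1 := by
    intro e he
    simp only [hc, hd, div_pow]
    rw [← add_div, ← phaseRadius_sq, div_self (pow_pos (hr e he) 2).ne']
  have cr : ContinuousOn (fun e => phaseRadius b e s) (Ici 0) :=
    ((continuous_phaseRadius hb).comp
      (by fun_prop : Continuous fun e : ℝ => (e, s))).continuousOn
  have cc : ContinuousOn c (Ici 0) :=
    (((continuous_decayingSol hb).comp
      (by fun_prop : Continuous fun e : ℝ => (e, s))).continuousOn).div cr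
      fun e he => (hr e he).ne'
  have cd : ContinuousOn d (Ici 0) :=
    (((continuous_decayingSol' hb).comp
      (by fun_prop : Continuous fun e : ℝ => (e, s))).continuousOn).div cr
      fun e he => (hr e he).ne'
  have hderiv : ∀ e, 0 ≤ e → HasDerivWithinAt c (-(angleDensity b e s * d e)) (Ici e) e ∧
      HasDerivWithinAt d (angleDensity b e s * c e) (Ici e) e := by
    intro e he
    have hsub : Ici e ⊆ Ici 0 := Ici_subset_Ici.2 he
    -- `X` and `Y` are the sine and the cosine of the angle from the unit vector `(c, d)` at `e` to
    -- the one at `e'`. The Wronskian identity differentiates `X`; `Y = √(1 - X²)` nearby then has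
    -- derivative `0` at `e`.
    set X : ℝ → ℝ := fun e' => c e * d e' - d e * c e' with hX
    set Y : ℝ → ℝ := fun e' => c e * c e' + d e * d e' with hY
    have hXe : X e = 0 := by simp only [hX]; ring
    have hYe : Y e = 1 := by simp only [hY]; rw [← hunit e he]; ring
    have hXd : HasDerivWithinAt X (angleDensity b e s) (Ici e) e := by
      have h1 : ContinuousWithinAt (fun e' => overlap b e e' s /
          (phaseRadius b e s * phaseRadius b e' s)) (Ici e) e := by
        refine ContinuousWithinAt.div ?_ (continuousWithinAt_const.mul
          ((cr e he).mono hsub)) (mul_pos (hr e he) (hr e he)).ne'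
        exact ((continuous_overlap hb).comp
          (by fun_prop : Continuous fun e' : ℝ => ((e, e'), s))).continuousWithinAt
      have h2 := hasDerivWithinAt_sub_mul h1
      have h3 : overlap b e e s / (phaseRadius b e s * phaseRadius b e s) = angleDensity b e s := by
        rw [angleDensity, max_eq_left he, sq]
      rw [h3] at h2
      refine h2.congr_of_mem (fun e' he' => ?_) self_mem_Ici
      have h4 := hr e he
      have h5 := hr e' (hsub he')
      have h6 := wronskian_decayingSol hb e e' s
      simp only [hX, hc, hd]
      rw [← mul_div_assoc (e' - e), ← h6]
      field_simp
    have hYd : HasDerivWithinAt Y 0 (Ici e) e := by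
      have h1 : HasDerivWithinAt (fun e' => Real.sqrt (1 - X e' ^ 2))
          (-(↑(2 : ℕ) * X e ^ (2 - 1) * angleDensity b e s) / (2 * Real.sqrt (1 - X e ^ 2)))
          (Ici e) e :=
        ((hXd.pow 2).const_sub 1).sqrt (by simp [hXe])
      have h2 : Y =ᶠ[𝓝[Ici e] e] fun e' => Real.sqrt (1 - X e' ^ 2) := by
        have hYc : ContinuousWithinAt Y (Ici e) e :=
          (continuousWithinAt_const.mul ((cc e he).mono hsub)).add
            (continuousWithinAt_const.mul ((cd e he).mono hsub))
        have hpos : ∀ᶠ e' in 𝓝[Ici e] e, 0 < Y e' :=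
          hYc.eventually_const_lt (by rw [hYe]; exact one_pos)
        filter_upwards [hpos, self_mem_nhdsWithin] with e' h3 h4
        have h5 : 1 - X e' ^ 2 = Y e' ^ 2 := by
          have h6 := hunit e he
          have h7 := hunit e' (hsub h4)
          have : X e' ^ 2 + Y e' ^ 2 = (c e ^ 2 + d e ^ 2) * (c e' ^ 2 + d e' ^ 2) := by
            simp only [hX, hY]; ring
          rw [h6, h7] at this
          linarith
        rw [h5, Real.sqrt_sq h3.le]
      refine (h1.congr_of_eventuallyEq_of_mem h2 self_mem_Ici).congr_deriv ?_
      rw [hXe]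
      simp
    constructor
    · refine (((hYd.const_mul (c e)).sub (hXd.const_mul (d e))).congr_of_mem (fun e' he' => ?_)
        self_mem_Ici).congr_deriv (by ring)
      simp only [hX, hY, Pi.sub_apply]
      linear_combination (-c e') * hunit e he
    · refine (((hYd.const_mul (d e)).add (hXd.const_mul (c e))).congr_of_mem (fun e' he' => ?_)
        self_mem_Ici).congr_deriv (by ring)
      simp only [hX, hY, Pi.add_apply]
      linear_combination (-d e') * hunit e he
  set α : ℝ → ℝ := fun e => phaseAngle b e s with hα
  -- The inner product of `(c, d)` with `(cos α, sin α)`. Both vectors rotate at the rate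
  -- `angleDensity`, so it is constant; it equals `1` at `E = 0` by the choice of arctangent, and
  -- unit vectors with inner product `1` coincide.
  set F : ℝ → ℝ := fun e => c e * Real.cos (α e) + d e * Real.sin (α e) with hF
  have hconst : F E = F 0 := by
    refine constant_of_has_deriv_right_zero (f := F) (a := 0) (b := E) ?_ ?_ E ⟨hE, le_rfl⟩
    · have ca : Continuous α := continuous_phaseAngle_left hb s
      have hs : Icc 0 E ⊆ Ici 0 := Icc_subset_Ici_self
      exact ((cc.mono hs).mul (Real.continuous_cos.comp ca).continuousOn).add
        ((cd.mono hs).mul (Real.continuous_sin.comp ca).continuousOn)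
    · intro e he
      obtain ⟨h1, h2⟩ := hderiv e he.1
      have h3 : HasDerivWithinAt α (angleDensity b e s) (Ici e) e :=
        (hasDerivAt_phaseAngle hb e s).hasDerivWithinAt
      exact ((h1.mul h3.cos).add (h2.mul h3.sin)).congr_deriv (by ring)
  have hF0 : F 0 = 1 := by
    have h0 := decayingSol_zero_pos hb s
    have h1 := hr 0 le_rfl
    have h2 : 1 + (decayingSol' b 0 s / decayingSol b 0 s) ^ 2 =
        (phaseRadius b 0 s / decayingSol b 0 s) ^ 2 := by
      rw [div_pow, div_pow, phaseRadius_sq]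
      field_simp
    simp only [hF, hα, hc, hd, phaseAngle, intervalIntegral.integral_same, add_zero,
      Real.cos_arctan, Real.sin_arctan, h2, Real.sqrt_sq (div_pos h1 h0).le]
    have h3 := phaseRadius_sq b 0 s
    field_simp
    linarith
  have hFE : c E * Real.cos (α E) + d E * Real.sin (α E) = 1 := hconst.trans hF0
  have hsq : (c E - Real.cos (α E)) ^ 2 + (d E - Real.sin (α E)) ^ 2 = 0 := by
    linear_combination hunit E hE + Real.cos_sq_add_sin_sq (α E) - 2 * hFE
  have e1 : c E = Real.cos (α E) := by
    nlinarith [sq_nonneg (c E - Real.cos (α E)), sq_nonneg (d E - Real.sin (α E))]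
  have e2 : d E = Real.sin (α E) := by
    nlinarith [sq_nonneg (c E - Real.cos (α E)), sq_nonneg (d E - Real.sin (α E))]
  have hrE := (hr E hE).ne'
  constructor
  · rw [← hα] at *
    change _ = _ * Real.cos (α E)
    rw [← e1]
    simp only [hc]
    field_simp
  · change _ = _ * Real.sin (α E)
    rw [← e2]
    simp only [hd]
    field_simp

theorem decayingSol_eq_zero_iff {b E : ℝ} (hb : 0 < b) (hE : 0 ≤ E) (s : ℝ) :
    decayingSol b E s = 0 ↔ Real.cos (phaseAngle b E s) = 0 := by
  rw [(decayingSol_eq_cos hb hE s).1, mul_eq_zero, or_iff_right (phaseRadius_pos hb hE s).ne']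

theorem decayingSol'_eq_zero_iff {b E : ℝ} (hb : 0 < b) (hE : 0 ≤ E) (s : ℝ) :
    decayingSol' b E s = 0 ↔ Real.sin (phaseAngle b E s) = 0 := by
  rw [(decayingSol_eq_cos hb hE s).2, mul_eq_zero, or_iff_right (phaseRadius_pos hb hE s).ne']

/-- The angle is negative at energy `0`. Reaching `0` at some energy `e ≤ E` would give `u_e'(s) =
0`, against `u_e u_e' < 0` on a forbidden half-line. -/
theorem phaseAngle_neg {b E s : ℝ} (hb : 0 < b) (hE : 0 ≤ E)
    (h : ∀ t, s ≤ t → E ≤ b ^ 2 * t ^ 2) : phaseAngle b E s < 0 := by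
  by_contra! hn
  obtain ⟨e, he, he0⟩ := intermediate_value_Icc hE (continuous_phaseAngle_left hb s).continuousOn
    ⟨(phaseAngle_zero_mem hb s).2.le, hn⟩
  have h1 := decayingSol_mul_neg hb he.1 (s := s) fun t ht => he.2.trans (h t ht)
  have h2 : decayingSol' b e s = 0 := by
    rw [decayingSol'_eq_zero_iff hb he.1]
    simp only at he0
    rw [he0, Real.sin_zero]
  rw [h2, mul_zero] at h1
  exact lt_irrefl _ h1

/-! ### The phase angle as a function of the position -/

/-- A function that decreases whenever it takes the value `c` can cross `c` only downwards. -/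
theorem lt_of_crossing {f : ℝ → ℝ} {x y c : ℝ} (hf : ContinuousOn f (Icc x y)) (hxy : x < y)
    (hcross : ∀ z ∈ Icc x y, f z = c → ∃ d < 0, HasDerivAt f d z) (hx : f x ≤ c) : f y < c := by
  have slope_neg : ∀ z ∈ Icc x y, f z = c → ∀ᶠ w in 𝓝[≠] z, slope f z w < 0 := by
    intro z hz hzc
    obtain ⟨d, hd, hder⟩ := hcross z hz hzc
    exact (hasDerivAt_iff_tendsto_slope.1 hder).eventually_lt_const hd
  -- strict version
  have main : ∀ x', x ≤ x' → x' < y → f x' < c → f y < c := by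
    intro x' hx' hx'y hlt
    by_contra! hy
    have hcont : ContinuousOn f (Icc x' y) := hf.mono (Icc_subset_Icc_left hx')
    set S := {z | z ∈ Icc x' y ∧ f z = c} with hS
    have hSne : S.Nonempty := by
      obtain ⟨z, hz, hzc⟩ := intermediate_value_Icc hx'y.le hcont ⟨hlt.le, hy⟩
      exact ⟨z, hz, hzc⟩
    have hSc : IsCompact S :=
      isCompact_Icc.of_isClosed_subset
        (hcont.preimage_isClosed_of_isClosed isClosed_Icc isClosed_singleton) fun z hz => hz.1
    -- At the first return `z` to the level `c`, the negative slope puts values above `c` just to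
    -- the left of `z`, hence an even earlier return.
    obtain ⟨z, ⟨hzI, hzc⟩, hzmin⟩ := hSc.exists_isLeast hSne
    have hx'z : x' < z := lt_of_le_of_ne hzI.1 (by rintro rfl; exact hlt.ne hzc)
    have h1 : ∀ᶠ w in 𝓝[<] z, slope f z w < 0 :=
      (slope_neg z ⟨hx'.trans hzI.1, hzI.2⟩ hzc).filter_mono
        (nhdsWithin_mono _ fun w hw => ne_of_lt hw)
    have h2 : ∀ᶠ w in 𝓝[<] z, w ∈ Ioo x' z := Ioo_mem_nhdsLT hx'z
    obtain ⟨w, hw1, hw2⟩ := (h1.and h2).exists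
    rw [slope_def_field, div_neg_iff] at hw1
    have hw3 : c < f w := by
      rcases hw1 with h | h
      · linarith [h.1]
      · linarith [h.2, hw2.2]
    obtain ⟨v, hv, hvc⟩ := intermediate_value_Icc hw2.1.le
      (hcont.mono (Icc_subset_Icc_right (hw2.2.le.trans hzI.2))) ⟨hlt.le, hw3.le⟩
    have := hzmin ⟨⟨hv.1, hv.2.trans (hw2.2.le.trans hzI.2)⟩, hvc⟩
    linarith [hv.2, hw2.2]
  rcases hx.lt_or_eq with hx | hx
  · exact main x le_rfl hxy hx
  · have h1 : ∀ᶠ w in 𝓝[>] x, slope f x w < 0 :=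
      (slope_neg x ⟨le_rfl, hxy.le⟩ hx).filter_mono
        (nhdsWithin_mono _ fun w hw => ne_of_gt hw)
    obtain ⟨w, hw1, hw2⟩ := (h1.and (Ioo_mem_nhdsGT hxy)).exists
    rw [slope_def_field, div_neg_iff] at hw1
    refine main w hw2.1.le hw2.2 ?_
    rcases hw1 with h | h
    · linarith [h.2, hw2.1]
    · linarith [h.1]

/-- Formally `θ' = ((b² s² - E) u² - u'²)/(u² + u'²)`, which is `-1` where `u = 0`. -/
theorem hasDerivAt_phaseAngle_of_cos_eq_zero {b E s : ℝ} (hb : 0 < b) (hE : 0 ≤ E)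
    (h : Real.cos (phaseAngle b E s) = 0) :
    HasDerivAt (fun t => phaseAngle b E t) (-1) s := by
  set a := phaseAngle b E s with ha
  have hsin : Real.sin a ^ 2 = 1 := by
    have := Real.sin_sq_add_cos_sq a
    rw [h] at this
    linarith
  -- Since `cos a = 0`, this is `sin(θ(t) - a)`; near `s` the arcsine recovers `θ(t) - a`.
  set w : ℝ → ℝ := fun t => -(Real.sin a * decayingSol b E t) / phaseRadius b E t with hw
  have hr := phaseRadius_pos hb hE s
  have hU := hasDerivAt_decayingSol hb E s
  have hrd : DifferentiableAt ℝ (fun t => phaseRadius b E t) s := by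
    have := (hU.pow 2).add ((hasDerivAt_decayingSol' hb E s).pow 2)
    refine (this.sqrt ?_).differentiableAt
    have h2 := pow_pos hr 2
    rw [phaseRadius_sq] at h2
    exact h2.ne'
  have hU0 := (decayingSol_eq_zero_iff hb hE s).2 h
  have hw0 : w s = 0 := by simp [hw, hU0]
  have hwd : HasDerivAt w (-1) s := by
    refine ((hU.const_mul (Real.sin a)).neg.div hrd.hasDerivAt hr.ne').congr_deriv ?_
    simp only [Pi.neg_apply]
    rw [(decayingSol_eq_cos hb hE s).2, hU0, ← ha]
    field_simp
    linear_combination (-phaseRadius b E s ^ 2) * hsin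
  have hasin : HasDerivAt (fun t => a + Real.arcsin (w t)) (-1) s := by
    have h1 : HasDerivAt Real.arcsin 1 (w s) := by
      rw [hw0]
      simpa using Real.hasDerivAt_arcsin (x := 0) (by norm_num) (by norm_num)
    exact ((h1.comp s hwd).const_add a).congr_deriv (by norm_num)
  refine hasin.congr_of_eventuallyEq ?_
  have hcont := (continuous_phaseAngle_right hb E).continuousAt (x := s)
  filter_upwards [hcont.preimage_mem_nhds
    (Metric.ball_mem_nhds (phaseAngle b E s) (half_pos Real.pi_pos))] with t ht
  rw [mem_preimage, Metric.mem_ball, Real.dist_eq, ← ha, abs_lt] at ht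
  have h1 : w t = Real.sin (phaseAngle b E t - a) := by
    have h2 := (phaseRadius_pos hb hE t).ne'
    simp only [hw]
    rw [(decayingSol_eq_cos hb hE t).1, Real.sin_sub, h]
    field_simp
    ring
  rw [h1, Real.arcsin_sin (by linarith) (by linarith)]
  ring

theorem cos_level (m : ℤ) : Real.cos (Real.pi / 2 + m * Real.pi) = 0 := by
  rw [Real.cos_eq_zero_iff]
  exact ⟨m, by ring⟩

/-- As `s` increases, the phase angle crosses the levels `π/2 + mπ` only downwards. -/
theorem phaseAngle_barrier {b E s t : ℝ} (hb : 0 < b) (hE : 0 ≤ E) (hst : s < t) (m : ℤ)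
    (h : phaseAngle b E s ≤ Real.pi / 2 + m * Real.pi) :
    phaseAngle b E t < Real.pi / 2 + m * Real.pi := by
  refine lt_of_crossing (f := fun t => phaseAngle b E t)
    (continuous_phaseAngle_right hb E).continuousOn hst (fun z _ hz => ?_) h
  refine ⟨-1, by norm_num, hasDerivAt_phaseAngle_of_cos_eq_zero hb hE ?_⟩
  rw [show phaseAngle b E z = _ from hz, cos_level]

/-- Sturm comparison puts a zero of `u` in every window of length `π/c`, and since odd multiples of
`π/2` are crossed only downwards, each zero costs the angle a further `π`. -/
theorem phaseAngle_lower_bound {b E c : ℝ} (hb : 0 < b) (hE : 0 ≤ E) (hc : 0 < c) (n : ℕ) :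
    ∀ a, (∀ x ∈ Icc a (a + n * (2 * Real.pi / c)), b ^ 2 * x ^ 2 - E ≤ -c ^ 2) →
      -(Real.pi / 2) + n * Real.pi < phaseAngle b E a := by
  induction n with
  | zero => intro a _; simpa using neg_pi_div_two_lt_phaseAngle hb hE a
  | succ n ih =>
    intro a ha
    have hpc : 0 < Real.pi / c := div_pos Real.pi_pos hc
    have e2 : 2 * Real.pi / c = 2 * (Real.pi / c) := by ring
    have hn : 0 ≤ (n : ℝ) * (2 * (Real.pi / c)) := by positivity
    rw [e2] at ih ha
    push_cast at ha
    have h1 := ih (a + 2 * (Real.pi / c)) fun x hx => ha x ⟨by linarith [hx.1], by linarith [hx.2]⟩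
    -- The zero is sought in the second half of the window of length `2π/c`, so that `a < z`
    -- strictly and the barrier applies on `[a, z]`.
    obtain ⟨z, hz, hz0⟩ := ((solvesOn_decayingSol hb E).mono (subset_univ _)).exists_zero
      (a := a + Real.pi / c) hc fun x hx => ha x ⟨by linarith [hx.1], by linarith [hx.2]⟩
    rw [decayingSol_eq_zero_iff hb hE, Real.cos_eq_zero_iff] at hz0
    obtain ⟨l, hl⟩ := hz0
    have hl' : phaseAngle b E z = Real.pi / 2 + l * Real.pi := by rw [hl]; ring
    have hln : (n : ℤ) ≤ l := by
      by_contra! hlt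
      have hlt : (l : ℝ) ≤ n - 1 := by
        have : l ≤ (n : ℤ) - 1 := by omega
        exact_mod_cast this
      have h2 : phaseAngle b E (a + 2 * (Real.pi / c)) ≤ Real.pi / 2 + l * Real.pi := by
        rcases (show z ≤ a + 2 * (Real.pi / c) by linarith [hz.2]).lt_or_eq with h | h
        · exact (phaseAngle_barrier hb hE h l hl'.le).le
        · rw [← h, hl']
      have := mul_le_mul_of_nonneg_right hlt Real.pi_pos.le
      linarith
    have hln' : (n : ℝ) ≤ l := by exact_mod_cast hln
    have h3 := mul_le_mul_of_nonneg_right hln' Real.pi_pos.le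
    have h4 : Real.pi / 2 + l * Real.pi < phaseAngle b E a := by
      by_contra! h
      have := phaseAngle_barrier hb hE (show a < z by linarith [hz.1]) l h
      linarith
    push_cast
    linarith

theorem exists_phaseAngle_gt {b : ℝ} (hb : 0 < b) (s : ℝ) (n : ℕ) :
    ∃ E, 0 ≤ E ∧ n * Real.pi < phaseAngle b E s := by
  -- Makes `n + 1` windows of length `2π/c` fill an interval of length exactly `1`.
  set c := 2 * Real.pi * (n + 1) with hc
  have hcpos : 0 < c := by positivity
  refine ⟨c ^ 2 + b ^ 2 * (|s| + 1) ^ 2, by positivity, ?_⟩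
  have h := phaseAngle_lower_bound hb (E := c ^ 2 + b ^ 2 * (|s| + 1) ^ 2) (by positivity) hcpos
    (n + 1) s ?_
  · push_cast at h
    linarith [Real.pi_pos]
  · intro x hx
    have e : ((n + 1 : ℕ) : ℝ) * (2 * Real.pi / c) = 1 := by
      rw [hc]
      push_cast
      field_simp
    rw [e] at hx
    have h1 : |x| ≤ |s| + 1 := by
      rw [abs_le]
      constructor <;> linarith [hx.1, hx.2, neg_abs_le s, le_abs_self s]
    have h2 : x ^ 2 ≤ (|s| + 1) ^ 2 := by
      rw [← sq_abs x]
      gcongr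
    nlinarith [sq_nonneg b, mul_le_mul_of_nonneg_left h2 (sq_nonneg b)]

/-! ### Eigenfunctions -/

/-- The Wronskian with `u_E` vanishes, so the Cauchy data at `0` are proportional to those of `u_E`.
The constant `c` is the orthogonal projection coefficient, which avoids dividing by `u_E(s)` or
`u_E'(s)`. -/
theorem decayingSol_unique {b E s : ℝ} {u v : ℝ → ℝ} (hb : 0 < b) (hE : 0 ≤ E)
    (h : SolvesOn (fun x => b ^ 2 * (x + s) ^ 2 - E) u v (Ici 0))
    (hu : IntegrableOn (fun x => u x ^ 2) (Ioi 0)) :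
    ∃ c, ∀ x, 0 ≤ x → u x = c * decayingSol b E (x + s) ∧ v x = c * decayingSol' b E (x + s) := by
  have hU := solvesOn_decayingSol_add hb E s (Ici 0)
  have hW := h.wronskian_eq_zero hU hu (integrableOn_sq_decayingSol hb E s)
    (integrableOn_sq_decayingSol' hb E s) 0 le_rfl
  rw [zero_add] at hW
  set U := decayingSol b E s with hUdef
  set V := decayingSol' b E s with hVdef
  have hr : 0 < U ^ 2 + V ^ 2 := by
    rcases not_and_or.1 (decayingSol_ne_zero hb hE s) with h | h <;> positivity
  set c := (u 0 * U + v 0 * V) / (U ^ 2 + V ^ 2) with hc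
  refine ⟨c, fun x hx => ?_⟩
  have h1 := (h.sub_mul hU c).eq_zero_Ici (by fun_prop) ?_ ?_ x hx
  · exact ⟨sub_eq_zero.1 h1.1, sub_eq_zero.1 h1.2⟩
  · rw [zero_add, ← hUdef, hc]
    field_simp
    linear_combination V * hW
  · rw [zero_add, ← hVdef, hc]
    field_simp
    linear_combination (-U) * hW

theorem solvesOn_re_im {Q : ℝ → ℝ} {g p : ℝ → ℂ} (hg : ∀ x, HasDerivAt g (p x) x)
    (hp : ∀ x, HasDerivAt p ((Q x : ℂ) * g x) x) :
    SolvesOn Q (fun x => (g x).re) (fun x => (p x).re) univ ∧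
      SolvesOn Q (fun x => (g x).im) (fun x => (p x).im) univ := by
  constructor
  · intro x _
    refine ⟨Complex.reCLM.hasFDerivAt.comp_hasDerivAt x (hg x), ?_⟩
    refine (Complex.reCLM.hasFDerivAt.comp_hasDerivAt x (hp x)).congr_deriv ?_
    simp
  · intro x _
    refine ⟨Complex.imCLM.hasFDerivAt.comp_hasDerivAt x (hg x), ?_⟩
    refine (Complex.imCLM.hasFDerivAt.comp_hasDerivAt x (hp x)).congr_deriv ?_
    simp

theorem integrable_re_im_sq {g : ℝ → ℂ} (hc : Continuous g)
    (hg : Integrable fun x => ‖g x‖ ^ 2) :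
    Integrable (fun x => (g x).re ^ 2) ∧ Integrable (fun x => (g x).im ^ 2) := by
  constructor
  · refine hg.mono' (by fun_prop) (Eventually.of_forall fun x => ?_)
    rw [Real.norm_of_nonneg (sq_nonneg _), ← sq_abs]
    have := Complex.abs_re_le_norm (g x)
    gcongr
  · refine hg.mono' (by fun_prop) (Eventually.of_forall fun x => ?_)
    rw [Real.norm_of_nonneg (sq_nonneg _), ← sq_abs]
    have := Complex.abs_im_le_norm (g x)
    gcongr

theorem decayingSol_unique_complex {b E s : ℝ} {Q : ℝ → ℝ} {g p : ℝ → ℂ} (hb : 0 < b) (hE : 0 ≤ E)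
    (hQ : ∀ x, 0 ≤ x → Q x = b ^ 2 * (x + s) ^ 2 - E)
    (hg : ∀ x, HasDerivAt g (p x) x) (hp : ∀ x, HasDerivAt p ((Q x : ℂ) * g x) x)
    (hi : Integrable fun x => ‖g x‖ ^ 2) :
    ∃ c : ℂ, ∀ x, 0 ≤ x → g x = c * decayingSol b E (x + s) ∧
      p x = c * decayingSol' b E (x + s) := by
  have hc : Continuous g := continuous_iff_continuousAt.2 fun x => (hg x).continuousAt
  obtain ⟨h1, h2⟩ := solvesOn_re_im hg hp
  obtain ⟨i1, i2⟩ := integrable_re_im_sq hc hi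
  have conv : ∀ {u v : ℝ → ℝ}, SolvesOn Q u v univ →
      SolvesOn (fun x => b ^ 2 * (x + s) ^ 2 - E) u v (Ici 0) := by
    intro u v h x hx
    simp only
    rw [← hQ x hx]
    exact h x (mem_univ x)
  obtain ⟨cr, hcr⟩ := decayingSol_unique hb hE (conv h1) i1.integrableOn
  obtain ⟨ci, hci⟩ := decayingSol_unique hb hE (conv h2) i2.integrableOn
  refine ⟨⟨cr, ci⟩, fun x hx => ⟨?_, ?_⟩⟩
  · apply Complex.ext <;> simp [(hcr x hx).1, (hci x hx).1]
  · apply Complex.ext <;> simp [(hcr x hx).2, (hci x hx).2]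

/-- On a forbidden line `u u' ≤ 0` from the right and, by reflection, `u u' ≥ 0` from the left; so
`u²` is constant and integrable. -/
theorem SolvesOn.eq_zero_of_nonneg {q u v : ℝ → ℝ} (h : SolvesOn q u v univ)
    (hq : ∀ x, 0 ≤ q x) (hu : Integrable fun x => u x ^ 2) (x : ℝ) : u x = 0 := by
  have h1 : ∀ y, u y * v y ≤ 0 := fun y =>
    (h.mono (subset_univ (Ici y))).mul_nonpos (fun z _ => hq z) hu.integrableOn y le_rfl
  have h2 : ∀ y, 0 ≤ u y * v y := by
    intro y
    have := (h.comp_neg.mono (subset_univ (Ici (-y)))).mul_nonpos (fun z _ => hq (-z))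
      (hu.comp_neg).integrableOn (-y) le_rfl
    simp only [neg_neg] at this
    linarith
  have hd : ∀ y, HasDerivAt (fun y => u y ^ 2) 0 y := by
    intro y
    refine ((h y (mem_univ y)).1.pow 2).congr_deriv ?_
    have := le_antisymm (h1 y) (h2 y)
    push_cast
    linear_combination 2 * this
  have hconst : ∀ y, u y ^ 2 = u x ^ 2 := fun y =>
    is_const_of_deriv_eq_zero (fun y => (hd y).differentiableAt) (fun y => (hd y).deriv) y x
  by_contra hne
  exact not_integrableOn_Ioi_of_le (a := 0) (c := u x ^ 2) (by positivity)
    (fun y _ => (hconst y).ge) hu.integrableOn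

theorem integrable_norm_sq_of_ae_eq {u : L2R} {g : ℝ → ℂ} (h : (u : ℝ → ℂ) =ᵐ[volume] g) :
    Integrable fun x => ‖g x‖ ^ 2 := by
  have h1 := (memLp_two_iff_integrable_sq_norm (Lp.memLp u).1).1 (Lp.memLp u)
  refine h1.congr ?_
  filter_upwards [h] with x hx
  rw [hx]

theorem norm_sq_eq_integral {u : L2R} {g : ℝ → ℂ} (h : (u : ℝ → ℂ) =ᵐ[volume] g) :
    ‖u‖ ^ 2 = ∫ x, ‖g x‖ ^ 2 := by
  have h1 := L2.inner_def (𝕜 := ℂ) u u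
  rw [inner_self_eq_norm_sq_to_K] at h1
  have h2 : (∫ x, inner ℂ ((u : ℝ → ℂ) x) ((u : ℝ → ℂ) x)) = ((∫ x, ‖g x‖ ^ 2 : ℝ) : ℂ) := by
    rw [← integral_complex_ofReal]
    apply integral_congr_ae
    filter_upwards [h] with x hx
    rw [hx, inner_self_eq_norm_sq_to_K]
    simp
  rw [h2] at h1
  apply Complex.ofReal_injective
  refine Eq.trans ?_ h1
  simp

/-- An eigenfunction in integrated form is a classical solution. -/
theorem isFiberPair_smul {b k E : ℝ} {u : L2R} (h : IsFiberPair b k u ((E : ℂ) • u)) :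
    ∃ g p : ℝ → ℂ, (u : ℝ → ℂ) =ᵐ[volume] g ∧ (∀ x, HasDerivAt g (p x) x) ∧
      ∀ x, HasDerivAt p (((effPotential b k x - E : ℝ) : ℂ) * g x) x := by
  obtain ⟨g, p, hu, hg, hp⟩ := h
  refine ⟨g, p, hu, hg, fun x => ?_⟩
  have hc : Continuous g := continuous_iff_continuousAt.2 fun x => (hg x).continuousAt
  have hc' : Continuous fun x => ((effPotential b k x - E : ℝ) : ℂ) * g x := by
    have := continuous_effPotential b k
    simp only [Complex.ofReal_sub]
    fun_prop
  have hp' : p = fun x => p 0 + ∫ t in (0 : ℝ)..x, ((effPotential b k t - E : ℝ) : ℂ) * g t := by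
    funext x
    rw [← sub_eq_iff_eq_add', hp x]
    apply intervalIntegral.integral_congr_ae
    filter_upwards [Lp.coeFn_smul (E : ℂ) u, hu] with t h1 h2 _
    rw [h1, Pi.smul_apply, h2, smul_eq_mul]
    push_cast
    ring
  rw [hp']
  exact ((hc'.integral_hasStrictDerivAt 0 x).hasDerivAt).const_add _

theorem effPotential_eq {b : ℝ} (hb : 0 < b) (k x : ℝ) :
    effPotential b k x = b ^ 2 * (|x| + -k / b) ^ 2 := by
  unfold effPotential
  field_simp
  ring

/-- Eigenvalues are positive, and eigenfunctions are multiples of the even or of the odd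
extension of the decaying solution. -/
theorem eigenfunction_classification {b k E : ℝ} {u : L2R} (hb : 0 < b) (hu0 : u ≠ 0)
    (h : IsFiberPair b k u ((E : ℂ) • u)) :
    0 ≤ E ∧ ∃ c : ℂ, c ≠ 0 ∧
      ((decayingSol' b E (-k / b) = 0 ∧
          (u : ℝ → ℂ) =ᵐ[volume] fun x => c * decayingSol b E (|x| + -k / b)) ∨
        (decayingSol b E (-k / b) = 0 ∧
          ∃ g : ℝ → ℂ, (u : ℝ → ℂ) =ᵐ[volume] g ∧ Continuous g ∧ ∀ x, g (-x) = -g x)) := by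
  obtain ⟨g, p, hu, hg, hp⟩ := isFiberPair_smul h
  have hc : Continuous g := continuous_iff_continuousAt.2 fun x => (hg x).continuousAt
  have hi := integrable_norm_sq_of_ae_eq hu
  have hgne : ¬ ∀ x, g x = 0 := by
    intro h0
    apply hu0
    rw [Lp.eq_zero_iff_ae_eq_zero]
    filter_upwards [hu] with x hx
    rw [hx, h0 x]
    rfl
  have hE : 0 ≤ E := by
    by_contra! hneg
    apply hgne
    intro x
    obtain ⟨h1, h2⟩ := solvesOn_re_im hg hp
    obtain ⟨i1, i2⟩ := integrable_re_im_sq hc hi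
    have hq : ∀ x, 0 ≤ effPotential b k x - E := fun x => by
      have : 0 ≤ effPotential b k x := sq_nonneg _
      linarith
    exact Complex.ext (h1.eq_zero_of_nonneg hq i1 x) (h2.eq_zero_of_nonneg hq i2 x)
  refine ⟨hE, ?_⟩
  set s := -k / b with hs
  obtain ⟨c, hcr⟩ := decayingSol_unique_complex (s := s) hb hE
    (fun x hx => by rw [effPotential_eq hb, abs_of_nonneg hx]) hg hp hi
  have hg' : ∀ x, HasDerivAt (fun x => g (-x)) (-p (-x)) x := fun x => by
    exact ((hg (-x)).scomp x (hasDerivAt_neg x)).congr_deriv (by simp)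
  have hp' : ∀ x, HasDerivAt (fun x => -p (-x))
      (((effPotential b k x - E : ℝ) : ℂ) * g (-x)) x := fun x => by
    have := ((hp (-x)).scomp x (hasDerivAt_neg x)).neg
    refine this.congr_deriv ?_
    rw [show effPotential b k (-x) = effPotential b k x by simp [effPotential]]
    simp
  obtain ⟨c', hcl⟩ := decayingSol_unique_complex (s := s) hb hE
    (fun x hx => by rw [effPotential_eq hb, abs_of_nonneg hx]) hg' hp' hi.comp_neg
  obtain ⟨a1, a2⟩ := hcr 0 le_rfl
  obtain ⟨b1, b2⟩ := hcl 0 le_rfl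
  simp only [neg_zero, zero_add] at a1 a2 b1 b2
  -- Continuity of `g` and of `g'` at `0` matches the coefficients `c` on the right and `c'` on the
  -- left: `c = c'` unless `u_E(s) = 0`, and `c = -c'` unless `u_E'(s) = 0`.
  have e1 : (c - c') * decayingSol b E s = 0 := by
    rw [sub_mul, ← a1, ← b1, sub_self]
  have e2 : (c + c') * decayingSol' b E s = 0 := by
    rw [add_mul, ← a2, ← b2, add_neg_cancel]
  have hne := decayingSol_ne_zero hb hE s
  have hgl : ∀ x, x ≤ 0 → g x = c' * decayingSol b E (-x + s) := fun x hx => by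
    have := (hcl (-x) (by linarith)).1
    simpa using this
  by_cases hU' : decayingSol' b E s = 0
  · have hU : (decayingSol b E s : ℂ) ≠ 0 := by
      exact_mod_cast fun h0 => hne ⟨h0, hU'⟩
    have hcc : c = c' := sub_eq_zero.1 ((mul_eq_zero.1 e1).resolve_right hU)
    have hgx : ∀ x, g x = c * decayingSol b E (|x| + s) := by
      intro x
      rcases le_total 0 x with hx | hx
      · rw [abs_of_nonneg hx, (hcr x hx).1]
      · rw [abs_of_nonpos hx, hgl x hx, hcc]
    refine ⟨c, ?_, Or.inl ⟨hU', ?_⟩⟩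
    · rintro rfl
      exact hgne fun x => by rw [hgx x, zero_mul]
    · filter_upwards [hu] with x hx
      rw [hx, hgx x]
  · have hU'c : (decayingSol' b E s : ℂ) ≠ 0 := by exact_mod_cast hU'
    have hcc : c' = -c := by
      linear_combination (mul_eq_zero.1 e2).resolve_right hU'c
    have hc0 : c ≠ 0 := by
      rintro rfl
      apply hgne
      intro x
      rcases le_total 0 x with hx | hx
      · rw [(hcr x hx).1, zero_mul]
      · rw [hgl x hx, hcc, neg_zero, zero_mul]
    refine ⟨c, hc0, Or.inr ⟨?_, g, hu, hc, fun x => ?_⟩⟩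
    · rw [hcc, sub_neg_eq_add, ← two_mul] at e1
      have := (mul_eq_zero.1 e1).resolve_left (mul_ne_zero two_ne_zero hc0)
      exact_mod_cast this
    · rcases le_total 0 x with hx | hx
      · rw [hgl (-x) (by linarith), neg_neg, (hcr x hx).1, hcc]
        ring
      · rw [hgl x hx, (hcr (-x) (by linarith)).1, hcc]
        ring

/-- Even (`ε = 1`) or odd (`ε = -1`) extension of a function on the half-line. -/
def extendBy (ε : ℝ) (u : ℝ → ℝ) (x : ℝ) : ℝ := if 0 ≤ x then u x else ε * u (-x)

theorem hasDerivAt_extendBy {ε : ℝ} {u u' : ℝ → ℝ} (hu : ∀ x, HasDerivAt u (u' x) x)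
    (h0 : ε * u 0 = u 0) (h0' : -ε * u' 0 = u' 0) (x : ℝ) :
    HasDerivAt (extendBy ε u) (extendBy (-ε) u' x) x := by
  have hneg : ∀ x, HasDerivAt (fun x => ε * u (-x)) (-ε * u' (-x)) x := fun x => by
    refine (((hu (-x)).comp x (hasDerivAt_neg x)).const_mul ε).congr_deriv ?_
    ring
  rcases lt_trichotomy x 0 with hx | rfl | hx
  · rw [extendBy, if_neg (not_le.2 hx)]
    refine (hneg x).congr_of_eventuallyEq ?_
    filter_upwards [Iio_mem_nhds hx] with y hy
    rw [extendBy, if_neg (not_le.2 hy)]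
  · rw [extendBy, if_pos le_rfl]
    have h1 : HasDerivWithinAt (extendBy ε u) (u' 0) (Ici 0) 0 :=
      (hu 0).hasDerivWithinAt.congr_of_mem (fun y hy => by rw [extendBy, if_pos (show 0 ≤ y from hy)])
        self_mem_Ici
    have h2 : HasDerivWithinAt (extendBy ε u) (u' 0) (Iic 0) 0 := by
      have := (hneg 0).hasDerivWithinAt (s := Iic 0)
      rw [neg_zero, h0'] at this
      refine this.congr_of_mem (fun y hy => ?_) self_mem_Iic
      rcases (show y ≤ 0 from hy).lt_or_eq with hy | rfl
      · rw [extendBy, if_neg (not_le.2 hy)]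
      · rw [extendBy, if_pos le_rfl, neg_zero, h0]
    have := h1.union h2
    rwa [Ici_union_Iic, hasDerivWithinAt_univ] at this
  · rw [extendBy, if_pos hx.le]
    refine (hu x).congr_of_eventuallyEq ?_
    filter_upwards [Ioi_mem_nhds hx] with y hy
    rw [extendBy, if_pos (le_of_lt hy)]

theorem extendBy_sq {ε : ℝ} (hε : ε ^ 2 = 1) (u : ℝ → ℝ) (x : ℝ) :
    extendBy ε u x ^ 2 = u |x| ^ 2 := by
  unfold extendBy
  split_ifs with h
  · rw [abs_of_nonneg h]
  · rw [abs_of_neg (not_le.1 h), mul_pow, hε, one_mul]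

theorem extendBy_one (u : ℝ → ℝ) (x : ℝ) : extendBy 1 u x = u |x| := by
  unfold extendBy
  split_ifs with h
  · rw [abs_of_nonneg h]
  · rw [abs_of_neg (not_le.1 h), one_mul]

theorem integral_decayingSol_abs_sq (b E s : ℝ) :
    ∫ x, decayingSol b E (|x| + s) ^ 2 = 2 * overlap b E E s := by
  rw [integral_comp_abs (f := fun x => decayingSol b E (x + s) ^ 2), overlap]
  simp only [sq]

theorem integrable_decayingSol_abs_sq {b E : ℝ} (hb : 0 < b) (hE : 0 ≤ E) (s : ℝ) :
    Integrable fun x => decayingSol b E (|x| + s) ^ 2 := by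
  apply Integrable.of_integral_ne_zero
  rw [integral_decayingSol_abs_sq]
  exact mul_ne_zero two_ne_zero (overlap_self_pos hb hE s).ne'

/-- The (even or odd) extension of the decaying solution is an eigenfunction. -/
theorem exists_eigenfunction {b k E ε : ℝ} (hb : 0 < b) (hE : 0 ≤ E) (hε : ε ^ 2 = 1)
    (h0 : ε * decayingSol b E (-k / b) = decayingSol b E (-k / b))
    (h0' : -ε * decayingSol' b E (-k / b) = decayingSol' b E (-k / b)) (c : ℝ) :
    ∃ u : L2R, ((u : ℝ → ℂ) =ᵐ[volume] fun x =>
        ((c * extendBy ε (fun x => decayingSol b E (x + -k / b)) x : ℝ) : ℂ)) ∧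
      IsFiberPair b k u ((E : ℂ) • u) ∧
      ‖u‖ ^ 2 = c ^ 2 * (2 * overlap b E E (-k / b)) := by
  set s := -k / b with hs
  set G := extendBy ε (fun x => decayingSol b E (x + s)) with hG
  set P := extendBy (-ε) (fun x => decayingSol' b E (x + s)) with hP
  have hGd : ∀ x, HasDerivAt G (P x) x := hasDerivAt_extendBy
    (fun x => (solvesOn_decayingSol_add hb E s univ x (mem_univ x)).1)
    (by simpa using h0) (by simpa using h0')
  have hPd : ∀ x, HasDerivAt P ((effPotential b k x - E) * G x) x := by
    intro x
    refine (hasDerivAt_extendBy (ε := -ε)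
      (fun x => (solvesOn_decayingSol_add hb E s univ x (mem_univ x)).2)
      (by simpa using h0') (by
        simp only [zero_add, neg_neg]
        linear_combination (b ^ 2 * s ^ 2 - E) * h0) x).congr_deriv ?_
    rw [hG, neg_neg, effPotential_eq hb, ← hs]
    unfold extendBy
    split_ifs with hx
    · rw [abs_of_nonneg hx]
    · rw [abs_of_neg (not_le.1 hx)]
      ring
  have hGc : Continuous G := continuous_iff_continuousAt.2 fun x => (hGd x).continuousAt
  have hsq : ∀ x, ‖((c * G x : ℝ) : ℂ)‖ ^ 2 = c ^ 2 * decayingSol b E (|x| + s) ^ 2 := by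
    intro x
    rw [Complex.norm_real, Real.norm_eq_abs, sq_abs, mul_pow, hG, extendBy_sq hε]
  have hLp : MemLp (fun x => ((c * G x : ℝ) : ℂ)) 2 volume := by
    rw [memLp_two_iff_integrable_sq_norm (by fun_prop)]
    simp_rw [hsq]
    exact (integrable_decayingSol_abs_sq hb hE s).const_mul _
  have hae : (hLp.toLp : ℝ → ℂ) =ᵐ[volume] fun x => ((c * G x : ℝ) : ℂ) := hLp.coeFn_toLp
  refine ⟨hLp.toLp, hae, ⟨fun x => ((c * G x : ℝ) : ℂ), fun x => ((c * P x : ℝ) : ℂ), hae,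
    fun x => ((hGd x).const_mul c).ofReal_comp, fun x => ?_⟩, ?_⟩
  · have hint : ∀ x, IntervalIntegrable (fun t => c * ((effPotential b k t - E) * G t))
        volume 0 x := fun x => by
      apply Continuous.intervalIntegrable
      unfold effPotential
      fun_prop
    have h1 := intervalIntegral.integral_eq_sub_of_hasDerivAt (a := 0) (b := x)
      (fun t _ => (hPd t).const_mul c) (hint x)
    rw [← Complex.ofReal_sub, ← h1, ← intervalIntegral.integral_ofReal]
    apply intervalIntegral.integral_congr_ae
    filter_upwards [Lp.coeFn_smul (E : ℂ) hLp.toLp, hae] with t h2 h3 _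
    rw [h2, Pi.smul_apply, h3, smul_eq_mul]
    push_cast
    ring
  · rw [norm_sq_eq_integral hae]
    simp_rw [hsq]
    rw [integral_const_mul, integral_decayingSol_abs_sq]

/-! ### The eigenvalues -/

theorem mem_eigenvalues_fiberOperator {b k E : ℝ} :
    E ∈ eigenvalues (fiberOperator b k) ↔ ∃ u : L2R, u ≠ 0 ∧ IsFiberPair b k u ((E : ℂ) • u) := by
  constructor
  · rintro ⟨u, hu, h⟩
    refine ⟨u, hu, ?_⟩
    rw [← mem_graph_fiberOperator, ← h]
    exact LinearPMap.mem_graph _ u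
  · rintro ⟨u, hu, h⟩
    rw [← mem_graph_fiberOperator, LinearPMap.mem_graph_iff] at h
    obtain ⟨y, hy, h⟩ := h
    simp only at hy h
    exact ⟨y, by rwa [hy], by rw [h, hy]⟩

theorem mem_eigenvalues_evenFiberOperator {b k E : ℝ} :
    E ∈ eigenvalues (evenFiberOperator b k) ↔
      ∃ u : L2R, u ≠ 0 ∧ u ∈ evenSubspace ∧ IsFiberPair b k u ((E : ℂ) • u) := by
  constructor
  · rintro ⟨u, hu, h⟩
    have hmem : (u : L2R) ∈ evenSubspace ⊓ (fiberOperator b k).domain := u.2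
    have h1 : evenFiberOperator b k u = fiberOperator b k ⟨u, hmem.2⟩ :=
      LinearPMap.domRestrict_apply rfl
    refine ⟨u, hu, hmem.1, ?_⟩
    rw [← mem_graph_fiberOperator, ← h, h1]
    exact LinearPMap.mem_graph _ (⟨u, hmem.2⟩ : (fiberOperator b k).domain)
  · rintro ⟨u, hu, heven, h⟩
    rw [← mem_graph_fiberOperator, LinearPMap.mem_graph_iff] at h
    obtain ⟨y, hy, h⟩ := h
    simp only at hy h
    have hmem : u ∈ evenSubspace ⊓ (fiberOperator b k).domain := ⟨heven, hy ▸ y.2⟩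
    refine ⟨⟨u, hmem⟩, hu, ?_⟩
    have h1 : evenFiberOperator b k ⟨u, hmem⟩ = fiberOperator b k y :=
      LinearPMap.domRestrict_apply hy.symm
    rw [h1, h]

theorem eigenvalues_fiberOperator {b : ℝ} (hb : 0 < b) (k : ℝ) :
    eigenvalues (fiberOperator b k) =
      {E | 0 ≤ E ∧ (decayingSol b E (-k / b) = 0 ∨ decayingSol' b E (-k / b) = 0)} := by
  ext E
  rw [mem_eigenvalues_fiberOperator, mem_ofPred_eq]
  constructor
  · rintro ⟨u, hu, h⟩
    obtain ⟨hE, c, _, h | h⟩ := eigenfunction_classification hb hu h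
    · exact ⟨hE, Or.inr h.1⟩
    · exact ⟨hE, Or.inl h.1⟩
  · rintro ⟨hE, h⟩
    have hN := overlap_self_pos hb hE (-k / b)
    have hne : ∀ u : L2R, ‖u‖ ^ 2 = 1 ^ 2 * (2 * overlap b E E (-k / b)) → u ≠ 0 := by
      rintro u hu rfl
      simp only [norm_zero] at hu
      linarith
    rcases h with h | h
    · obtain ⟨u, _, h1, h2⟩ := exists_eigenfunction (k := k) (ε := -1) hb hE (by norm_num)
        (by rw [h, mul_zero]) (by ring) 1
      exact ⟨u, hne u h2, h1⟩
    · obtain ⟨u, _, h1, h2⟩ := exists_eigenfunction (k := k) (ε := 1) hb hE (by norm_num)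
        (by ring) (by rw [h, mul_zero]) 1
      exact ⟨u, hne u h2, h1⟩

theorem ae_comp_neg {p : ℝ → Prop} (h : ∀ᵐ x, p x) : ∀ᵐ x, p (-x) :=
  (Measure.measurePreserving_neg (volume : Measure ℝ)).quasiMeasurePreserving.ae h

theorem eigenvalues_evenFiberOperator {b : ℝ} (hb : 0 < b) (k : ℝ) :
    eigenvalues (evenFiberOperator b k) = {E | 0 ≤ E ∧ decayingSol' b E (-k / b) = 0} := by
  ext E
  rw [mem_eigenvalues_evenFiberOperator, mem_ofPred_eq]
  constructor
  · rintro ⟨u, hu, heven, h⟩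
    obtain ⟨hE, c, _, h | ⟨_, g, hg, _, hodd⟩⟩ := eigenfunction_classification hb hu h
    · exact ⟨hE, h.1⟩
    · exfalso
      apply hu
      rw [Lp.eq_zero_iff_ae_eq_zero]
      have heven : ∀ᵐ x, (u : ℝ → ℂ) (-x) = u x := heven
      filter_upwards [heven, hg, ae_comp_neg hg] with x h1 h2 h3
      rw [h2, h3, hodd x] at h1
      rw [h2]
      simpa [eq_comm] using (self_eq_neg.1 h1.symm)
  · rintro ⟨hE, h⟩
    obtain ⟨u, hu, h1, h2⟩ := exists_eigenfunction (k := k) (ε := 1) hb hE (by norm_num)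
      (by ring) (by rw [h, mul_zero]) 1
    refine ⟨u, ?_, ?_, h1⟩
    · rintro rfl
      have hN := overlap_self_pos hb hE (-k / b)
      simp only [norm_zero] at h2
      linarith
    · change ∀ᵐ x, (u : ℝ → ℂ) (-x) = u x
      filter_upwards [hu, ae_comp_neg hu] with x h3 h4
      rw [h3, h4, extendBy_one, extendBy_one, abs_neg]

/-- The energy at which the phase angle at `s` equals `nπ/2`. -/
def energyLevel (b : ℝ) (n : ℕ) (s : ℝ) : ℝ :=
  sInf {E | 0 ≤ E ∧ phaseAngle b E s = n * (Real.pi / 2)}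

theorem energyLevel_eq {b E s : ℝ} {n : ℕ} (hb : 0 < b) (hE : 0 ≤ E)
    (h : phaseAngle b E s = n * (Real.pi / 2)) : energyLevel b n s = E := by
  have : {E | 0 ≤ E ∧ phaseAngle b E s = n * (Real.pi / 2)} = {E} := by
    ext e
    constructor
    · rintro ⟨_, he⟩
      exact (strictMono_phaseAngle hb s).injective (he.trans h.symm)
    · rintro rfl
      exact ⟨hE, h⟩
  rw [energyLevel, this, csInf_singleton]

/-- Intermediate values in the energy, between the negative angle at `0` and an arbitrarily large
one. -/
theorem energyLevel_spec {b : ℝ} (hb : 0 < b) (n : ℕ) (s : ℝ) :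
    0 < energyLevel b n s ∧ phaseAngle b (energyLevel b n s) s = n * (Real.pi / 2) := by
  obtain ⟨E₁, hE₁, h₁⟩ := exists_phaseAngle_gt hb s n
  have h0 := (phaseAngle_zero_mem hb s).2
  have hn : 0 ≤ (n : ℝ) * (Real.pi / 2) := by positivity
  have hn' : (n : ℝ) * (Real.pi / 2) ≤ n * Real.pi := by
    apply mul_le_mul_of_nonneg_left _ (Nat.cast_nonneg n)
    linarith [Real.pi_pos]
  obtain ⟨E, hE, hEn⟩ := intermediate_value_Icc hE₁ (continuous_phaseAngle_left hb s).continuousOn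
    ⟨h0.le.trans hn, hn'.trans h₁.le⟩
  rw [energyLevel_eq hb hE.1 hEn]
  refine ⟨lt_of_le_of_ne hE.1 ?_, hEn⟩
  rintro rfl
  simp only at hEn
  linarith

theorem strictMono_energyLevel {b : ℝ} (hb : 0 < b) (s : ℝ) :
    StrictMono fun n => energyLevel b n s := by
  intro m n hmn
  rw [← (strictMono_phaseAngle hb s).lt_iff_lt]
  simp only
  rw [(energyLevel_spec hb m s).2, (energyLevel_spec hb n s).2]
  exact mul_lt_mul_of_pos_right (by exact_mod_cast hmn) (by positivity)

/-- The bound `-π/2` excludes every negative multiple, so the numbering of the levels starts at `0`.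
-/
theorem exists_nat_of_angle {a : ℝ} (h : -(Real.pi / 2) < a) {l : ℤ}
    (hl : a = l * (Real.pi / 2)) : ∃ n : ℕ, (n : ℤ) = l ∧ a = n * (Real.pi / 2) := by
  have h0 : 0 ≤ l := by
    by_contra! hneg
    have h1 : (l : ℝ) ≤ -1 := by
      have : l ≤ -1 := by omega
      exact_mod_cast this
    nlinarith [Real.pi_pos]
  lift l to ℕ using h0
  exact ⟨l, rfl, by simpa using hl⟩

theorem eigenvalues_fiberOperator_eq_range {b : ℝ} (hb : 0 < b) (k : ℝ) :
    eigenvalues (fiberOperator b k) = range fun n => energyLevel b n (-k / b) := by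
  rw [eigenvalues_fiberOperator hb]
  ext E
  constructor
  · rintro ⟨hE, h⟩
    have : ∃ l : ℤ, phaseAngle b E (-k / b) = l * (Real.pi / 2) := by
      rw [decayingSol_eq_zero_iff hb hE, decayingSol'_eq_zero_iff hb hE, Real.cos_eq_zero_iff,
        Real.sin_eq_zero_iff] at h
      rcases h with ⟨l, hl⟩ | ⟨l, hl⟩
      · exact ⟨2 * l + 1, by rw [hl]; push_cast; ring⟩
      · exact ⟨2 * l, by rw [← hl]; push_cast; ring⟩
    obtain ⟨l, hl⟩ := this
    obtain ⟨n, _, hn⟩ := exists_nat_of_angle (neg_pi_div_two_lt_phaseAngle hb hE _) hl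
    exact ⟨n, energyLevel_eq hb hE hn⟩
  · rintro ⟨n, rfl⟩
    obtain ⟨h1, h2⟩ := energyLevel_spec hb n (-k / b)
    refine ⟨h1.le, ?_⟩
    rw [decayingSol_eq_zero_iff hb h1.le, decayingSol'_eq_zero_iff hb h1.le, h2]
    rcases Nat.even_or_odd' n with ⟨m, rfl | rfl⟩
    · right
      rw [Real.sin_eq_zero_iff]
      exact ⟨m, by push_cast; ring⟩
    · left
      rw [Real.cos_eq_zero_iff]
      exact ⟨m, by push_cast; ring⟩

theorem eigenvalues_evenFiberOperator_eq_range {b : ℝ} (hb : 0 < b) (k : ℝ) :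
    eigenvalues (evenFiberOperator b k) = range fun n => energyLevel b (2 * n) (-k / b) := by
  rw [eigenvalues_evenFiberOperator hb]
  ext E
  constructor
  · rintro ⟨hE, h⟩
    rw [decayingSol'_eq_zero_iff hb hE, Real.sin_eq_zero_iff] at h
    obtain ⟨l, hl⟩ := h
    obtain ⟨n, hnl, hn⟩ := exists_nat_of_angle (l := 2 * l)
      (neg_pi_div_two_lt_phaseAngle hb hE (-k / b)) (by rw [← hl]; push_cast; ring)
    obtain ⟨m, rfl⟩ : ∃ m, n = 2 * m := ⟨n / 2, by omega⟩
    exact ⟨m, energyLevel_eq hb hE hn⟩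
  · rintro ⟨n, rfl⟩
    obtain ⟨h1, h2⟩ := energyLevel_spec hb (2 * n) (-k / b)
    refine ⟨h1.le, ?_⟩
    rw [decayingSol'_eq_zero_iff hb h1.le, h2, Real.sin_eq_zero_iff]
    exact ⟨n, by push_cast; ring⟩

theorem eigenvalueList_eq {T : L2R →ₗ.[ℂ] L2R} {a : ℕ → ℝ} (ha : StrictMono a)
    (hT : eigenvalues T = range a) (n : ℕ) : eigenvalueList T n = a n := by
  induction n with
  | zero =>
    rw [eigenvalueList, hT]
    refine IsLeast.csInf_eq ⟨⟨0, rfl⟩, ?_⟩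
    rintro _ ⟨m, rfl⟩
    exact ha.monotone (Nat.zero_le m)
  | succ n ih =>
    rw [eigenvalueList, hT, ih]
    refine IsLeast.csInf_eq ⟨⟨⟨n + 1, rfl⟩, ha (Nat.lt_succ_self n)⟩, ?_⟩
    rintro _ ⟨⟨m, rfl⟩, hm⟩
    exact ha.monotone (ha.lt_iff_lt.1 hm)

theorem bandFunction_eq {b : ℝ} (hb : 0 < b) (n : ℕ) (k : ℝ) :
    bandFunction b n k = energyLevel b (n - 1) (-k / b) :=
  eigenvalueList_eq (strictMono_energyLevel hb (-k / b)) (eigenvalues_fiberOperator_eq_range hb k) _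

theorem evenBandFunction_eq {b : ℝ} (hb : 0 < b) (j : ℕ) (k : ℝ) :
    evenBandFunction b j k = energyLevel b (2 * (j - 1)) (-k / b) :=
  eigenvalueList_eq (a := fun n => energyLevel b (2 * n) (-k / b))
    (fun _ _ h => strictMono_energyLevel hb (-k / b) (by omega))
    (eigenvalues_evenFiberOperator_eq_range hb k) _

/-! ### Normalized eigenfunctions -/

theorem exists_isNormalizedEigenfunction {b k E : ℝ} (hb : 0 < b) (hE : 0 ≤ E)
    (h : decayingSol' b E (-k / b) = 0) : ∃ ψ, IsNormalizedEigenfunction b k E ψ := by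
  have hN := overlap_self_pos hb hE (-k / b)
  set N := 2 * overlap b E E (-k / b) with hNdef
  have hNpos : 0 < N := by linarith
  obtain ⟨u, hu, h1, h2⟩ := exists_eigenfunction (k := k) (ε := 1) hb hE (by norm_num)
    (by ring) (by rw [h, mul_zero]) (Real.sqrt N)⁻¹
  rw [← mem_graph_fiberOperator, LinearPMap.mem_graph_iff] at h1
  obtain ⟨y, hy, h1⟩ := h1
  simp only at hy h1
  refine ⟨fun x => (Real.sqrt N)⁻¹ * decayingSol b E (|x| + -k / b), ?_, y, ?_, ?_, ?_⟩
  · exact continuous_const.mul ((continuous_decayingSol_right hb E).comp (by fun_prop))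
  · rw [hy]
    simpa only [extendBy_one] using hu
  · rw [hy, ← sq_eq_sq₀ (norm_nonneg _) zero_le_one, h2, ← hNdef, inv_pow, Real.sq_sqrt hNpos.le]
    field_simp
  · rw [h1, hy]

/-- Where `u_E'(s) = 0` the odd case would need `u_E(s) = 0` as well. The factor `2` comes from the
two half-lines in the normalization. -/
theorem IsNormalizedEigenfunction.even_and_sq {b k E : ℝ} {ψ : ℝ → ℝ} (hb : 0 < b)
    (h : decayingSol' b E (-k / b) = 0) (hψ : IsNormalizedEigenfunction b k E ψ) :
    Function.Even ψ ∧
      ψ 0 ^ 2 = decayingSol b E (-k / b) ^ 2 / (2 * overlap b E E (-k / b)) := by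
  obtain ⟨hc, y, hy, hnorm, hT⟩ := hψ
  have hpair : IsFiberPair b k (y : L2R) ((E : ℂ) • (y : L2R)) := by
    rw [← mem_graph_fiberOperator, ← hT]
    exact LinearPMap.mem_graph _ y
  have hy0 : (y : L2R) ≠ 0 := by
    intro h0
    rw [h0, norm_zero] at hnorm
    exact zero_ne_one hnorm
  obtain ⟨hE, c, hc0, h1 | h1⟩ := eigenfunction_classification hb hy0 hpair
  · have hψx : ∀ x, (ψ x : ℂ) = c * decayingSol b E (|x| + -k / b) := by
      have hae := hy.symm.trans h1.2
      have := (Continuous.ae_eq_iff_eq volume (by fun_prop) (continuous_const.mul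
        (Complex.continuous_ofReal.comp ((continuous_decayingSol_right hb E).comp
          (by fun_prop))))).1 hae
      exact fun x => congrFun this x
    have hN := overlap_self_pos hb hE (-k / b)
    have hsq : ∀ x, ψ x ^ 2 = ‖c‖ ^ 2 * decayingSol b E (|x| + -k / b) ^ 2 := by
      intro x
      have := congrArg (fun z : ℂ => ‖z‖ ^ 2) (hψx x)
      simpa [mul_pow] using this
    refine ⟨fun x => ?_, ?_⟩
    · have := hψx (-x)
      rw [abs_neg, ← hψx x] at this
      exact_mod_cast this
    · have h2 : ‖(y : L2R)‖ ^ 2 = ‖c‖ ^ 2 * (2 * overlap b E E (-k / b)) := by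
        rw [norm_sq_eq_integral hy, ← integral_decayingSol_abs_sq, ← integral_const_mul]
        apply integral_congr_ae
        filter_upwards with x
        rw [Complex.norm_real, Real.norm_eq_abs, sq_abs, hsq]
      rw [hnorm] at h2
      have h3 := hsq 0
      rw [abs_zero, zero_add] at h3
      rw [h3, eq_div_iff (by positivity)]
      linear_combination (-decayingSol b E (-k / b) ^ 2) * h2
  · exact absurd ⟨h1.1, h⟩ (decayingSol_ne_zero hb hE _)

/-! ### The Landau levels -/

/-- Hermite polynomials scaled so that `P_n(t) exp(-b t²/2)` are the oscillator eigenfunctions. -/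
def scaledHermite (b : ℝ) : ℕ → Polynomial ℝ
  | 0 => 1
  | n + 1 => Polynomial.C (2 * b) * Polynomial.X * scaledHermite b n -
      Polynomial.derivative (scaledHermite b n)

theorem natDegree_scaledHermite_le (b : ℝ) (n : ℕ) : (scaledHermite b n).natDegree ≤ n := by
  induction n with
  | zero => simp [scaledHermite]
  | succ n ih =>
    rw [scaledHermite]
    refine (Polynomial.natDegree_sub_le _ _).trans (max_le ?_ ?_)
    · refine Polynomial.natDegree_mul_le.trans ?_
      have : (Polynomial.C (2 * b) * Polynomial.X).natDegree ≤ 1 :=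
        (Polynomial.natDegree_C_mul_le _ _).trans Polynomial.natDegree_X_le
      omega
    · have := Polynomial.natDegree_derivative_le (scaledHermite b n)
      omega

theorem scaledHermite_ode (b : ℝ) (n : ℕ) :
    Polynomial.derivative (scaledHermite b (n + 1)) =
        Polynomial.C (2 * b * (n + 1)) * scaledHermite b n ∧
      Polynomial.derivative (Polynomial.derivative (scaledHermite b n)) =
        Polynomial.C (2 * b) * Polynomial.X * Polynomial.derivative (scaledHermite b n) -
          Polynomial.C (2 * b * n) * scaledHermite b n := by
  induction n with
  | zero => simp [scaledHermite]
  | succ n ih =>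
    obtain ⟨h1, _⟩ := ih
    have h2 : Polynomial.derivative (Polynomial.derivative (scaledHermite b (n + 1))) =
        Polynomial.C (2 * b) * Polynomial.X * Polynomial.derivative (scaledHermite b (n + 1)) -
          Polynomial.C (2 * b * (n + 1 : ℕ)) * scaledHermite b (n + 1) := by
      rw [h1, Polynomial.derivative_C_mul]
      conv_rhs => rw [scaledHermite]
      push_cast
      ring
    refine ⟨?_, h2⟩
    rw [scaledHermite, Polynomial.derivative_sub, h2, mul_assoc, Polynomial.derivative_C_mul,
      Polynomial.derivative_mul, Polynomial.derivative_X]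
    push_cast
    simp only [map_mul, map_add, map_one, Polynomial.C_ofNat]
    ring

theorem scaledHermite_ne_zero {b : ℝ} (hb : 0 < b) (n : ℕ) : scaledHermite b n ≠ 0 := by
  induction n with
  | zero => simp [scaledHermite]
  | succ n ih =>
    intro h
    have h1 := (scaledHermite_ode b n).1
    rw [h, Polynomial.derivative_zero] at h1
    refine mul_ne_zero ?_ ih h1.symm
    rw [Ne, Polynomial.C_eq_zero]
    positivity

theorem eval_neg_scaledHermite (b : ℝ) (n : ℕ) (x : ℝ) :
    (scaledHermite b n).eval (-x) = (-1) ^ n * (scaledHermite b n).eval x ∧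
      (Polynomial.derivative (scaledHermite b n)).eval (-x) =
        -(-1) ^ n * (Polynomial.derivative (scaledHermite b n)).eval x := by
  induction n with
  | zero => simp [scaledHermite]
  | succ n ih =>
    obtain ⟨h1, h2⟩ := ih
    constructor
    · simp only [scaledHermite, Polynomial.eval_sub, Polynomial.eval_mul, Polynomial.eval_C,
        Polynomial.eval_X, h1, h2]
      ring
    · rw [(scaledHermite_ode b n).1]
      simp only [Polynomial.eval_mul, Polynomial.eval_C, h1]
      ring

def landauSol (b : ℝ) (n : ℕ) (t : ℝ) : ℝ :=
  Real.exp (-(b * t ^ 2 / 2)) * (scaledHermite b n).eval t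

def landauSol' (b : ℝ) (n : ℕ) (t : ℝ) : ℝ :=
  Real.exp (-(b * t ^ 2 / 2)) *
    ((Polynomial.derivative (scaledHermite b n)).eval t - b * t * (scaledHermite b n).eval t)

theorem landauSol_neg (b : ℝ) (n : ℕ) (t : ℝ) :
    landauSol b n (-t) = (-1) ^ n * landauSol b n t ∧
      landauSol' b n (-t) = -(-1) ^ n * landauSol' b n t := by
  obtain ⟨h1, h2⟩ := eval_neg_scaledHermite b n t
  unfold landauSol landauSol'
  rw [h1, h2, neg_sq]
  constructor <;> ring

theorem solvesOn_landauSol (b : ℝ) (n : ℕ) :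
    SolvesOn (fun t => b ^ 2 * t ^ 2 - (2 * n + 1) * b) (landauSol b n) (landauSol' b n) univ := by
  intro t _
  have he : HasDerivAt (fun t : ℝ => Real.exp (-(b * t ^ 2 / 2)))
      (Real.exp (-(b * t ^ 2 / 2)) * (-(b * (↑(2 : ℕ) * t ^ (2 - 1)) / 2))) t :=
    (((hasDerivAt_pow 2 t).const_mul b).div_const 2).neg.exp
  have hp := (scaledHermite b n).hasDerivAt t
  have hp' := (Polynomial.derivative (scaledHermite b n)).hasDerivAt t
  have ht : HasDerivAt (fun t : ℝ => b * t) (b * 1) t := (hasDerivAt_id t).const_mul b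
  constructor
  · refine (he.mul hp).congr_deriv ?_
    rw [landauSol']
    push_cast
    ring
  · refine (he.mul (hp'.sub (ht.mul hp))).congr_deriv ?_
    rw [(scaledHermite_ode b n).2]
    simp only [Pi.sub_apply, Pi.mul_apply, Polynomial.eval_sub, Polynomial.eval_mul,
      Polynomial.eval_C, Polynomial.eval_X, landauSol]
    push_cast
    ring

theorem exists_eval_le_exp (p : Polynomial ℝ) : ∃ C, ∀ t, |p.eval t| ≤ C * Real.exp |t| := by
  induction p using Polynomial.induction_on' with
  | add p q hp hq =>
    obtain ⟨C, hC⟩ := hp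
    obtain ⟨D, hD⟩ := hq
    refine ⟨C + D, fun t => ?_⟩
    rw [Polynomial.eval_add, add_mul]
    exact (abs_add_le _ _).trans (add_le_add (hC t) (hD t))
  | monomial n a =>
    refine ⟨|a| * n.factorial, fun t => ?_⟩
    rw [Polynomial.eval_monomial, abs_mul, abs_pow, mul_assoc]
    apply mul_le_mul_of_nonneg_left _ (abs_nonneg a)
    have := Real.pow_div_factorial_le_exp |t| (abs_nonneg t) n
    rw [div_le_iff₀ (by positivity)] at this
    linarith

theorem integrableOn_landauSol_sq {b : ℝ} (hb : 0 < b) (n : ℕ) :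
    IntegrableOn (fun t => landauSol b n t ^ 2) (Ioi 0) := by
  obtain ⟨C, hC⟩ := exists_eval_le_exp (scaledHermite b n)
  have hc : Continuous (landauSol b n) := by
    unfold landauSol
    fun_prop
  refine Integrable.mono' ((integrable_exp_linear_sub_sq hb 2).const_mul (C ^ 2)).integrableOn
    (hc.pow 2).aestronglyMeasurable ?_
  refine (ae_restrict_iff' measurableSet_Ioi).2 (Eventually.of_forall fun t ht => ?_)
  have h1 := hC t
  rw [abs_of_pos (show 0 < t from ht)] at h1
  have h2 : (scaledHermite b n).eval t ^ 2 ≤ (C * Real.exp t) ^ 2 := by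
    rw [← sq_abs]
    gcongr
  rw [Real.norm_of_nonneg (sq_nonneg _), landauSol, mul_pow]
  calc _ ≤ Real.exp (-(b * t ^ 2 / 2)) ^ 2 * (C * Real.exp t) ^ 2 := by gcongr
    _ = C ^ 2 * Real.exp (2 * t - b * t ^ 2) := by
      rw [mul_pow, ← Real.exp_nat_mul, ← Real.exp_nat_mul, mul_left_comm, ← Real.exp_add]
      congr 2
      push_cast
      ring

/-- At the Landau levels the decaying solution is the Hermite function. -/
theorem landauSol_eq {b : ℝ} (hb : 0 < b) (n : ℕ) :
    ∃ c, c ≠ 0 ∧ ∀ t, landauSol b n t = c * decayingSol b ((2 * n + 1) * b) t ∧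
      landauSol' b n t = c * decayingSol' b ((2 * n + 1) * b) t := by
  have hE : 0 ≤ (2 * (n : ℝ) + 1) * b := by positivity
  obtain ⟨c, hc⟩ := decayingSol_unique (s := 0) (u := landauSol b n) (v := landauSol' b n) hb hE
    (by simpa using (solvesOn_landauSol b n).mono (subset_univ _)) (integrableOn_landauSol_sq hb n)
  have h0 := hc 0 le_rfl
  rw [add_zero] at h0
  have hall : ∀ t, landauSol b n t = c * decayingSol b ((2 * n + 1) * b) t ∧
      landauSol' b n t = c * decayingSol' b ((2 * n + 1) * b) t := by
    intro t
    have := ((solvesOn_landauSol b n).sub_mul (solvesOn_decayingSol hb _) c).eq_zero (a := 0)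
      (by fun_prop) (sub_eq_zero.2 h0.1) (sub_eq_zero.2 h0.2) t
    exact ⟨sub_eq_zero.1 this.1, sub_eq_zero.1 this.2⟩
  refine ⟨c, ?_, hall⟩
  rintro rfl
  apply scaledHermite_ne_zero hb n
  apply Polynomial.funext
  intro t
  have h1 := (hall t).1
  rw [zero_mul, landauSol] at h1
  rw [(mul_eq_zero.1 h1).resolve_left (Real.exp_pos _).ne', Polynomial.eval_zero]

theorem decayingSol_landau_neg {b : ℝ} (hb : 0 < b) (n : ℕ) (t : ℝ) :
    decayingSol b ((2 * n + 1) * b) (-t) = (-1) ^ n * decayingSol b ((2 * n + 1) * b) t ∧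
      decayingSol' b ((2 * n + 1) * b) (-t) =
        -(-1) ^ n * decayingSol' b ((2 * n + 1) * b) t := by
  obtain ⟨c, hc, h⟩ := landauSol_eq hb n
  obtain ⟨h1, h2⟩ := landauSol_neg b n t
  rw [(h _).1, (h _).1] at h1
  rw [(h _).2, (h _).2] at h2
  constructor <;> apply mul_left_cancel₀ hc
  · rw [h1]; ring
  · rw [h2]; ring

/-- By parity each Hermite function has `u(0) = 0` or `u'(0) = 0`, so the angle at `0` is a
nonnegative multiple of `π/2`. It increases strictly with the energy, hence by at least `π/2` per
level. -/
theorem phaseAngle_landau_zero {b : ℝ} (hb : 0 < b) (n : ℕ) :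
    n * (Real.pi / 2) ≤ phaseAngle b ((2 * n + 1) * b) 0 := by
  have hint : ∀ n : ℕ, ∃ m : ℕ, phaseAngle b ((2 * n + 1) * b) 0 = m * (Real.pi / 2) := by
    intro n
    have hE : 0 ≤ (2 * (n : ℝ) + 1) * b := by positivity
    obtain ⟨h1, h2⟩ := decayingSol_landau_neg hb n 0
    rw [neg_zero] at h1 h2
    have : ∃ l : ℤ, phaseAngle b ((2 * n + 1) * b) 0 = l * (Real.pi / 2) := by
      rcases Nat.even_or_odd n with hn | hn
      · rw [hn.neg_one_pow] at h2
        have h3 : decayingSol' b ((2 * n + 1) * b) 0 = 0 := by linarith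
        rw [decayingSol'_eq_zero_iff hb hE, Real.sin_eq_zero_iff] at h3
        obtain ⟨l, hl⟩ := h3
        exact ⟨2 * l, by rw [← hl]; push_cast; ring⟩
      · rw [hn.neg_one_pow] at h1
        have h3 : decayingSol b ((2 * n + 1) * b) 0 = 0 := by linarith
        rw [decayingSol_eq_zero_iff hb hE, Real.cos_eq_zero_iff] at h3
        obtain ⟨l, hl⟩ := h3
        exact ⟨2 * l + 1, by rw [hl]; push_cast; ring⟩
    obtain ⟨l, hl⟩ := this
    obtain ⟨m, _, hm⟩ := exists_nat_of_angle (neg_pi_div_two_lt_phaseAngle hb hE 0) hl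
    exact ⟨m, hm⟩
  have hpi : 0 < Real.pi / 2 := by positivity
  induction n with
  | zero =>
    obtain ⟨m, hm⟩ := hint 0
    rw [hm]
    push_cast
    rw [zero_mul]
    positivity
  | succ n ih =>
    obtain ⟨m, hm⟩ := hint (n + 1)
    have h1 : phaseAngle b ((2 * n + 1) * b) 0 < phaseAngle b ((2 * (n + 1 : ℕ) + 1) * b) 0 := by
      apply strictMono_phaseAngle hb 0
      push_cast
      nlinarith
    rw [hm] at h1 ⊢
    have h2 : (n : ℝ) < m := lt_of_mul_lt_mul_right (ih.trans_lt h1) hpi.le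
    have h3 : n + 1 ≤ m := by exact_mod_cast h2
    apply mul_le_mul_of_nonneg_right _ hpi.le
    exact_mod_cast h3

/-- The Hermite function of degree `n` has at most `n` zeros. -/
theorem phaseAngle_landau_lt {b : ℝ} (hb : 0 < b) (n : ℕ) (s : ℝ) :
    phaseAngle b ((2 * n + 1) * b) s < Real.pi / 2 + n * Real.pi := by
  by_contra! hge
  set E := (2 * (n : ℝ) + 1) * b with hEdef
  have hE : 0 ≤ E := by positivity
  obtain ⟨c, hc, h⟩ := landauSol_eq hb n
  set T := |s| + (E + 1) / b with hT
  have hTs : s ≤ T := by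
    have : 0 ≤ (E + 1) / b := by positivity
    linarith [le_abs_self s]
  have hneg : phaseAngle b E T < 0 := by
    apply phaseAngle_neg hb hE
    intro t ht
    have h1 : E + 1 ≤ b * t := by
      have h2 : (E + 1) / b ≤ t := by linarith [abs_nonneg s]
      rw [div_le_iff₀ hb] at h2
      linarith
    nlinarith
  -- If the angle reached `π/2 + nπ` at `s`, then, being negative at `T`, it would take all `n + 1`
  -- values `π/2 + iπ`, giving more zeros than the degree of the polynomial allows.
  have hz : ∀ i : Fin (n + 1), ∃ t, phaseAngle b E t = Real.pi / 2 + (i : ℕ) * Real.pi := by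
    intro i
    have hi : ((i : ℕ) : ℝ) ≤ n := by exact_mod_cast Nat.lt_succ_iff.1 i.2
    have h1 := mul_le_mul_of_nonneg_right hi Real.pi_pos.le
    have h2 : 0 ≤ ((i : ℕ) : ℝ) * Real.pi := by positivity
    obtain ⟨t, _, ht⟩ := intermediate_value_Icc' hTs
      (continuous_phaseAngle_right hb E).continuousOn
      (show Real.pi / 2 + (i : ℕ) * Real.pi ∈ Icc (phaseAngle b E T) (phaseAngle b E s) from
        ⟨by linarith [Real.pi_pos], by linarith⟩)
    exact ⟨t, ht⟩
  choose z hz using hz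
  refine scaledHermite_ne_zero hb n (Polynomial.eq_zero_of_natDegree_lt_card_of_eval_eq_zero
    (scaledHermite b n) (f := z) ?_ ?_ ?_)
  · intro i j hij
    have h1 := hz i
    rw [hij, hz j] at h1
    have h2 : ((j : ℕ) : ℝ) = (i : ℕ) := mul_right_cancel₀ Real.pi_ne_zero (by linarith)
    exact Fin.ext (by exact_mod_cast h2.symm)
  · intro i
    have h1 : decayingSol b E (z i) = 0 := by
      rw [decayingSol_eq_zero_iff hb hE, hz i]
      exact_mod_cast cos_level (i : ℕ)
    have h2 := (h (z i)).1
    rw [h1, mul_zero, landauSol] at h2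
    exact (mul_eq_zero.1 h2).resolve_left (Real.exp_pos _).ne'
  · rw [Fintype.card_fin]
    exact Nat.lt_succ_of_le (natDegree_scaledHermite_le b n)

theorem eq_of_continuous_of_sin_eq_zero {f : ℝ → ℝ} (hf : Continuous f)
    (h : ∀ t, Real.sin (f t) = 0) (s t : ℝ) : f s = f t := by
  have hpre : ∀ v ∈ range f, Real.sin v = 0 := by
    rintro _ ⟨x, rfl⟩
    exact h x
  have key : ∀ s t, f s < f t → False := by
    intro s t hst
    obtain ⟨m, hm⟩ := Real.sin_eq_zero_iff.1 (h s)
    obtain ⟨l, hl⟩ := Real.sin_eq_zero_iff.1 (h t)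
    have hml : (m : ℝ) < l := by
      rw [← hm, ← hl] at hst
      exact lt_of_mul_lt_mul_right hst Real.pi_pos.le
    have hml' : (m : ℝ) + 1 ≤ l := by
      have : m < l := by exact_mod_cast hml
      exact_mod_cast this
    have h2 := mul_le_mul_of_nonneg_right hml' Real.pi_pos.le
    -- Two distinct multiples of `π` in the range would enclose this value, at which the sine is
    -- `cos (f s) ≠ 0`.
    have hv : f s + Real.pi / 2 ∈ range f :=
      mem_range_of_exists_le_of_exists_ge hf ⟨s, by linarith [Real.pi_pos]⟩
        ⟨t, by linarith [Real.pi_pos]⟩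
    have h3 := hpre _ hv
    have h4 := Real.sin_sq_add_cos_sq (f s)
    rw [Real.sin_add_pi_div_two] at h3
    rw [h s, h3] at h4
    norm_num at h4
  rcases lt_trichotomy (f s) (f t) with h1 | h1 | h1
  · exact (key s t h1).elim
  · exact h1
  · exact (key t s h1).elim

/-- The reflection symmetry of the phase angle at the Landau levels. -/
theorem phaseAngle_landau_add_neg {b : ℝ} (hb : 0 < b) (n : ℕ) (t : ℝ) :
    phaseAngle b ((2 * n + 1) * b) t + phaseAngle b ((2 * n + 1) * b) (-t) =
      2 * phaseAngle b ((2 * n + 1) * b) 0 := by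
  set E := (2 * (n : ℝ) + 1) * b with hEdef
  have hE : 0 ≤ E := by positivity
  have hc := continuous_phaseAngle_right hb E
  have := eq_of_continuous_of_sin_eq_zero
    (f := fun t => phaseAngle b E t + phaseAngle b E (-t)) (by fun_prop) (fun t => ?_) t 0
  · simp only [neg_zero] at this
    linarith
  · obtain ⟨h1, h2⟩ := decayingSol_landau_neg hb n t
    rw [← hEdef] at h1 h2
    obtain ⟨a1, a2⟩ := decayingSol_eq_cos hb hE t
    obtain ⟨b1, b2⟩ := decayingSol_eq_cos hb hE (-t)
    have r1 := (phaseRadius_pos hb hE t).ne'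
    have r2 := (phaseRadius_pos hb hE (-t)).ne'
    apply mul_left_cancel₀ (mul_ne_zero r1 r2)
    rw [Real.sin_add, mul_zero]
    calc _ = phaseRadius b E t * Real.sin (phaseAngle b E t) *
            (phaseRadius b E (-t) * Real.cos (phaseAngle b E (-t))) +
          phaseRadius b E t * Real.cos (phaseAngle b E t) *
            (phaseRadius b E (-t) * Real.sin (phaseAngle b E (-t))) := by ring
      _ = 0 := by
        rw [← a1, ← a2, ← b1, ← b2, h1, h2]
        ring

/-- To the right of the turning point the angle is negative; the reflection symmetry transfers this
to the left, with `2 θ(0) ≥ nπ`. -/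
theorem phaseAngle_landau_gt {b : ℝ} (hb : 0 < b) (n : ℕ) {t : ℝ} (ht0 : 0 ≤ t)
    (ht : (2 * n + 1) * b ≤ b ^ 2 * t ^ 2) :
    n * Real.pi < phaseAngle b ((2 * n + 1) * b) (-t) := by
  have h1 := phaseAngle_landau_add_neg hb n t
  have h2 := phaseAngle_landau_zero hb n
  have h3 : phaseAngle b ((2 * n + 1) * b) t < 0 := by
    apply phaseAngle_neg hb (by positivity)
    intro t' ht'
    refine ht.trans ?_
    gcongr
  linarith

/-! ### Regularity of the band functions -/

/-- Strict monotonicity in the energy brackets the level between `E - ε` and `E + ε`, and the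
bracketing inequalities are open in `s`. -/
theorem continuous_energyLevel {b : ℝ} (hb : 0 < b) (n : ℕ) :
    Continuous fun s => energyLevel b n s := by
  refine continuous_iff_continuousAt.2 fun s => Metric.continuousAt_iff'.2 fun ε hε => ?_
  set E := energyLevel b n s with hE
  have hspec := (energyLevel_spec hb n s).2
  have h1 : ∀ᶠ t in 𝓝 s, phaseAngle b (E - ε) t < n * (Real.pi / 2) := by
    apply (continuous_phaseAngle_right hb (E - ε)).continuousAt.eventually_lt_const
    rw [← hspec]
    exact strictMono_phaseAngle hb s (by linarith)
  have h2 : ∀ᶠ t in 𝓝 s, n * (Real.pi / 2) < phaseAngle b (E + ε) t := by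
    apply (continuous_phaseAngle_right hb (E + ε)).continuousAt.eventually_const_lt
    rw [← hspec]
    exact strictMono_phaseAngle hb s (by linarith)
  filter_upwards [h1, h2] with t h1 h2
  rw [← (energyLevel_spec hb n t).2] at h1 h2
  have h3 := (strictMono_phaseAngle hb t).lt_iff_lt.1 h1
  have h4 := (strictMono_phaseAngle hb t).lt_iff_lt.1 h2
  rw [Real.dist_eq, abs_lt]
  constructor <;> linarith

theorem decayingSol'_energyLevel {b : ℝ} (hb : 0 < b) (m : ℕ) (s : ℝ) :
    decayingSol' b (energyLevel b (2 * m) s) s = 0 := by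
  obtain ⟨h1, h2⟩ := energyLevel_spec hb (2 * m) s
  rw [decayingSol'_eq_zero_iff hb h1.le, h2, Real.sin_eq_zero_iff]
  exact ⟨m, by push_cast; ring⟩

/-- The Feynman–Hellmann type formula for the even levels. -/
theorem hasDerivAt_energyLevel {b : ℝ} (hb : 0 < b) (m : ℕ) (s : ℝ) :
    HasDerivAt (fun s => energyLevel b (2 * m) s)
      ((energyLevel b (2 * m) s - b ^ 2 * s ^ 2) *
        (decayingSol b (energyLevel b (2 * m) s) s ^ 2 /
          overlap b (energyLevel b (2 * m) s) (energyLevel b (2 * m) s) s)) s := by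
  set W : ℝ → ℝ := fun s => energyLevel b (2 * m) s with hW
  have hWc : Continuous W := continuous_energyLevel hb (2 * m)
  change HasDerivAt W ((W s - b ^ 2 * s ^ 2) * (decayingSol b (W s) s ^ 2 /
    overlap b (W s) (W s) s)) s
  -- The mean of `u''` over the segment from `s` to `t` at energy `W t`. As `u'` vanishes at `t`,
  -- its value at `s` is `-(t - s) Φ t`; the Wronskian identity at `s` then expresses `W t - W s` as
  -- `t - s` times a continuous function.
  set Φ : ℝ → ℝ := fun t => ∫ θ in (0 : ℝ)..1,
    (b ^ 2 * (s + θ * (t - s)) ^ 2 - W t) * decayingSol b (W t) (s + θ * (t - s)) with hΦ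
  have hΦc : Continuous Φ := by
    apply intervalIntegral.continuous_parametric_intervalIntegral_of_continuous'
      (f := fun t θ => (b ^ 2 * (s + θ * (t - s)) ^ 2 - W t) *
        decayingSol b (W t) (s + θ * (t - s)))
    have h1 := (continuous_decayingSol hb).comp
      (by fun_prop : Continuous fun q : ℝ × ℝ => (W q.1, s + q.2 * (q.1 - s)))
    exact Continuous.mul (by fun_prop) h1
  have hΦeq : ∀ t, decayingSol' b (W t) s = -((t - s) * Φ t) := by
    intro t
    have hd : ∀ θ ∈ uIcc (0 : ℝ) 1, HasDerivAt (fun θ => decayingSol' b (W t) (s + θ * (t - s)))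
        ((t - s) * ((b ^ 2 * (s + θ * (t - s)) ^ 2 - W t) *
          decayingSol b (W t) (s + θ * (t - s)))) θ := by
      intro θ _
      have h1 : HasDerivAt (fun θ : ℝ => s + θ * (t - s)) (1 * (t - s)) θ :=
        ((hasDerivAt_id θ).mul_const _).const_add s
      exact ((hasDerivAt_decayingSol' hb (W t) _).comp θ h1).congr_deriv (by ring)
    have hi : Continuous fun θ : ℝ => (t - s) * ((b ^ 2 * (s + θ * (t - s)) ^ 2 - W t) *
        decayingSol b (W t) (s + θ * (t - s))) :=
      continuous_const.mul (Continuous.mul (by fun_prop)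
        ((continuous_decayingSol_right hb (W t)).comp (by fun_prop)))
    have := intervalIntegral.integral_eq_sub_of_hasDerivAt hd (hi.intervalIntegrable _ _)
    rw [intervalIntegral.integral_const_mul] at this
    simp only [zero_mul, add_zero, one_mul] at this
    rw [show s + (t - s) = t by ring, decayingSol'_energyLevel hb m t, zero_sub] at this
    simp only [hΦ]
    linarith
  set N : ℝ → ℝ := fun t => overlap b (W s) (W t) s with hN
  have hNc : Continuous N := (continuous_overlap hb).comp
    (by fun_prop : Continuous fun t : ℝ => ((W s, W t), s))
  have hN0 : 0 < N s := overlap_self_pos hb (energyLevel_spec hb (2 * m) s).1.le s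
  have hf : ContinuousWithinAt (fun t => -(decayingSol b (W s) s * Φ t) / N t) univ s :=
    ((continuous_const.mul hΦc).neg.continuousAt.div hNc.continuousAt
      hN0.ne').continuousWithinAt
  have hmain := (hasDerivWithinAt_univ.1 (hasDerivWithinAt_sub_mul hf)).const_add (W s)
  have heq : W =ᶠ[𝓝 s] fun t => W s + (t - s) * (-(decayingSol b (W s) s * Φ t) / N t) := by
    filter_upwards [hNc.continuousAt.eventually_const_lt hN0] with t ht
    have h1 := wronskian_decayingSol hb (W s) (W t) s
    rw [decayingSol'_energyLevel hb m s, hΦeq t, zero_mul, sub_zero] at h1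
    have h2 : W t - W s = (t - s) * (-(decayingSol b (W s) s * Φ t) / N t) := by
      rw [← mul_div_assoc, eq_div_iff ht.ne']
      linear_combination -h1
    linarith
  refine (hmain.congr_of_eventuallyEq heq).congr_deriv ?_
  have hΦs : Φ s = (b ^ 2 * s ^ 2 - W s) * decayingSol b (W s) s := by
    simp [hΦ]
  rw [hΦs]
  simp only [hN]
  ring

/-! ### The shape of the even bands and the location of the minimum -/

/-- Gives `ω''` at the critical point: the factor `k² - ω` vanishes there, so the continuity of `D`
suffices. -/
theorem hasDerivAt_mul_of_eq_zero {f g : ℝ → ℝ} {f' a : ℝ} (hf : HasDerivAt f f' a)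
    (hf0 : f a = 0) (hg : ContinuousAt g a) : HasDerivAt (fun x => f x * g x) (f' * g a) a := by
  rw [hasDerivAt_iff_tendsto_slope] at hf ⊢
  refine (hf.mul (hg.tendsto.mono_left nhdsWithin_le_nhds)).congr fun x => ?_
  simp only [slope_def_field, hf0]
  ring

/-- The shape of a solution of `ω' = (k² - ω) D`, `D > 0`, lying above `k²` for `k ≤ 0`. -/
theorem band_shape {ω D : ℝ → ℝ} {M : ℝ} (hD : ∀ k, 0 < D k) (hDc : Continuous D)
    (hω : ∀ k, HasDerivAt ω ((k ^ 2 - ω k) * D k) k) (hneg : ∀ k, k ≤ 0 → k ^ 2 < ω k)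
    (h0 : ω 0 ≤ M) :
    ∃ κ, 0 < κ ∧ κ < Real.sqrt M ∧
      (∀ k, deriv ω k = 0 ↔ k = κ) ∧
      (∀ k, IsLocalExtr ω k ↔ k = κ) ∧
      (∀ k, k ≠ κ → ω κ < ω k) ∧
      (∀ k, ω k - k ^ 2 = 0 ↔ k = κ) ∧
      ω κ = κ ^ 2 ∧
      HasDerivAt (deriv ω) (2 * κ * D κ) κ ∧
      (∀ k, k < κ → deriv ω k < 0) ∧
      (∀ k, κ < k → 0 < deriv ω k) := by
  have hωc : Continuous ω := continuous_iff_continuousAt.2 fun k => (hω k).continuousAt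
  have hderiv : ∀ k, deriv ω k = (k ^ 2 - ω k) * D k := fun k => (hω k).deriv
  set g : ℝ → ℝ := fun k => ω k - k ^ 2 with hg
  have hgc : Continuous g := by fun_prop
  have hcross : ∀ x y, x < y → g x ≤ 0 → g y < 0 := by
    intro x y hxy hx
    refine lt_of_crossing hgc.continuousOn hxy (fun z _ hz => ?_) hx
    have hz0 : 0 < z := by
      by_contra! h
      have := hneg z h
      simp only [hg] at hz
      linarith
    refine ⟨-(2 * z), by linarith, ((hω z).sub (hasDerivAt_pow 2 z)).congr_deriv ?_⟩
    simp only [hg] at hz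
    push_cast
    linear_combination (-D z) * hz
  have hω0 : 0 < ω 0 := by simpa using hneg 0 le_rfl
  have hM : 0 < M := hω0.trans_le h0
  set K := Real.sqrt M with hK
  have hKpos : 0 < K := Real.sqrt_pos.2 hM
  have hK2 : K ^ 2 = M := Real.sq_sqrt hM.le
  -- Otherwise `ω > k²` to the left of `K = √M`, so `ω` decreases strictly on `[0, K]` and `ω(K) <
  -- ω(0) ≤ M = K²`.
  have hgK : g K < 0 := by
    by_contra! hge
    have hpos : ∀ x, x < K → 0 < g x := by
      intro x hx
      by_contra! h
      linarith [hcross x K hx h]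
    have hanti : StrictAntiOn ω (Icc 0 K) := by
      apply strictAntiOn_of_deriv_neg (convex_Icc 0 K) hωc.continuousOn
      intro x hx
      rw [interior_Icc] at hx
      rw [hderiv]
      have := hpos x hx.2
      simp only [hg] at this
      exact mul_neg_of_neg_of_pos (by linarith) (hD x)
    have := hanti ⟨le_rfl, hKpos.le⟩ ⟨hKpos.le, le_rfl⟩ hKpos
    simp only [hg] at hge
    linarith
  obtain ⟨κ, hκ, hκ0⟩ := intermediate_value_Icc' hKpos.le hgc.continuousOn
    (show (0 : ℝ) ∈ Icc (g K) (g 0) from ⟨hgK.le, by simpa [hg] using hω0.le⟩)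
  have hκpos : 0 < κ := by
    by_contra! h
    have := hneg κ h
    simp only [hg] at hκ0
    linarith
  have hκK : κ < K := lt_of_le_of_ne hκ.2 (by rintro h; rw [← h] at hgK; linarith)
  have hleft : ∀ k, k < κ → 0 < g k := by
    intro k hk
    by_contra! h
    linarith [hcross k κ hk h]
  have hright : ∀ k, κ < k → g k < 0 := fun k hk => hcross κ k hk hκ0.le
  have hdleft : ∀ k, k < κ → deriv ω k < 0 := by
    intro k hk
    rw [hderiv]
    have := hleft k hk
    simp only [hg] at this
    exact mul_neg_of_neg_of_pos (by linarith) (hD k)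
  have hdright : ∀ k, κ < k → 0 < deriv ω k := by
    intro k hk
    rw [hderiv]
    have := hright k hk
    simp only [hg] at this
    exact mul_pos (by linarith) (hD k)
  have hωκ : ω κ = κ ^ 2 := sub_eq_zero.1 hκ0
  have hcrit : ∀ k, deriv ω k = 0 ↔ k = κ := by
    intro k
    constructor
    · intro h
      rcases lt_trichotomy k κ with hk | hk | hk
      · exact absurd h (hdleft k hk).ne
      · exact hk
      · exact absurd h (hdright k hk).ne'
    · rintro rfl
      rw [hderiv, hωκ, sub_self, zero_mul]
  have hmin : ∀ k, k ≠ κ → ω κ < ω k := by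
    intro k hk
    rcases lt_or_gt_of_ne hk with hk | hk
    · have : StrictAntiOn ω (Iic κ) := by
        apply strictAntiOn_of_deriv_neg (convex_Iic κ) hωc.continuousOn
        intro x hx
        rw [interior_Iic] at hx
        exact hdleft x hx
      exact this hk.le self_mem_Iic hk
    · have : StrictMonoOn ω (Ici κ) := by
        apply strictMonoOn_of_deriv_pos (convex_Ici κ) hωc.continuousOn
        intro x hx
        rw [interior_Ici] at hx
        exact hdright x hx
      exact this self_mem_Ici (le_of_lt hk) hk
  refine ⟨κ, hκpos, hκK, hcrit, fun k => ⟨fun h => (hcrit k).1 h.deriv_eq_zero, ?_⟩, hmin,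
    fun k => ⟨fun h => ?_, ?_⟩, hωκ, ?_, hdleft, hdright⟩
  · rintro rfl
    refine Or.inl (Eventually.of_forall fun x => ?_)
    rcases eq_or_ne x k with rfl | hx
    · exact le_rfl
    · exact (hmin x hx).le
  · rcases lt_trichotomy k κ with hk | hk | hk
    · exact absurd h (hleft k hk).ne'
    · exact hk
    · exact absurd h (hright k hk).ne
  · rintro rfl
    exact hκ0
  · have h1 : HasDerivAt (fun k => k ^ 2 - ω k) (2 * κ) κ := by
      refine ((hasDerivAt_pow 2 κ).sub (hω κ)).congr_deriv ?_
      rw [hωκ]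
      push_cast
      ring
    have h2 := hasDerivAt_mul_of_eq_zero h1 (by rw [hωκ, sub_self]) hDc.continuousAt
    rwa [show deriv ω = fun k => (k ^ 2 - ω k) * D k from funext hderiv]

theorem landauLevel_succ (b : ℝ) (m : ℕ) : landauLevel b (m + 1) = (2 * m + 1) * b := by
  rw [landauLevel, if_neg (Nat.succ_ne_zero m)]
  push_cast
  ring

/-- Otherwise `[s, ∞)` is classically forbidden and `u u' < 0` at `s`, where `u' = 0`. This is `k² <
ω(k)` for `k ≤ 0`. -/
theorem sq_lt_energyLevel {b : ℝ} (hb : 0 < b) (m : ℕ) {s : ℝ} (hs : 0 ≤ s) :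
    b ^ 2 * s ^ 2 < energyLevel b (2 * m) s := by
  by_contra! h
  have := decayingSol_mul_neg hb (energyLevel_spec hb (2 * m) s).1.le (s := s) fun t ht =>
    h.trans (by gcongr)
  rw [decayingSol'_energyLevel hb m s, mul_zero] at this
  exact lt_irrefl _ this

theorem energyLevel_zero_le {b : ℝ} (hb : 0 < b) (n : ℕ) :
    energyLevel b n 0 ≤ (2 * n + 1) * b := by
  rw [← (strictMono_phaseAngle hb 0).le_iff_le, (energyLevel_spec hb n 0).2]
  exact phaseAngle_landau_zero hb n

/-- For `m ≥ 1` the angle at the `m`-th Landau level stays below `mπ - π/2`, whereas the even level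
has angle `mπ`. -/
theorem landauLevel_lt_energyLevel {b : ℝ} (hb : 0 < b) (m : ℕ) (s : ℝ) :
    landauLevel b m < energyLevel b (2 * m) s := by
  obtain ⟨h1, h2⟩ := energyLevel_spec hb (2 * m) s
  rcases m with _ | m
  · simpa [landauLevel] using h1
  · rw [landauLevel_succ, ← (strictMono_phaseAngle hb s).lt_iff_lt]
    rw [h2]
    refine (phaseAngle_landau_lt hb m s).trans ?_
    push_cast
    linarith [Real.pi_pos]

/-- An even level at the left turning point lies below the Landau level. -/
theorem energyLevel_lt_landauLevel {b : ℝ} (hb : 0 < b) (m : ℕ) {t : ℝ} (ht : 0 ≤ t)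
    (h : energyLevel b (2 * m) (-t) = b ^ 2 * t ^ 2) :
    energyLevel b (2 * m) (-t) < landauLevel b (m + 1) := by
  rw [landauLevel_succ]
  by_contra! hle
  -- If the level were at least `(2m+1) b`, then `-t` would be at or left of the turning point of
  -- that Landau energy, whose angle there exceeds `mπ`, the angle of the level itself.
  have h1 := phaseAngle_landau_gt hb m ht (hle.trans h.le)
  have h2 := (strictMono_phaseAngle hb (-t)).monotone hle
  rw [(energyLevel_spec hb (2 * m) (-t)).2] at h2
  push_cast at h2
  linarith

/-- The density `u(s)² / (b ∫_s^∞ u²)` governing the slope of an even band. -/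
def bandDensity (b : ℝ) (m : ℕ) (k : ℝ) : ℝ :=
  decayingSol b (energyLevel b (2 * m) (-k / b)) (-k / b) ^ 2 /
    (b * overlap b (energyLevel b (2 * m) (-k / b)) (energyLevel b (2 * m) (-k / b)) (-k / b))

theorem bandDensity_pos {b : ℝ} (hb : 0 < b) (m : ℕ) (k : ℝ) : 0 < bandDensity b m k := by
  have hE := (energyLevel_spec hb (2 * m) (-k / b)).1.le
  have h0 : decayingSol b (energyLevel b (2 * m) (-k / b)) (-k / b) ≠ 0 := fun h =>
    decayingSol_ne_zero hb hE _ ⟨h, decayingSol'_energyLevel hb m _⟩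
  have := overlap_self_pos hb hE (-k / b)
  unfold bandDensity
  positivity

theorem continuous_decayingSol_comp {b : ℝ} (hb : 0 < b) {W s : ℝ → ℝ} (hW : Continuous W)
    (hs : Continuous s) : Continuous fun k => decayingSol b (W k) (s k) :=
  (continuous_decayingSol hb).comp (hW.prodMk hs)

theorem continuous_overlap_comp {b : ℝ} (hb : 0 < b) {W s : ℝ → ℝ} (hW : Continuous W)
    (hs : Continuous s) : Continuous fun k => overlap b (W k) (W k) (s k) :=
  (continuous_overlap hb).comp ((hW.prodMk hW).prodMk hs)

theorem continuous_bandDensity {b : ℝ} (hb : 0 < b) (m : ℕ) : Continuous (bandDensity b m) := by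
  have hs : Continuous fun k : ℝ => -k / b := by fun_prop
  have hW : Continuous fun k : ℝ => energyLevel b (2 * m) (-k / b) :=
    (continuous_energyLevel hb (2 * m)).comp hs
  exact ((continuous_decayingSol_comp hb hW hs).pow 2).div
    (continuous_const.mul (continuous_overlap_comp hb hW hs)) fun k =>
    (mul_pos hb (overlap_self_pos hb (energyLevel_spec hb (2 * m) (-k / b)).1.le _)).ne'

theorem hasDerivAt_evenBand {b : ℝ} (hb : 0 < b) (m : ℕ) (k : ℝ) :
    HasDerivAt (fun k => energyLevel b (2 * m) (-k / b))
      ((k ^ 2 - energyLevel b (2 * m) (-k / b)) * bandDensity b m k) k := by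
  have h1 : HasDerivAt (fun k : ℝ => -k / b) (-1 / b) k := (hasDerivAt_neg k).div_const b
  refine ((hasDerivAt_energyLevel hb m (-k / b)).comp k h1).congr_deriv ?_
  have hN := (overlap_self_pos hb (energyLevel_spec hb (2 * m) (-k / b)).1.le (-k / b)).ne'
  have e : b ^ 2 * (-k / b) ^ 2 = k ^ 2 := by
    field_simp
  rw [bandDensity, e]
  generalize overlap b _ _ _ = N at *
  generalize decayingSol b _ _ = U
  generalize energyLevel b (2 * m) (-k / b) = W
  field_simp
  ring

end MagneticEdge

end

theorem mainTheorem2 (b : ℝ) (hb : 0 < b) (j : ℕ) (hj : 1 ≤ j) :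
    -- the band function of index `2j - 1` is the `j`-th even one, and its eigenstates are even
    (∀ k : ℝ,
      MagneticEdge.evenBandFunction b j k = MagneticEdge.bandFunction b (2 * j - 1) k ∧
      (∃ ψ : ℝ → ℝ, MagneticEdge.IsNormalizedEigenfunction b k
        (MagneticEdge.bandFunction b (2 * j - 1) k) ψ) ∧
      (∀ ψ : ℝ → ℝ, MagneticEdge.IsNormalizedEigenfunction b k
        (MagneticEdge.bandFunction b (2 * j - 1) k) ψ → Function.Even ψ)) ∧
    Differentiable ℝ (MagneticEdge.bandFunction b (2 * j - 1)) ∧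
    ∃ κ : ℝ,
      0 < κ ∧ κ < Real.sqrt (MagneticEdge.landauLevel b (2 * j - 1)) ∧
      -- the only critical point, the only local extremum, and a strict global minimum
      (∀ k : ℝ, deriv (MagneticEdge.bandFunction b (2 * j - 1)) k = 0 ↔ k = κ) ∧
      (∀ k : ℝ, IsLocalExtr (MagneticEdge.bandFunction b (2 * j - 1)) k ↔ k = κ) ∧
      (∀ k : ℝ, k ≠ κ →
        MagneticEdge.bandFunction b (2 * j - 1) κ < MagneticEdge.bandFunction b (2 * j - 1) k) ∧
      -- the only solution of `ω(k) = k²`, and the location of the minimum value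
      (∀ k : ℝ, MagneticEdge.bandFunction b (2 * j - 1) k - k ^ 2 = 0 ↔ k = κ) ∧
      MagneticEdge.bandFunction b (2 * j - 1) κ = κ ^ 2 ∧
      MagneticEdge.landauLevel b (j - 1) < MagneticEdge.bandFunction b (2 * j - 1) κ ∧
      MagneticEdge.bandFunction b (2 * j - 1) κ < MagneticEdge.landauLevel b j ∧
      -- the second derivative at the minimum
      (∀ ψ : ℝ → ℝ, MagneticEdge.IsNormalizedEigenfunction b κ
        (MagneticEdge.bandFunction b (2 * j - 1) κ) ψ →
        HasDerivAt (deriv (MagneticEdge.bandFunction b (2 * j - 1)))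
          (4 * κ / b * ψ 0 ^ 2) κ ∧ 0 < 4 * κ / b * ψ 0 ^ 2) ∧
      (∀ k : ℝ, k < κ → deriv (MagneticEdge.bandFunction b (2 * j - 1)) k < 0) ∧
      (∀ k : ℝ, κ < k → 0 < deriv (MagneticEdge.bandFunction b (2 * j - 1)) k) := by
  obtain ⟨m, rfl⟩ : ∃ m, j = m + 1 := ⟨j - 1, by omega⟩
  have hband : MagneticEdge.bandFunction b (2 * (m + 1) - 1) =
      fun k => MagneticEdge.energyLevel b (2 * m) (-k / b) := funext fun k => by
    rw [MagneticEdge.bandFunction_eq hb]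
    congr 1
  have hlevel : MagneticEdge.landauLevel b (2 * (m + 1) - 1) = (2 * (2 * m : ℕ) + 1) * b := by
    rw [show 2 * (m + 1) - 1 = 2 * m + 1 by omega, MagneticEdge.landauLevel_succ]
  have hU' : ∀ k, MagneticEdge.decayingSol' b (MagneticEdge.energyLevel b (2 * m) (-k / b))
      (-k / b) = 0 := fun k => MagneticEdge.decayingSol'_energyLevel hb m _
  rw [hband, hlevel, Nat.add_sub_cancel]
  refine ⟨fun k => ⟨?_, ?_, fun ψ hψ => ?_⟩,
    fun k => (MagneticEdge.hasDerivAt_evenBand hb m k).differentiableAt, ?_⟩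
  · rw [MagneticEdge.evenBandFunction_eq hb, Nat.add_sub_cancel]
  · exact MagneticEdge.exists_isNormalizedEigenfunction hb
      (MagneticEdge.energyLevel_spec hb _ _).1.le (hU' k)
  · exact (hψ.even_and_sq hb (hU' k)).1
  have hsq : ∀ k : ℝ, b ^ 2 * (-k / b) ^ 2 = k ^ 2 := fun k => by field_simp
  obtain ⟨κ, hκ0, hκM, hcrit, hext, hmin, huniq, hval, hsecond, hleft, hright⟩ :=
    -- `M` is the Landau level of index `2j - 1 = 2m + 1`; the zero-based index of the band is `2m`,
    -- and at `k = 0` its value is bounded by that of the Hermite function of degree `2m`.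
    MagneticEdge.band_shape (M := (2 * (2 * m : ℕ) + 1) * b) (MagneticEdge.bandDensity_pos hb m)
      (MagneticEdge.continuous_bandDensity hb m) (MagneticEdge.hasDerivAt_evenBand hb m)
      (fun k hk => by
        rw [← hsq k]
        exact MagneticEdge.sq_lt_energyLevel hb m (div_nonneg (by linarith) hb.le))
      (by
        rw [neg_zero, zero_div]
        exact MagneticEdge.energyLevel_zero_le hb (2 * m))
  refine ⟨κ, hκ0, hκM, hcrit, hext, hmin, huniq, hval,
    MagneticEdge.landauLevel_lt_energyLevel hb m _, ?_, fun ψ hψ => ?_, hleft, hright⟩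
  · have := MagneticEdge.energyLevel_lt_landauLevel hb m (t := κ / b) (by positivity)
    rw [← neg_div] at this
    exact this (by rw [hval, ← hsq κ, neg_div, neg_sq])
  · have h1 : 4 * κ / b * ψ 0 ^ 2 = 2 * κ * MagneticEdge.bandDensity b m κ := by
      have hN := (MagneticEdge.overlap_self_pos hb
        (MagneticEdge.energyLevel_spec hb (2 * m) (-κ / b)).1.le (-κ / b)).ne'
      rw [(hψ.even_and_sq hb (hU' κ)).2, MagneticEdge.bandDensity]
      generalize MagneticEdge.overlap b _ _ _ = N at *
      field_simp
      ring
    rw [h1]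
    exact ⟨hsecond, mul_pos (by positivity) (MagneticEdge.bandDensity_pos hb m κ)⟩
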